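/- Let $n\ge 1$, let $(\mathcal C,\Sigma,\Theta)$ be an $(n+2)$-angulated category (in the sense of Geiss–Keller–Oppermann), and let $\mathcal H$ be a full subcategory of $\mathcal C$. Let $\mathbb E=\mathcal C(-,\Sigma-)$ and let $\mathfrak s$ be the realization which assigns to $\delta\in\mathcal C(Z,\Sigma A)$ the class $[X^\bullet]$ of the complexes $A\to X^1\to\cdots\to X^n\to Z$ for which $A\to X^1\to\cdots\to X^n\to Z\xrightarrow{\delta}\Sigma A$ lies in $\Theta$. Denote by $\xi\subseteq\Theta$ the class of $(n+2)$-angles $$X^0\xrightarrow{d^0}X^1\xrightarrow{d^1}\cdots\xrightarrow{d^n}X^{n+1}\xrightarrow{\delta}\Sigma X^0$$ such that $\mathcal C(d^0,H):\mathcal C(X^1,H)\to\mathcal C(X^0,H)$ is surjective for every $H\in\mathcal H$. Let $\mathbb E_\xi(Z,A)\subseteq\mathbb E(Z,A)$ be the set of the $\delta$ that are realized by an $(n+2)$-angle in $\xi$, and let $\mathfrak s_\xi$ be the restriction of $\mathfrak s$ to $\mathbb E_\xi$. A class of distinguished $n$-exangles is called $n$-proper if it contains the split ones ($\delta=0$),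 is closed under finite coproducts, base change, cobase change and weak isomorphisms (morphisms of distinguished $n$-exangles whose components in degrees $0$ and $n+1$ are isomorphisms), and is saturated: whenever $ba=dc$ with $a,b,d$ deflations and $a,b$ last maps of members of the class, $d$ is the last map of a member of the class. An $n$-exangulated category is called $(n+2)$-angulated if it is, up to an isomorphism of bifunctors, the one induced by some $(n+2)$-angulated category with the same underlying additive category; it is called $n$-exact if its conflations are exactly the admissible sequences of an $n$-exact structure (in the sense of Jasso) on the underlying additive category. 1. $\xi$ is an $n$-proper class in $(\mathcal C,\Sigma,\Theta)$; the $\mathbb E_\xi(Z,A)$ are subgroups forming a subfunctor of $\mathbb E$, and $(\mathcal C,\mathbb E_\xi,\mathfrak s_\xi)$ is an $n$-exangulated category. 2. If $(\mathcal C,\mathbb E_\xi,\mathfrak s_\xi)$ is $n$-exact, then $\xi$ is the class of split $(n+2)$-angles, i.e. of those with $\delta=0$. 3. If $(\mathcal C,\mathbb E_\xi,\mathfrak s_\xi)$ is $(n+2)$-angulated, then $\Theta=\xi$. 4. Assume that $\mathcal H$ is strongly covariantly finite, i.e. for every object $B$ there is an $(n+2)$-angle $B\xrightarrow{f}H^1\to\cdots\to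 H^n\to D\to\Sigma B$ with $H^1,\dots,H^n\in\mathcal H$ such that $\mathcal C(f,H)$ is surjective for every $H\in\mathcal H$. Assume also that $\mathcal H$ is closed under direct summands, in the sense that $A\in\mathcal H$ whenever there are $i:A\to H$ and $p:H\to A$ with $H\in\mathcal H$ and $pi=1_A$. If $\mathcal H$ contains a nonzero object and does not contain all objects of $\mathcal C$, then $(\mathcal C,\mathbb E_\xi,\mathfrak s_\xi)$ is neither $n$-exact nor $(n+2)$-angulated. -/

import Mathlib

open CategoryTheory CategoryTheory.Limits Opposite

universe v u

namespace NExang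

variable {C : Type u} [Category.{v} C] [Preadditive C]

/-! ### Complexes concentrated in degrees `0, …, m` -/

/-- A complex in `C` whose components vanish outside the degrees `0, …, m`. -/
structure BCpx (C : Type u) [Category.{v} C] [Preadditive C] (m : ℕ) where
  K : CochainComplex C ℕ
  isZero : ∀ i, m < i → IsZero (K.X i)

/-- An object of the category of complexes `A = X⁰ ⟶ X¹ ⟶ ⋯ ⟶ Xⁿ ⟶ Xⁿ⁺¹ = Z` with prescribed end
terms `A` and `Z`; the end terms are identified with `A` and `Z` by chosen isomorphisms. -/
structure Cpx (n : ℕ) (A Z : C) extends BCpx C (n + 1) where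
  fst : K.X 0 ≅ A
  lst : K.X (n + 1) ≅ Z

namespace Cpx

variable {n : ℕ} {A Z A' Z' : C}

/-- The first differential `d⁰ : A ⟶ X¹`. -/
def ι (X : Cpx n A Z) : A ⟶ X.K.X 1 := X.fst.inv ≫ X.K.d 0 1

/-- The last differential `dⁿ : Xⁿ ⟶ Z`. -/
def π (X : Cpx n A Z) : X.K.X n ⟶ Z := X.K.d n (n + 1) ≫ X.lst.hom

/-- `f` is a morphism of complexes of the form `(a, f¹, …, fⁿ, c)`. -/
def IsLift {X : Cpx n A Z} {Y : Cpx n A' Z'} (f : X.K ⟶ Y.K) (a : A ⟶ A') (c : Z ⟶ Z') : Prop :=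
  f.f 0 ≫ Y.fst.hom = X.fst.hom ≫ a ∧ f.f (n + 1) ≫ Y.lst.hom = X.lst.hom ≫ c

/-- Homotopy equivalence in the category of complexes with end terms `A` and `Z`, whose morphisms
are the identity on `A` and on `Z`. -/
def HEquiv (X Y : Cpx n A Z) : Prop :=
  ∃ (f : X.K ⟶ Y.K) (g : Y.K ⟶ X.K),
    IsLift f (𝟙 A) (𝟙 Z) ∧ IsLift g (𝟙 A) (𝟙 Z) ∧
    Nonempty (Homotopy (f ≫ g) (𝟙 X.K)) ∧ Nonempty (Homotopy (g ≫ f) (𝟙 Y.K))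

end Cpx

/-- A complex of length `n + 2`, seen as a complex with end terms `X⁰` and `Xⁿ⁺¹`. -/
def BCpx.toCpx {n : ℕ} (X : BCpx C (n + 1)) : Cpx n (X.K.X 0) (X.K.X (n + 1)) where
  toBCpx := X
  fst := Iso.refl _
  lst := Iso.refl _

/-! ### Mapping cones and cocones

A complex is exhibited as a cone by its projections `u`, `v` onto the two summands. -/

/-- `M` is (via the projections `u` and `v`) the complex
`K¹ ⟶ K² ⊞ L¹ ⟶ ⋯ ⟶ Kⁿ⁺¹ ⊞ Lⁿ ⟶ Lⁿ⁺¹` with differentials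
`[-d; f]`, `[-d 0; f d]`, …, `[f d]`. -/
structure IsMappingCone [HasBinaryBiproducts C] (n : ℕ) {K L : CochainComplex C ℕ} (f : K ⟶ L)
    (M : CochainComplex C ℕ) (u : ∀ i, M.X i ⟶ K.X (i + 1)) (v : ∀ i, M.X i ⟶ L.X i) : Prop where
  iso_zero : IsIso (u 0)
  v_zero : v 0 = 0
  iso_mid : ∀ i, 1 ≤ i → i ≤ n → IsIso (biprod.lift (u i) (v i))
  iso_last : IsIso (v (n + 1))
  d_u : ∀ i, i < n → M.d i (i + 1) ≫ u (i + 1) = -(u i ≫ K.d (i + 1) (i + 2))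
  d_v : ∀ i, i ≤ n → M.d i (i + 1) ≫ v (i + 1) = u i ≫ f.f (i + 1) + v i ≫ L.d i (i + 1)

/-- `N` is (via the projections `u` and `v`) the complex
`K⁰ ⟶ K¹ ⊞ L⁰ ⟶ ⋯ ⟶ Kⁿ ⊞ Lⁿ⁻¹ ⟶ Lⁿ` with differentials
`[d; f]`, `[d 0; f -d]`, …, `[f -d]`. This is the dual of the mapping cone. -/
structure IsMappingCocone [HasBinaryBiproducts C] (n : ℕ) {K L : CochainComplex C ℕ} (f : K ⟶ L)
    (N : CochainComplex C ℕ) (u : ∀ i, N.X i ⟶ K.X i) (v : ∀ i, N.X (i + 1) ⟶ L.X i) : Prop where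
  iso_zero : IsIso (u 0)
  iso_mid : ∀ i, i < n → IsIso (biprod.lift (u (i + 1)) (v i))
  iso_last : IsIso (v n)
  d_u : ∀ i, i < n → N.d i (i + 1) ≫ u (i + 1) = u i ≫ K.d i (i + 1)
  d_v_zero : N.d 0 1 ≫ v 0 = u 0 ≫ f.f 0
  d_v : ∀ i, i < n →
    N.d (i + 1) (i + 2) ≫ v (i + 1) = u (i + 1) ≫ f.f (i + 1) - v i ≫ L.d i (i + 1)

/-! ### Extensions -/

/-- The group `𝔼(Z, A)` of extensions, for a bifunctor `𝔼 : Cᵒᵖ × C ⟶ Ab`. -/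
abbrev Ext (E : Cᵒᵖ ⥤ C ⥤ AddCommGrpCat.{v}) (Z A : C) : Type v := (E.obj (op Z)).obj A

/-- `a_* δ = 𝔼(Z, a)(δ)`. -/
def push (E : Cᵒᵖ ⥤ C ⥤ AddCommGrpCat.{v}) {Z A A' : C} (a : A ⟶ A') (δ : Ext E Z A) :
    Ext E Z A' := (E.obj (op Z)).map a δ

/-- `c^* δ = 𝔼(c, A)(δ)`. -/
def pull (E : Cᵒᵖ ⥤ C ⥤ AddCommGrpCat.{v}) {Z Z' A : C} (c : Z' ⟶ Z) (δ : Ext E Z A) :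
    Ext E Z' A := (E.map c.op).app A δ

/-- Assigns to `δ ∈ 𝔼(Z, A)` a class of complexes with end terms `A` and `Z`. It serves both for a
realization (`R δ X` means `𝔰(δ) = [X]`) and for a class of pairs `⟨X, δ⟩`. -/
abbrev PairClass (n : ℕ) (E : Cᵒᵖ ⥤ C ⥤ AddCommGrpCat.{v}) : Type (max u v) :=
  ∀ ⦃A Z : C⦄, Ext E Z A → Cpx n A Z → Prop

/-- `⟨X, δ⟩` is an `n`-exangle: the sequences of functors
`C(-, X⁰) ⟶ ⋯ ⟶ C(-, Xⁿ⁺¹) ⟶ 𝔼(-, X⁰)` and `C(Xⁿ⁺¹, -) ⟶ ⋯ ⟶ C(X⁰, -) ⟶ 𝔼(Xⁿ⁺¹, -)`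
are exact. -/
structure IsExangle {n : ℕ} (E : Cᵒᵖ ⥤ C ⥤ AddCommGrpCat.{v}) {A Z : C} (δ : Ext E Z A)
    (X : Cpx n A Z) : Prop where
  exact_left : ∀ (W : C) (i : ℕ), i < n → ∀ x : W ⟶ X.K.X (i + 1),
    x ≫ X.K.d (i + 1) (i + 2) = 0 → ∃ y : W ⟶ X.K.X i, y ≫ X.K.d i (i + 1) = x
  exact_left_last : ∀ (W : C) (x : W ⟶ Z), pull E x δ = 0 ↔ ∃ y : W ⟶ X.K.X n, y ≫ X.π = x
  exact_right : ∀ (W : C) (i : ℕ), i < n → ∀ x : X.K.X (i + 1) ⟶ W,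
    X.K.d i (i + 1) ≫ x = 0 → ∃ y : X.K.X (i + 2) ⟶ W, X.K.d (i + 1) (i + 2) ≫ y = x
  exact_right_last : ∀ (W : C) (x : A ⟶ W), push E x δ = 0 ↔ ∃ y : X.K.X 1 ⟶ W, X.ι ≫ y = x

/-- `f` is the first differential of a complex occurring in `R`: an inflation if `R` is a
realization, a `ξ`-inflation if `R` is a class `ξ` of distinguished `n`-exangles. -/
def IsInflation {n : ℕ} {E : Cᵒᵖ ⥤ C ⥤ AddCommGrpCat.{v}} (R : PairClass n E) {A B : C}
    (f : A ⟶ B) : Prop :=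
  ∃ (Z : C) (δ : Ext E Z A) (X : Cpx n A Z) (e : X.K.X 1 ≅ B), R δ X ∧ X.ι ≫ e.hom = f

/-- `g` is the last differential of a complex occurring in `R`. -/
def IsDeflation {n : ℕ} {E : Cᵒᵖ ⥤ C ⥤ AddCommGrpCat.{v}} (R : PairClass n E) {B Z : C}
    (g : B ⟶ Z) : Prop :=
  ∃ (A : C) (δ : Ext E Z A) (X : Cpx n A Z) (e : X.K.X n ≅ B), R δ X ∧ e.inv ≫ X.π = g

/-- `(C, 𝔼, 𝔰)` is an `n`-exangulated category. -/
structure IsNExangulated [HasBinaryBiproducts C] (n : ℕ) (E : Cᵒᵖ ⥤ C ⥤ AddCommGrpCat.{v})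
    (s : PairClass n E) : Prop where
  push_add : ∀ {Z A A' : C} (a b : A ⟶ A') (δ : Ext E Z A),
    push E (a + b) δ = push E a δ + push E b δ
  pull_add : ∀ {Z Z' A : C} (c d : Z' ⟶ Z) (δ : Ext E Z A),
    pull E (c + d) δ = pull E c δ + pull E d δ
  /-- `𝔰(δ)` is a homotopy equivalence class. -/
  htpyClass : ∀ {A Z : C} (δ : Ext E Z A), ∃ X : Cpx n A Z, ∀ Y : Cpx n A Z, s δ Y ↔ X.HEquiv Y
  /-- (R0) -/
  lift : ∀ {A Z A' Z' : C} (δ : Ext E Z A) (ρ : Ext E Z' A') (X : Cpx n A Z) (Y : Cpx n A' Z'),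
    s δ X → s ρ Y → ∀ (a : A ⟶ A') (c : Z ⟶ Z'), push E a δ = pull E c ρ →
      ∃ f : X.K ⟶ Y.K, Cpx.IsLift f a c
  /-- (R1) -/
  exangle : ∀ {A Z : C} (δ : Ext E Z A) (X : Cpx n A Z), s δ X → IsExangle E δ X
  /-- (R2): `𝔰(0) = [A = A ⟶ 0 ⟶ ⋯ ⟶ 0]` -/
  zero_right : ∀ {A Z : C} (X : Cpx n A Z), IsIso (X.K.d 0 1) →
    (∀ i, 2 ≤ i → IsZero (X.K.X i)) → s (0 : Ext E Z A) X
  /-- (R2), dual part: `𝔰(0) = [0 ⟶ ⋯ ⟶ 0 ⟶ Z = Z]` -/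
  zero_left : ∀ {A Z : C} (X : Cpx n A Z), IsIso (X.K.d n (n + 1)) →
    (∀ i, i < n → IsZero (X.K.X i)) → s (0 : Ext E Z A) X
  /-- (EA1) -/
  inflation_comp : ∀ {A B D : C} (f : A ⟶ B) (g : B ⟶ D),
    IsInflation s f → IsInflation s g → IsInflation s (f ≫ g)
  deflation_comp : ∀ {A B D : C} (f : A ⟶ B) (g : B ⟶ D),
    IsDeflation s f → IsDeflation s g → IsDeflation s (f ≫ g)
  /-- (EA2): `(1, c)` has a good lift `f`, one whose mapping cone realizes `(d_X⁰)_* ρ` -/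
  good_lift : ∀ {A Z D : C} (ρ : Ext E D A) (c : Z ⟶ D) (X : Cpx n A Z) (Y : Cpx n A D),
    s (pull E c ρ) X → s ρ Y → ∃ f : X.K ⟶ Y.K, Cpx.IsLift f (𝟙 A) c ∧
      ∃ (M : Cpx n (X.K.X 1) D) (u : ∀ i, M.K.X i ⟶ X.K.X (i + 1)) (v : ∀ i, M.K.X i ⟶ Y.K.X i),
        IsMappingCone n f M.K u v ∧ M.fst.hom = u 0 ∧ M.lst.hom = v (n + 1) ≫ Y.lst.hom ∧
        s (push E X.ι ρ) M
  /-- (EA2ᵒᵖ): `(a, 1)` has a good lift `h`, one whose mapping cocone realizes `(d_Yⁿ)^* ρ` -/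
  good_colift : ∀ {A A' Z : C} (ρ : Ext E Z A) (a : A ⟶ A') (X : Cpx n A Z) (Y : Cpx n A' Z),
    s ρ X → s (push E a ρ) Y → ∃ h : X.K ⟶ Y.K, Cpx.IsLift h a (𝟙 Z) ∧
      ∃ (N : Cpx n A (Y.K.X n)) (u : ∀ i, N.K.X i ⟶ X.K.X i) (v : ∀ i, N.K.X (i + 1) ⟶ Y.K.X i),
        IsMappingCocone n h N.K u v ∧ N.fst.hom = u 0 ≫ X.fst.hom ∧ N.lst.hom = v n ∧
        s (pull E Y.π ρ) N

/-! ### `n`-proper classes -/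

/-- `⟨W, ω⟩` is a direct sum of `⟨X, δ⟩` and `⟨Y, ρ⟩`, i.e. `W = X ⊕ Y` and `ω = δ ⊕ ρ`. -/
def IsExangleSum {n : ℕ} (E : Cᵒᵖ ⥤ C ⥤ AddCommGrpCat.{v}) {A Z A' Z' A'' Z'' : C}
    (δ : Ext E Z A) (X : Cpx n A Z) (ρ : Ext E Z' A') (Y : Cpx n A' Z')
    (ω : Ext E Z'' A'') (W : Cpx n A'' Z'') : Prop :=
  ∃ (i₁ : X.K ⟶ W.K) (p₁ : W.K ⟶ X.K) (i₂ : Y.K ⟶ W.K) (p₂ : W.K ⟶ Y.K),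
    i₁ ≫ p₁ = 𝟙 _ ∧ i₂ ≫ p₂ = 𝟙 _ ∧ p₁ ≫ i₁ + p₂ ≫ i₂ = 𝟙 _ ∧
    (∃ a c, Cpx.IsLift i₁ a c ∧ push E a δ = pull E c ω) ∧
    (∃ a c, Cpx.IsLift p₁ a c ∧ push E a ω = pull E c δ) ∧
    (∃ a c, Cpx.IsLift i₂ a c ∧ push E a ρ = pull E c ω) ∧
    (∃ a c, Cpx.IsLift p₂ a c ∧ push E a ω = pull E c ρ)

/-- `ξ` is an `n`-proper class of distinguished `n`-exangles of `(C, 𝔼, 𝔰)`. -/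
structure IsProperClass {n : ℕ} (E : Cᵒᵖ ⥤ C ⥤ AddCommGrpCat.{v}) (s ξ : PairClass n E) :
    Prop where
  distinguished : ∀ {A Z : C} (δ : Ext E Z A) (X : Cpx n A Z), ξ δ X → s δ X
  /-- `ξ` contains the split distinguished `n`-exangles. -/
  split : ∀ {A Z : C} (X : Cpx n A Z), s (0 : Ext E Z A) X → ξ (0 : Ext E Z A) X
  weakIso : ∀ {A Z A' Z' : C} (δ : Ext E Z A) (X : Cpx n A Z) (ρ : Ext E Z' A') (Y : Cpx n A' Z')
    (f : X.K ⟶ Y.K) (a : A ⟶ A') (c : Z ⟶ Z'), s δ X → s ρ Y → Cpx.IsLift f a c →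
    push E a δ = pull E c ρ → IsIso a → IsIso c → (ξ δ X ↔ ξ ρ Y)
  /-- Binary coproducts; the empty one is a split distinguished `n`-exangle. -/
  coprod : ∀ {A Z A' Z' A'' Z'' : C} (δ : Ext E Z A) (X : Cpx n A Z) (ρ : Ext E Z' A')
    (Y : Cpx n A' Z') (ω : Ext E Z'' A'') (W : Cpx n A'' Z''),
    ξ δ X → ξ ρ Y → IsExangleSum E δ X ρ Y ω W → ξ ω W
  baseChange : ∀ {A Z Z' : C} (δ : Ext E Z A) (X : Cpx n A Z) (c : Z' ⟶ Z) (Y : Cpx n A Z'),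
    ξ δ X → s (pull E c δ) Y → ξ (pull E c δ) Y
  cobaseChange : ∀ {A A' Z : C} (δ : Ext E Z A) (X : Cpx n A Z) (a : A ⟶ A') (Y : Cpx n A' Z),
    ξ δ X → s (push E a δ) Y → ξ (push E a δ) Y
  saturated : ∀ {A B B' D : C} (a : A ⟶ B) (b : B ⟶ D) (c : A ⟶ B') (d : B' ⟶ D),
    a ≫ b = c ≫ d → IsDeflation s d → IsDeflation ξ a → IsDeflation ξ b → IsDeflation ξ d

/-- A subfunctor of the bifunctor `E`, given by subgroups. -/
structure SubExt (E : Cᵒᵖ ⥤ C ⥤ AddCommGrpCat.{v}) where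
  carrier : ∀ Z A : C, AddSubgroup (Ext E Z A)
  push_mem : ∀ {Z A A' : C} (a : A ⟶ A') (δ : Ext E Z A),
    δ ∈ carrier Z A → push E a δ ∈ carrier Z A'
  pull_mem : ∀ {Z Z' A : C} (c : Z' ⟶ Z) (δ : Ext E Z A),
    δ ∈ carrier Z A → pull E c δ ∈ carrier Z' A

namespace SubExt

variable {E : Cᵒᵖ ⥤ C ⥤ AddCommGrpCat.{v}}

/-- A subfunctor as a bifunctor. -/
def functor (F : SubExt E) : Cᵒᵖ ⥤ C ⥤ AddCommGrpCat.{v} where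
  obj Z :=
    { obj := fun A => AddCommGrpCat.of (F.carrier Z.unop A)
      map := fun {A A'} a => AddCommGrpCat.ofHom
        ((((E.obj Z).map a).hom.comp (F.carrier Z.unop A).subtype).codRestrict
          (F.carrier Z.unop A') (fun δ => F.push_mem (Z := Z.unop) a δ.1 δ.2))
      map_id := by intro A; ext δ; simp
      map_comp := by intro A B D a b; ext δ; simp; rfl }
  map {Z Z'} c :=
    { app := fun A => AddCommGrpCat.ofHom
        ((((E.map c).app A).hom.comp (F.carrier Z.unop A).subtype).codRestrict
          (F.carrier Z'.unop A) (fun δ => F.pull_mem c.unop δ.1 δ.2))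
      naturality := by
        intro A B a; ext δ
        exact ConcreteCategory.congr_hom ((E.map c).naturality a) δ.1 }
  map_id := by intro Z; ext A δ; simp
  map_comp := by intro Z Z' Z'' c d; ext A δ; simp; rfl

/-- The inclusion of a subfunctor. -/
def incl (F : SubExt E) {Z A : C} (δ : Ext F.functor Z A) : Ext E Z A :=
  (F.carrier Z A).subtype δ

/-- The restriction of a realization to a subfunctor. -/
def restrict (F : SubExt E) {n : ℕ} (s : PairClass n E) : PairClass n F.functor :=
  fun _ _ δ X => s (F.incl δ) X

end SubExt

/-- `𝔼_ξ(Z, A)`: the extensions in `𝔼(Z, A)` that are realized by an `n`-exangle in `ξ`. -/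
def extOf {n : ℕ} {E : Cᵒᵖ ⥤ C ⥤ AddCommGrpCat.{v}} (ξ : PairClass n E) (Z A : C) :
    Set (Ext E Z A) := {δ | ∃ X : Cpx n A Z, ξ δ X}

/-! ### `(n+2)`-angulated categories -/

/-- A sequence `X⁰ ⟶ X¹ ⟶ ⋯ ⟶ Xⁿ⁺¹ ⟶ S X⁰`. Consecutive differentials compose to zero, as they do
in every `(n+2)`-angle. -/
structure SigmaSeq (n : ℕ) (S : C ⥤ C) extends BCpx C (n + 1) where
  δ : K.X (n + 1) ⟶ S.obj (K.X 0)

variable {n : ℕ} {S : C ⥤ C}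

/-- Morphisms of sequences `X⁰ ⟶ ⋯ ⟶ Xⁿ⁺¹ ⟶ S X⁰`. -/
def SigmaSeq.IsHom {X Y : SigmaSeq n S} (f : X.K ⟶ Y.K) : Prop :=
  X.δ ≫ S.map (f.f 0) = f.f (n + 1) ≫ Y.δ

/-- `W` is a direct sum of `X` and `Y`. -/
def SigmaSeq.IsSum (X Y W : SigmaSeq n S) : Prop :=
  ∃ (i₁ : X.K ⟶ W.K) (p₁ : W.K ⟶ X.K) (i₂ : Y.K ⟶ W.K) (p₂ : W.K ⟶ Y.K),
    i₁ ≫ p₁ = 𝟙 _ ∧ i₂ ≫ p₂ = 𝟙 _ ∧ p₁ ≫ i₁ + p₂ ≫ i₂ = 𝟙 _ ∧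
    IsHom i₁ ∧ IsHom p₁ ∧ IsHom i₂ ∧ IsHom p₂

/-- `Y` is (isomorphic to) the left rotation
`X¹ ⟶ X² ⟶ ⋯ ⟶ Xⁿ⁺¹ ⟶ S X⁰ ⟶ S X¹` of `X`, the last map being `(-1)ⁿ S d⁰`. -/
def SigmaSeq.IsRotation (X Y : SigmaSeq n S) : Prop :=
  ∃ (p : ∀ i, Y.K.X i ⟶ X.K.X (i + 1)) (t : Y.K.X (n + 1) ≅ S.obj (X.K.X 0)),
    (∀ i, i ≤ n → IsIso (p i)) ∧
    (∀ i, i < n → Y.K.d i (i + 1) ≫ p (i + 1) = p i ≫ X.K.d (i + 1) (i + 2)) ∧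
    Y.K.d n (n + 1) ≫ t.hom = p n ≫ X.δ ∧
    Y.δ ≫ S.map (p 0) = (-1 : ℤ) ^ n • (t.hom ≫ S.map (X.K.d 0 1))

/-- `W` is (isomorphic to) the mapping cone of `f : X ⟶ Y`,
`X¹ ⊞ Y⁰ ⟶ X² ⊞ Y¹ ⟶ ⋯ ⟶ Xⁿ⁺¹ ⊞ Yⁿ ⟶ S X⁰ ⊞ Yⁿ⁺¹ ⟶ S X¹ ⊞ S Y⁰`, with differentials
`[-d 0; f d]`; it is exhibited by its projections `u`, `w` and `v`. -/
def SigmaSeq.IsCone [HasBinaryBiproducts C] {X Y : SigmaSeq n S} (f : X.K ⟶ Y.K)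
    (W : SigmaSeq n S) : Prop :=
  ∃ (u : ∀ i, W.K.X i ⟶ X.K.X (i + 1)) (w : W.K.X (n + 1) ⟶ S.obj (X.K.X 0))
    (v : ∀ i, W.K.X i ⟶ Y.K.X i),
    (∀ i, i ≤ n → IsIso (biprod.lift (u i) (v i))) ∧ IsIso (biprod.lift w (v (n + 1))) ∧
    (∀ i, i < n → W.K.d i (i + 1) ≫ u (i + 1) = -(u i ≫ X.K.d (i + 1) (i + 2))) ∧
    W.K.d n (n + 1) ≫ w = -(u n ≫ X.δ) ∧
    (∀ i, i ≤ n →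
      W.K.d i (i + 1) ≫ v (i + 1) = u i ≫ f.f (i + 1) + v i ≫ Y.K.d i (i + 1)) ∧
    W.δ ≫ S.map (u 0) = -(w ≫ S.map (X.K.d 0 1)) ∧
    W.δ ≫ S.map (v 0) = w ≫ S.map (f.f 0) + v (n + 1) ≫ Y.δ

/-- The axioms (F1)–(F4) of Geiss, Keller and Oppermann: `Θ` is the class of `(n+2)`-angles of an
`(n+2)`-angulated category `(C, S, Θ)`. -/
structure IsAngulation [HasBinaryBiproducts C] (Θ : Set (SigmaSeq n S)) : Prop where
  sum_mem : ∀ X Y W, SigmaSeq.IsSum X Y W → X ∈ Θ → Y ∈ Θ → W ∈ Θ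
  summand_mem : ∀ X Y W, SigmaSeq.IsSum X Y W → W ∈ Θ → X ∈ Θ
  /-- The trivial sequence `A = A ⟶ 0 ⟶ ⋯ ⟶ 0 ⟶ S A` is an `(n+2)`-angle. -/
  trivial_mem : ∀ A : C, ∃ X ∈ Θ, Nonempty (X.K.X 0 ≅ A) ∧ IsIso (X.K.d 0 1) ∧
    ∀ i, 2 ≤ i → IsZero (X.K.X i)
  exists_mem : ∀ {A B : C} (f : A ⟶ B), ∃ X ∈ Θ, ∃ (e₀ : X.K.X 0 ≅ A) (e₁ : X.K.X 1 ≅ B),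
    e₀.inv ≫ X.K.d 0 1 ≫ e₁.hom = f
  rotation : ∀ X Y, SigmaSeq.IsRotation X Y → (X ∈ Θ ↔ Y ∈ Θ)
  /-- (F3) and (F4) -/
  exists_hom : ∀ X ∈ Θ, ∀ Y ∈ Θ, ∀ (a : X.K.X 0 ⟶ Y.K.X 0) (b : X.K.X 1 ⟶ Y.K.X 1),
    X.K.d 0 1 ≫ b = a ≫ Y.K.d 0 1 →
    ∃ f : X.K ⟶ Y.K, SigmaSeq.IsHom f ∧ f.f 0 = a ∧ f.f 1 = b ∧
      ∃ W ∈ Θ, SigmaSeq.IsCone f W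

/-- The bifunctor `𝔼(Z, A) = C(Z, S A)`. -/
def shiftExt (S : C ⥤ C) : Cᵒᵖ ⥤ C ⥤ AddCommGrpCat.{v} where
  obj Z :=
    { obj := fun A => AddCommGrpCat.of (Z.unop ⟶ S.obj A)
      map := fun a => AddCommGrpCat.ofHom (Preadditive.rightComp _ (S.map a))
      map_id := by intro A; ext δ; simp [Preadditive.rightComp]
      map_comp := by intro A B D a b; ext δ; simp [Preadditive.rightComp] }
  map c :=
    { app := fun A => AddCommGrpCat.ofHom (Preadditive.leftComp _ c.unop)
      naturality := by
        intro A B a; ext δ; simp [Preadditive.rightComp, Preadditive.leftComp] }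
  map_id := by intro Z; ext A δ; simp [Preadditive.leftComp]
  map_comp := by intro Z Z' Z'' c d; ext A δ; simp [Preadditive.leftComp]

/-- `X⁰ ≅ A ⟶ X¹ ⟶ ⋯ ⟶ Z ⟶ S A` as a sequence `X⁰ ⟶ ⋯ ⟶ Xⁿ⁺¹ ⟶ S X⁰`. -/
def Cpx.toSigmaSeq {A Z : C} (X : Cpx n A Z) (δ : Z ⟶ S.obj A) : SigmaSeq n S where
  toBCpx := X.toBCpx
  δ := X.lst.hom ≫ δ ≫ S.map X.fst.inv

/-- The pairs `⟨X, δ⟩` induced by a class of sequences `X⁰ ⟶ ⋯ ⟶ Xⁿ⁺¹ ⟶ S X⁰`. For the class of all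
`(n+2)`-angles this is the realization of the `n`-exangulated category induced by the
`(n+2)`-angulated category. -/
def induced (Θ : Set (SigmaSeq n S)) : PairClass n (shiftExt S) :=
  fun _ _ δ X => X.toSigmaSeq δ ∈ Θ

/-- `(C, 𝔼, 𝔰)` is an `(n+2)`-angulated category: up to an isomorphism of bifunctors it is the
`n`-exangulated category induced by some `(n+2)`-angulated category `(C, T, Φ)`. -/
def IsAngulatedExt [HasBinaryBiproducts C] {n : ℕ} (E : Cᵒᵖ ⥤ C ⥤ AddCommGrpCat.{v})
    (s : PairClass n E) : Prop :=
  ∃ (T : C ⥤ C) (Φ : Set (SigmaSeq n T)) (η : E ≅ shiftExt T),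
    T.IsEquivalence ∧ T.Additive ∧ IsAngulation Φ ∧
    ∀ (A Z : C) (δ : Ext E Z A) (X : Cpx n A Z),
      s δ X ↔ induced Φ ((η.hom.app (op Z)).app A δ) X

/-! ### `n`-exact categories -/

/-- `0 ⟶ C(-, X⁰) ⟶ ⋯ ⟶ C(-, Xⁿ⁺¹)` is exact: `(d⁰, …, dⁿ⁻¹)` is an `n`-kernel of `dⁿ`. -/
def BCpx.IsNKernel (X : BCpx C (n + 1)) : Prop :=
  ∀ W : C, (∀ x : W ⟶ X.K.X 0, x ≫ X.K.d 0 1 = 0 → x = 0) ∧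
    ∀ i, i < n → ∀ x : W ⟶ X.K.X (i + 1), x ≫ X.K.d (i + 1) (i + 2) = 0 →
      ∃ y : W ⟶ X.K.X i, y ≫ X.K.d i (i + 1) = x

/-- `0 ⟶ C(Xⁿ⁺¹, -) ⟶ ⋯ ⟶ C(X⁰, -)` is exact: `(d¹, …, dⁿ)` is an `n`-cokernel of `d⁰`. -/
def BCpx.IsNCokernel (X : BCpx C (n + 1)) : Prop :=
  ∀ W : C, (∀ x : X.K.X (n + 1) ⟶ W, X.K.d n (n + 1) ≫ x = 0 → x = 0) ∧
    ∀ i, i < n → ∀ x : X.K.X (i + 1) ⟶ W, X.K.d i (i + 1) ≫ x = 0 →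
      ∃ y : X.K.X (i + 2) ⟶ W, X.K.d (i + 1) (i + 2) ≫ y = x

/-- Admissible monomorphisms of a class of sequences. -/
def AdmMono (𝒳 : Set (BCpx C (n + 1))) {A B : C} (f : A ⟶ B) : Prop :=
  ∃ X ∈ 𝒳, ∃ (e₀ : X.K.X 0 ≅ A) (e₁ : X.K.X 1 ≅ B), e₀.inv ≫ X.K.d 0 1 ≫ e₁.hom = f

/-- Admissible epimorphisms of a class of sequences. -/
def AdmEpi (𝒳 : Set (BCpx C (n + 1))) {A B : C} (f : A ⟶ B) : Prop :=
  ∃ X ∈ 𝒳, ∃ (e₀ : X.K.X n ≅ A) (e₁ : X.K.X (n + 1) ≅ B),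
    e₀.inv ≫ X.K.d n (n + 1) ≫ e₁.hom = f

/-- `𝒳` is an `n`-exact structure on `C` in the sense of Jasso. -/
structure IsNExactStructure [HasBinaryBiproducts C] (𝒳 : Set (BCpx C (n + 1))) : Prop where
  nExact : ∀ X ∈ 𝒳, X.IsNKernel ∧ X.IsNCokernel
  /-- Closure under weak isomorphisms: morphisms of `n`-exact sequences two cyclically consecutive
  components of which are isomorphisms. -/
  weakIso : ∀ X ∈ 𝒳, ∀ Y : BCpx C (n + 1), Y.IsNKernel → Y.IsNCokernel → ∀ f : X.K ⟶ Y.K,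
    ((∃ k, k ≤ n ∧ IsIso (f.f k) ∧ IsIso (f.f (k + 1))) ∨
      (IsIso (f.f (n + 1)) ∧ IsIso (f.f 0))) → Y ∈ 𝒳
  /-- (E0) -/
  zero_mem : ∀ X : BCpx C (n + 1), (∀ i, IsZero (X.K.X i)) → X ∈ 𝒳
  /-- (E1) and (E1ᵒᵖ) -/
  mono_comp : ∀ {A B D : C} (f : A ⟶ B) (g : B ⟶ D),
    AdmMono 𝒳 f → AdmMono 𝒳 g → AdmMono 𝒳 (f ≫ g)
  epi_comp : ∀ {A B D : C} (f : A ⟶ B) (g : B ⟶ D),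
    AdmEpi 𝒳 f → AdmEpi 𝒳 g → AdmEpi 𝒳 (f ≫ g)
  /-- (E2): `n`-pushouts along `X⁰ ⟶ B`. Here `Y⁰ ⟶ ⋯ ⟶ Yⁿ` is concentrated in degrees `0, …, n`,
  and in `X⁰ ⟶ X¹ ⊞ Y⁰ ⟶ ⋯ ⟶ Xⁿ ⊞ Yⁿ⁻¹ ⟶ Yⁿ` the maps after the first one form an
  `n`-cokernel of it. -/
  pushout : ∀ X ∈ 𝒳, ∀ {B : C} (b : X.K.X 0 ⟶ B),
    ∃ (Y : BCpx C n) (e : Y.K.X 0 ≅ B) (f : X.K ⟶ Y.K), f.f 0 ≫ e.hom = b ∧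
      AdmMono 𝒳 (Y.K.d 0 1) ∧
      ∃ (Q : BCpx C (n + 1)) (u : ∀ i, Q.K.X i ⟶ X.K.X i) (v : ∀ i, Q.K.X (i + 1) ⟶ Y.K.X i),
        IsMappingCocone n f Q.K u v ∧ Q.IsNCokernel
  /-- (E2ᵒᵖ): `n`-pullbacks along `B ⟶ Xⁿ⁺¹`, where `Y¹ ⟶ ⋯ ⟶ Yⁿ⁺¹` is concentrated in degrees
  `1, …, n + 1`. -/
  pullback : ∀ X ∈ 𝒳, ∀ {B : C} (b : B ⟶ X.K.X (n + 1)),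
    ∃ (Y : BCpx C (n + 1)) (e : Y.K.X (n + 1) ≅ B) (f : Y.K ⟶ X.K), IsZero (Y.K.X 0) ∧
      e.inv ≫ f.f (n + 1) = b ∧ AdmEpi 𝒳 (Y.K.d n (n + 1)) ∧
      ∃ (Q : BCpx C (n + 1)) (u : ∀ i, Q.K.X i ⟶ Y.K.X (i + 1)) (v : ∀ i, Q.K.X i ⟶ X.K.X i),
        IsMappingCone n f Q.K u v ∧ Q.IsNKernel

/-- `(C, 𝔼, 𝔰)` is an `n`-exact category: its conflations, i.e. the complexes realizing some
extension, are exactly the admissible sequences of an `n`-exact structure on `C`. -/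
def IsNExactExt [HasBinaryBiproducts C] {n : ℕ} (E : Cᵒᵖ ⥤ C ⥤ AddCommGrpCat.{v})
    (s : PairClass n E) : Prop :=
  ∃ 𝒳 : Set (BCpx C (n + 1)), IsNExactStructure 𝒳 ∧
    ∀ X : BCpx C (n + 1), (∃ δ : Ext E (X.K.X (n + 1)) (X.K.X 0), s δ X.toCpx) ↔ X ∈ 𝒳

/-! ### Left `H`-epimorphisms and strongly covariantly finite subcategories -/

/-- `C(f, H)` is surjective for all objects `H` of the full subcategory `P`. -/
def IsLeftEpi (P : ObjectProperty C) {A B : C} (f : A ⟶ B) : Prop :=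
  ∀ H : C, P H → Function.Surjective (fun g : B ⟶ H => f ≫ g)

/-- The `(n+2)`-angles whose first map is a left `P`-epimorphism. -/
def leftEpiAngles (Θ : Set (SigmaSeq n S)) (P : ObjectProperty C) : Set (SigmaSeq n S) :=
  {X | X ∈ Θ ∧ IsLeftEpi P (X.K.d 0 1)}

/-- `P` is strongly covariantly finite: every object `B` starts an `(n+2)`-angle
`B ⟶ H¹ ⟶ ⋯ ⟶ Hⁿ ⟶ D ⟶ S B` with all `Hⁱ` in `P` whose first map is a left `P`-approximation. -/
def StronglyCovariantlyFinite (Θ : Set (SigmaSeq n S)) (P : ObjectProperty C) : Prop :=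
  ∀ B : C, ∃ X ∈ Θ, Nonempty (X.K.X 0 ≅ B) ∧ (∀ i, 1 ≤ i → i ≤ n → P (X.K.X i)) ∧
    IsLeftEpi P (X.K.d 0 1)

end NExang

/-! The class `ξ` is governed by the connecting map alone. In an `(n+2)`-angle the Hom sequences are
exact, so `g : X⁰ ⟶ H` extends along `d⁰` exactly when `δ ≫ S g = 0` (`isLeftEpi_iff`). Hence `𝔼_ξ`
is the subfunctor `killedExt` of those `δ` that every map into an object of `P` annihilates, and
being a subgroup and being stable under pushing and pulling are evident. Its inflations are the left
`P`-epimorphisms. Its deflations are the `g : B ⟶ Z` for which every `C(Z, S H) ⟶ C(B, S H)` with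
`H` in `P` is injective (`isDeflation_restrict_iff`). Both conditions are stable under composition,
and the second is inherited by right factors, which is saturation.

The other axioms of an `n`-exangulated category pass from `Θ` to the subfunctor without change, so
they have to be derived from (F1)–(F4). Three things are needed. The long Hom sequences are exact
(`exists_lift`, `exists_desc` and their end cases): rotate, and compare with a trivial angle. The
realizations of a fixed `δ` form one homotopy class: `hEquiv_of_mem` corrects a pair of lifts of the
identities, and `mem_of_homotopy` exhibits a homotopy equivalent complex as a direct summand of an
angle plus contractible disks. Good lifts exist in both directions: the cone given by (F4) contains
a contractible two-term piece, because one end component of the morphism is invertible, and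
splitting it off leaves the required cone or cocone (`exists_good_lift`, `exists_good_colift`).
Idempotents are not assumed to split in `C`, so every splitting is accompanied by explicit images of
the idempotent and of its complement.

The comparison statements are then short. In an `n`-exact structure `d⁰` is a monomorphism, while
the desuspension of `δ` is killed by `d⁰`; so `δ = 0`. In an `(n+2)`-angulated structure `H ⟶ 0` is
an inflation for every `H`; for `H` in `P` it is a left `P`-epimorphism, so `𝟙 H` factors through
`0` and `P` has only zero objects. For strongly covariantly finite `P`, `n`-exactness would split
each approximation `B ⟶ H¹` and put every `B` into `P`. -/

open scoped ZeroObject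

/-! ### Construction of rotated sequences. -/

namespace NExang

variable {C : Type u} [Category.{v} C] [Preadditive C]

/-- A morphism of cochain complexes from its components. -/
def chainMap {K L : CochainComplex C ℕ} (f : ∀ i, K.X i ⟶ L.X i)
    (h : ∀ i, f i ≫ L.d i (i + 1) = K.d i (i + 1) ≫ f (i + 1)) : K ⟶ L where
  f := f
  comm' := by
    rintro i _ rfl
    exact h i

@[simp]
lemma chainMap_f {K L : CochainComplex C ℕ} (f : ∀ i, K.X i ⟶ L.X i)
    (h : ∀ i, f i ≫ L.d i (i + 1) = K.d i (i + 1) ≫ f (i + 1)) (i : ℕ) :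
    (chainMap f h).f i = f i := rfl

variable {n : ℕ} {S : C ⥤ C}

lemma neg_one_pow_smul_smul {X Y : C} (f : X ⟶ Y) :
    (-1 : ℤ) ^ n • ((-1 : ℤ) ^ n • f) = f := by
  rcases neg_one_pow_eq_or ℤ n with h | h <;> simp [h]

namespace SigmaSeq

lemma exists_rotation (X : SigmaSeq n S) (h : X.K.d n (n + 1) ≫ X.δ = 0) :
    ∃ Y : SigmaSeq n S, IsRotation X Y := by
  let O : ℕ → C := fun i => if i = n + 1 then S.obj (X.K.X 0) else X.K.X (i + 1)
  -- The value `0` in degree `n + 1` is a default: there the comparison with `S X⁰` is made by `t`.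
  let p : ∀ i, O i ⟶ X.K.X (i + 1) := fun i =>
    if h : i = n + 1 then 0 else eqToHom (if_neg h)
  let q : ∀ i, X.K.X (i + 1) ⟶ O i := fun i =>
    if h : i = n + 1 then 0 else eqToHom (if_neg h).symm
  have hpq : ∀ i, i ≠ n + 1 → p i ≫ q i = 𝟙 _ := fun i hi => by simp [p, q, hi]
  have hqp : ∀ i, i ≠ n + 1 → q i ≫ p i = 𝟙 _ := fun i hi => by simp [p, q, hi]
  let t : O (n + 1) ≅ S.obj (X.K.X 0) := eqToIso (if_pos rfl)
  let tinv : ∀ i, S.obj (X.K.X 0) ⟶ O i := fun i =>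
    if h : i = n + 1 then eqToHom (if_pos h).symm else 0
  have htinv : tinv (n + 1) ≫ t.hom = 𝟙 _ := by simp [tinv, t]
  -- Spreading `X.δ` over all degrees, with value `0` off degree `n`, lets `d` be written without
  -- casts.
  let δ' : ∀ i, X.K.X (i + 1) ⟶ S.obj (X.K.X 0) := fun i =>
    if h : i = n then eqToHom (by rw [h]) ≫ X.δ else 0
  have hδ' : δ' n = X.δ := by simp [δ']
  have hδ'0 : ∀ i, i ≠ n → δ' i = 0 := fun i hi => by simp [δ', hi]
  have hdδ : ∀ i, X.K.d i (i + 1) ≫ δ' i = 0 := fun i => by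
    by_cases hi : i = n
    · subst hi
      rw [hδ', h]
    · simp [hδ'0 i hi]
  let d : ∀ i, O i ⟶ O (i + 1) := fun i =>
    if i < n then p i ≫ X.K.d (i + 1) (i + 2) ≫ q (i + 1) else p i ≫ δ' i ≫ tinv (i + 1)
  have hd : ∀ i, d i ≫ d (i + 1) = 0 := fun i => by
    dsimp only [d]
    split_ifs with h₁ h₂
    · have := reassoc_of% (hqp (i + 1) (by omega))
      simp [this]
    · have := reassoc_of% (hqp (i + 1) (by omega))
      have h₃ := reassoc_of% (hdδ (i + 1))
      simp [this, h₃]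
    · omega
    · simp [hδ'0 (i + 1) (by omega)]
  have hO : ∀ i, n + 1 < i → IsZero (O i) := fun i hi => by
    dsimp only [O]
    rw [if_neg (by omega)]
    exact X.isZero _ (by omega)
  let Y : SigmaSeq n S :=
    { K := CochainComplex.of O d hd
      isZero := hO
      δ := (-1 : ℤ) ^ n • (t.hom ≫ S.map (X.K.d 0 1 ≫ q 0)) }
  have hYd : ∀ i, Y.K.d i (i + 1) = d i := fun i => CochainComplex.of_d _ _ _
  refine ⟨Y, p, t, fun i hi => ⟨q i, hpq i (by omega), hqp i (by omega)⟩, fun i hi => ?_, ?_, ?_⟩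
  · rw [hYd]
    dsimp only [d]
    rw [if_pos hi, Category.assoc, Category.assoc, hqp (i + 1) (by omega), Category.comp_id]
  · rw [hYd]
    dsimp only [d]
    rw [if_neg (lt_irrefl _), Category.assoc, Category.assoc, htinv, Category.comp_id, hδ']
  · change ((-1 : ℤ) ^ n • (t.hom ≫ S.map (X.K.d 0 1 ≫ q 0))) ≫ S.map (p 0) = _
    rw [Preadditive.zsmul_comp, Category.assoc, ← S.map_comp, Category.assoc, hqp 0 (by omega),
      Category.comp_id]

/-- Since `S` is an equivalence, `Xⁿ⁺¹` can be desuspended to serve as the new degree `0`, with the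
desuspension of `(-1)ⁿ δ` as first differential. The hypothesis is what makes the first two
differentials compose to zero. -/
lemma exists_unrotation [HasZeroObject C] [S.IsEquivalence] [S.Additive] (X : SigmaSeq n S)
    (h : X.δ ≫ S.map (X.K.d 0 1) = 0) : ∃ Y : SigmaSeq n S, IsRotation Y X := by
  let W : C := S.objPreimage (X.K.X (n + 1))
  let e : S.obj W ≅ X.K.X (n + 1) := S.objObjPreimageIso _
  let x : W ⟶ X.K.X 0 := S.preimage ((-1 : ℤ) ^ n • (e.hom ≫ X.δ))
  have hx : S.map x = (-1 : ℤ) ^ n • (e.hom ≫ X.δ) := S.map_preimage _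
  -- The object `Xⁿ⁺¹` is already represented by `W` in degree `0`, so degree `n + 2`, where the
  -- shift would put it, is filled with the zero object.
  let O : ℕ → C := fun i =>
    Nat.rec (motive := fun _ => C) W (fun j _ => if j = n + 1 then 0 else X.K.X j) i
  let q : ∀ j, O (j + 1) ⟶ X.K.X j := fun j =>
    if h : j = n + 1 then 0 else eqToHom (if_neg h)
  let r : ∀ j, X.K.X j ⟶ O (j + 1) := fun j =>
    if h : j = n + 1 then 0 else eqToHom (if_neg h).symm
  have hqr : ∀ i, i ≠ n + 1 → q i ≫ r i = 𝟙 _ := fun i hi => by simp [q, r, hi]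
  have hrq : ∀ i, i ≠ n + 1 → r i ≫ q i = 𝟙 _ := fun i hi => by simp [q, r, hi]
  have hr : r (n + 1) = 0 := by simp [r]
  let d : ∀ i, O i ⟶ O (i + 1) := fun i =>
    Nat.rec (motive := fun i => O i ⟶ O (i + 1)) (x ≫ r 0)
      (fun j _ => q j ≫ X.K.d j (j + 1) ≫ r (j + 1)) i
  have hd0 : d 0 = x ≫ r 0 := rfl
  have hds : ∀ j, d (j + 1) = q j ≫ X.K.d j (j + 1) ≫ r (j + 1) := fun _ => rfl
  have hd : ∀ i, d i ≫ d (i + 1) = 0 := by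
    rintro (_ | j)
    · have h₁ := reassoc_of% (hrq 0 (by omega))
      have h₂ : x ≫ X.K.d 0 1 = 0 := S.map_injective (by
        rw [S.map_comp, hx, Preadditive.zsmul_comp, Category.assoc, h]
        simp)
      have h₃ := reassoc_of% h₂
      rw [hd0, hds, Category.assoc, h₁, h₃, zero_comp]
    · rw [hds, hds]
      by_cases hj : j + 1 = n + 1
      · have : r (j + 1) = 0 := by rw [hj, hr]
        simp [this]
      · have h₁ := reassoc_of% (hrq (j + 1) hj)
        simp [h₁]
  have hO : ∀ i, n + 1 < i → IsZero (O i) := by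
    rintro (_ | j) hj
    · omega
    · change IsZero (if j = n + 1 then (0 : C) else X.K.X j)
      split_ifs
      · exact isZero_zero C
      · exact X.isZero _ (by omega)
  let Y : SigmaSeq n S :=
    { K := CochainComplex.of O d hd
      isZero := hO
      δ := q n ≫ X.K.d n (n + 1) ≫ e.inv }
  have hYd : ∀ i, Y.K.d i (i + 1) = d i := fun i => CochainComplex.of_d _ _ _
  refine ⟨Y, r, e.symm, fun i hi => ⟨q i, hrq i (by omega), hqr i (by omega)⟩, fun i hi => ?_,
    ?_, ?_⟩
  · have := reassoc_of% (hrq i (by omega))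
    rw [hYd, hds, this]
  · have := reassoc_of% (hrq n (by omega))
    exact (this _).symm
  · have h₁ : Y.K.d 0 1 = x ≫ r 0 := hYd 0
    rw [h₁, S.map_comp, hx, Preadditive.zsmul_comp, Category.assoc, Preadditive.comp_zsmul,
      neg_one_pow_smul_smul]
    simp

end SigmaSeq

end NExang

/-! ### Closure of the class of angles under isomorphism; disks. -/

namespace NExang

variable {C : Type u} [Category.{v} C] [Preadditive C] {n : ℕ} {S : C ⥤ C}

lemma SigmaSeq.isHom_zero [S.Additive] (X Y : SigmaSeq n S) : IsHom (X := X) (Y := Y) 0 := by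
  simp [IsHom]

lemma SigmaSeq.IsHom.comp {X Y Z : SigmaSeq n S} {f : X.K ⟶ Y.K} {g : Y.K ⟶ Z.K}
    (hf : IsHom f) (hg : IsHom g) : IsHom (X := X) (Y := Z) (f ≫ g) := by
  have h₁ := reassoc_of% (show X.δ ≫ S.map (f.f 0) = f.f (n + 1) ≫ Y.δ from hf)
  have h₂ : Y.δ ≫ S.map (g.f 0) = g.f (n + 1) ≫ Z.δ := hg
  simp [IsHom, h₁, h₂]

lemma SigmaSeq.IsHom.add [S.Additive] {X Y : SigmaSeq n S} {f g : X.K ⟶ Y.K}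
    (hf : IsHom f) (hg : IsHom g) : IsHom (X := X) (Y := Y) (f + g) := by
  have h₁ : X.δ ≫ S.map (f.f 0) = f.f (n + 1) ≫ Y.δ := hf
  have h₂ : X.δ ≫ S.map (g.f 0) = g.f (n + 1) ≫ Y.δ := hg
  simp [IsHom, S.map_add, h₁, h₂]

lemma SigmaSeq.IsHom.inv {X Y : SigmaSeq n S} {e : X.K ≅ Y.K} (h : IsHom e.hom) :
    IsHom (X := Y) (Y := X) e.inv := by
  have h₁ : X.δ ≫ S.map (e.hom.f 0) = e.hom.f (n + 1) ≫ Y.δ := h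
  have h₂ : e.inv.f (n + 1) ≫ e.hom.f (n + 1) = 𝟙 _ := by
    rw [← HomologicalComplex.comp_f, e.inv_hom_id, HomologicalComplex.id_f]
  have h₃ : e.hom.f 0 ≫ e.inv.f 0 = 𝟙 _ := by
    rw [← HomologicalComplex.comp_f, e.hom_inv_id, HomologicalComplex.id_f]
  have h₅ := reassoc_of% h₂
  calc Y.δ ≫ S.map (e.inv.f 0)
      = e.inv.f (n + 1) ≫ (e.hom.f (n + 1) ≫ Y.δ) ≫ S.map (e.inv.f 0) := by
        rw [Category.assoc, h₅]
    _ = _ := by rw [← h₁, Category.assoc, ← S.map_comp, h₃]; simp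

/-- `X` is concentrated in the degrees `i` and `i + 1`, with an isomorphism between them. -/
structure SigmaSeq.IsDisk (X : SigmaSeq n S) (i : ℕ) : Prop where
  isIso : IsIso (X.K.d i (i + 1))
  isZero : ∀ j, j ≠ i → j ≠ i + 1 → IsZero (X.K.X j)
  δ_eq : X.δ = 0

open SigmaSeq

namespace IsAngulation

variable [HasBinaryBiproducts C] [S.Additive] {Θ : Set (SigmaSeq n S)} (hΘ : IsAngulation Θ)
include hΘ

lemma exists_zero_mem [HasZeroObject C] : ∃ X ∈ Θ, ∀ i, IsZero (X.K.X i) := by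
  obtain ⟨X, hX, ⟨e⟩, hd, hz⟩ := hΘ.trivial_mem 0
  have h0 : IsZero (X.K.X 0) := (isZero_zero C).of_iso e
  refine ⟨X, hX, ?_⟩
  rintro (_ | _ | i)
  · exact h0
  · exact h0.of_iso (asIso (X.K.d 0 1)).symm
  · exact hz _ (by omega)

/-- An isomorphic copy of `X` is a direct sum of `X` and a zero angle. -/
lemma mem_of_iso [HasZeroObject C] {X Y : SigmaSeq n S} (hX : X ∈ Θ) (e : X.K ≅ Y.K)
    (h : IsHom e.hom) : Y ∈ Θ := by
  obtain ⟨Z, hZ, hZ0⟩ := hΘ.exists_zero_mem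
  refine hΘ.sum_mem X Z Y ⟨e.hom, e.inv, 0, 0, e.hom_inv_id, ?_, by simp, h, h.inv,
    isHom_zero _ _, isHom_zero _ _⟩ hX hZ
  ext i
  exact (hZ0 i).eq_of_src _ _

/-- Extend `d⁰` to a morphism from `X` to the trivial angle on `X¹`. Its component in degree `n + 1`
lands in a zero object because `n ≥ 1`, and compatibility with the connecting maps gives the claim.
-/
lemma δ_map_d (hn : 1 ≤ n) {X : SigmaSeq n S} (hX : X ∈ Θ) :
    X.δ ≫ S.map (X.K.d 0 1) = 0 := by
  obtain ⟨T, hT, ⟨e⟩, hd, hz⟩ := hΘ.trivial_mem (X.K.X 1)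
  obtain ⟨f, hf, h0, -, -⟩ := hΘ.exists_hom X hX T hT (X.K.d 0 1 ≫ e.inv) (e.inv ≫ T.K.d 0 1)
    (by simp)
  have h₁ : X.δ ≫ S.map (f.f 0) = f.f (n + 1) ≫ T.δ := hf
  have h₂ : f.f (n + 1) = 0 := (hz (n + 1) (by omega)).eq_of_tgt _ _
  rw [h0, h₂, zero_comp, S.map_comp, ← Category.assoc] at h₁
  rw [← cancel_mono (S.map e.inv), h₁, zero_comp]

variable [HasZeroObject C] [S.IsEquivalence]

lemma exists_unrotation (hn : 1 ≤ n) {X : SigmaSeq n S} (hX : X ∈ Θ) :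
    ∃ Y ∈ Θ, IsRotation Y X := by
  obtain ⟨Y, hY⟩ := SigmaSeq.exists_unrotation X (hΘ.δ_map_d hn hX)
  exact ⟨Y, (hΘ.rotation Y X hY).2 hX, hY⟩

lemma d_δ (hn : 1 ≤ n) {X : SigmaSeq n S} (hX : X ∈ Θ) : X.K.d n (n + 1) ≫ X.δ = 0 := by
  obtain ⟨Y, hY, p, t, hp, hd, hdn, hδ⟩ := hΘ.exists_unrotation hn hX
  have h := hΘ.δ_map_d hn hY
  have := hp 0 (by omega)
  have := hp n le_rfl
  have h₁ : t.hom ≫ S.map (Y.K.d 0 1) = (-1 : ℤ) ^ n • (X.δ ≫ S.map (p 0)) := by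
    rw [hδ, neg_one_pow_smul_smul]
  have h₂ : p n ≫ Y.δ ≫ S.map (Y.K.d 0 1) = 0 := by rw [h, comp_zero]
  rw [← Category.assoc, ← hdn, Category.assoc, h₁, Preadditive.comp_zsmul] at h₂
  rw [← cancel_mono (S.map (p 0)), zero_comp, Category.assoc,
    ← neg_one_pow_smul_smul (n := n) (X.K.d n (n + 1) ≫ X.δ ≫ S.map (p 0)), h₂, smul_zero]

lemma exists_rotation (hn : 1 ≤ n) {X : SigmaSeq n S} (hX : X ∈ Θ) :
    ∃ Y ∈ Θ, IsRotation X Y := by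
  obtain ⟨Y, hY⟩ := SigmaSeq.exists_rotation X (hΘ.d_δ hn hX)
  exact ⟨Y, (hΘ.rotation X Y hY).1 hX, hY⟩

lemma mem_of_isDisk_zero (hn : 1 ≤ n) {X : SigmaSeq n S} (hX : X.IsDisk 0) : X ∈ Θ := by
  obtain ⟨T, hT, ⟨e⟩, hd, hz⟩ := hΘ.trivial_mem (X.K.X 0)
  have := hX.isIso
  have hX0 : ∀ i, 2 ≤ i → IsZero (X.K.X i) := fun i hi => hX.isZero i (by omega) (by omega)
  let φ : T.K ⟶ X.K := chainMap
    (Function.update (Function.update 0 0 e.hom) 1 (inv (T.K.d 0 1) ≫ e.hom ≫ X.K.d 0 1)) (by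
      rintro (_ | i)
      · simp [Function.update]
      · exact (hX0 _ (by omega)).eq_of_tgt _ _)
  have hφ0 : φ.f 0 = e.hom := by simp [φ]
  have hφ1 : φ.f 1 = inv (T.K.d 0 1) ≫ e.hom ≫ X.K.d 0 1 := by simp [φ]
  have : ∀ i, IsIso (φ.f i) := by
    rintro (_ | _ | i)
    · rw [hφ0]; infer_instance
    · rw [hφ1]
      have : IsIso (X.K.d 0 1) := hX.isIso
      infer_instance
    · exact ⟨0, (hz _ (by omega)).eq_of_src _ _, (hX0 _ (by omega)).eq_of_src _ _⟩
  have := HomologicalComplex.Hom.isIso_of_components φ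
  refine hΘ.mem_of_iso hT (asIso φ) ?_
  have h₁ : φ.f (n + 1) = 0 := (hz _ (by omega)).eq_of_src _ _
  have h₂ : T.δ = 0 := (hz _ (by omega)).eq_of_src _ _
  simp [IsHom, h₁, h₂]

/-- Rotation moves a disk down by one degree, and a disk in degree `0` is isomorphic to a trivial
angle. -/
lemma mem_of_isDisk (hn : 1 ≤ n) {i : ℕ} (hi : i ≤ n) {X : SigmaSeq n S} (hX : X.IsDisk i) :
    X ∈ Θ := by
  induction i generalizing X with
  | zero => exact hΘ.mem_of_isDisk_zero hn hX
  | succ i ih =>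
    obtain ⟨Y, hY⟩ := SigmaSeq.exists_rotation X (by rw [hX.δ_eq, comp_zero])
    refine (hΘ.rotation X Y hY).2 (ih (by omega) ?_)
    obtain ⟨p, t, hp, hd, hdn, hδ⟩ := hY
    have hX0 : IsZero (X.K.X 0) := hX.isZero 0 (by omega) (by omega)
    have := hX.isIso
    have h₀ := hp 0 (by omega)
    refine ⟨?_, fun j hj hj' => ?_, ?_⟩
    · have h₁ := hp i (by omega)
      have h₂ := hp (i + 1) (by omega)
      have : IsIso (Y.K.d i (i + 1) ≫ p (i + 1)) := by
        rw [hd i (by omega)]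
        infer_instance
      exact IsIso.of_isIso_comp_right _ (p (i + 1))
    · by_cases hjn : j ≤ n
      · have := hp j hjn
        exact (hX.isZero (j + 1) (by omega) (by omega)).of_iso (asIso (p j))
      · by_cases hjn' : j = n + 1
        · subst hjn'
          exact (S.map_isZero hX0).of_iso t
        · exact Y.isZero _ (by omega)
    · rw [← cancel_mono (S.map (p 0)), hδ, hX0.eq_of_src (X.K.d 0 1) 0]
      simp

end IsAngulation

end NExang

/-! ### Exactness of the Hom sequences; realizing prescribed maps. -/

namespace NExang

variable {C : Type u} [Category.{v} C] [Preadditive C] {n : ℕ} {S : C ⥤ C}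

open SigmaSeq

namespace IsAngulation

variable [HasBinaryBiproducts C] [S.Additive] {Θ : Set (SigmaSeq n S)} (hΘ : IsAngulation Θ)
  [HasZeroObject C] [S.IsEquivalence]
include hΘ

/-- The rotated trivial angle on `W` is `W ⟶ 0 ⟶ ⋯ ⟶ 0 ⟶ S W` with connecting map `±𝟙`. Extend `(x,
0)` to a morphism into `X`; its last component is `y` up to sign. -/
lemma exists_comp_δ_eq_map (hn : 1 ≤ n) {X : SigmaSeq n S} (hX : X ∈ Θ) {W : C}
    (x : W ⟶ X.K.X 0) (hx : x ≫ X.K.d 0 1 = 0) :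
    ∃ y : S.obj W ⟶ X.K.X (n + 1), y ≫ X.δ = S.map x := by
  obtain ⟨T, hT, ⟨e⟩, hd, hz⟩ := hΘ.trivial_mem W
  obtain ⟨T', hT', p, t, hp, -, -, hδ⟩ := hΘ.exists_rotation hn hT
  have := hp 0 (by omega)
  obtain ⟨f, hf, h0, -⟩ := hΘ.exists_hom T' hT' X hX (p 0 ≫ inv (T.K.d 0 1) ≫ e.hom ≫ x) 0
    (by simp [hx])
  have hf' : T'.δ ≫ S.map (f.f 0) = f.f (n + 1) ≫ X.δ := hf
  refine ⟨(-1 : ℤ) ^ n • (S.map e.inv ≫ t.inv ≫ f.f (n + 1)), ?_⟩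
  rw [Preadditive.zsmul_comp, Category.assoc, Category.assoc, ← hf', h0, S.map_comp,
    reassoc_of% hδ, Preadditive.zsmul_comp, Preadditive.comp_zsmul, Preadditive.comp_zsmul,
    neg_one_pow_smul_smul, Category.assoc, t.inv_hom_id_assoc, ← S.map_comp, ← S.map_comp]
  simp

/-- Rotation lowers `i`. For `i = 0` the rotated angle is in the situation of
`exists_comp_δ_eq_map`, and the lift found after suspension descends because `S` is fully faithful.
-/
lemma exists_lift (hn : 1 ≤ n) {i : ℕ} (hi : i < n) {X : SigmaSeq n S} (hX : X ∈ Θ) {W : C}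
    (x : W ⟶ X.K.X (i + 1)) (hx : x ≫ X.K.d (i + 1) (i + 2) = 0) :
    ∃ y : W ⟶ X.K.X i, y ≫ X.K.d i (i + 1) = x := by
  induction i generalizing X with
  | zero =>
    obtain ⟨Y, hY, p, t, hp, hd, -, hδ⟩ := hΘ.exists_rotation hn hX
    have h₀ := hp 0 (by omega)
    have h₁ := hp 1 hn
    obtain ⟨y, hy⟩ := hΘ.exists_comp_δ_eq_map hn hY (x ≫ inv (p 0)) (by
      rw [← cancel_mono (p 1), Category.assoc, Category.assoc, hd 0 hi]
      simpa using hx)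
    refine ⟨S.preimage ((-1 : ℤ) ^ n • (y ≫ t.hom)), S.map_injective ?_⟩
    have h₂ : y ≫ Y.δ ≫ S.map (p 0) = S.map x := by
      rw [reassoc_of% hy, ← S.map_comp, Category.assoc, IsIso.inv_hom_id, Category.comp_id]
    rw [S.map_comp, S.map_preimage, Preadditive.zsmul_comp, Category.assoc, ← h₂, hδ,
      Preadditive.comp_zsmul]
  | succ i ih =>
    obtain ⟨Y, hY, p, t, hp, hd, -, hδ⟩ := hΘ.exists_rotation hn hX
    have h₀ := hp (i + 1) (by omega)
    have h₁ := hp (i + 2) (by omega)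
    obtain ⟨y, hy⟩ := ih (by omega) hY (x ≫ inv (p (i + 1))) (by
      rw [← cancel_mono (p (i + 2)), Category.assoc, Category.assoc, hd (i + 1) hi]
      simpa using hx)
    refine ⟨y ≫ p i, ?_⟩
    rw [Category.assoc, ← hd i (by omega), reassoc_of% hy, IsIso.inv_hom_id, Category.comp_id]

lemma exists_lift_last (hn : 1 ≤ n) {X : SigmaSeq n S} (hX : X ∈ Θ) {W : C}
    (x : W ⟶ X.K.X (n + 1)) (hx : x ≫ X.δ = 0) :
    ∃ y : W ⟶ X.K.X n, y ≫ X.K.d n (n + 1) = x := by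
  obtain ⟨Y, hY, p, t, hp, hd, hdn, hδ⟩ := hΘ.exists_unrotation hn hX
  have h₀ := hp n le_rfl
  let e : S.obj (S.objPreimage W) ≅ W := S.objObjPreimageIso W
  have h₁ : t.hom ≫ S.map (Y.K.d 0 1) = (-1 : ℤ) ^ n • (X.δ ≫ S.map (p 0)) := by
    rw [hδ, neg_one_pow_smul_smul]
  obtain ⟨y, hy⟩ := hΘ.exists_comp_δ_eq_map hn hY (S.preimage (e.hom ≫ x ≫ t.hom))
    (S.map_injective (by
      rw [S.map_comp, S.map_preimage, Category.assoc, Category.assoc, h₁,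
        Preadditive.comp_zsmul, reassoc_of% hx]
      simp))
  rw [S.map_preimage] at hy
  refine ⟨e.inv ≫ y ≫ inv (p n), ?_⟩
  rw [← cancel_mono t.hom, Category.assoc, Category.assoc, Category.assoc, hdn,
    IsIso.inv_hom_id_assoc, hy, e.inv_hom_id_assoc]

/-- For `i = 0`, map `X` by `(0, x)` to the disk on `W` in degrees `1` and `2`, which is the trivial
angle rotated backwards; the component in degree `2` is the factorization. Rotation reduces larger
`i` to this case. -/
lemma exists_desc (hn : 1 ≤ n) {i : ℕ} (hi : i < n) {X : SigmaSeq n S} (hX : X ∈ Θ) {W : C}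
    (x : X.K.X (i + 1) ⟶ W) (hx : X.K.d i (i + 1) ≫ x = 0) :
    ∃ y : X.K.X (i + 2) ⟶ W, X.K.d (i + 1) (i + 2) ≫ y = x := by
  induction i generalizing X with
  | zero =>
    obtain ⟨T, hT, ⟨e⟩, hdT, hz⟩ := hΘ.trivial_mem W
    obtain ⟨Y, hY, p, t, hp, hd, -, -⟩ := hΘ.exists_unrotation hn hT
    have h₀ := hp 0 (by omega)
    have h₁ := hp 1 hn
    obtain ⟨f, -, -, hf, -⟩ := hΘ.exists_hom X hX Y hY 0 (x ≫ e.inv ≫ p 0)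
      (by rw [reassoc_of% hx]; simp)
    have h₂ := f.comm 1 2
    rw [hf, Category.assoc, Category.assoc, ← hd 0 hi] at h₂
    refine ⟨f.f 2 ≫ inv (p 1) ≫ inv (T.K.d 0 1) ≫ e.hom, ?_⟩
    have h₃ := reassoc_of% h₂
    simp [← h₃]
  | succ i ih =>
    obtain ⟨Y, hY, p, t, hp, hd, -, hδ⟩ := hΘ.exists_rotation hn hX
    have h₀ := hp i (by omega)
    have h₁ := hp (i + 1) (by omega)
    have h₂ := hp (i + 2) (by omega)
    obtain ⟨y, hy⟩ := ih (by omega) hY (p (i + 1) ≫ x) (by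
      rw [reassoc_of% (hd i (by omega)), hx, comp_zero])
    refine ⟨inv (p (i + 2)) ≫ y, ?_⟩
    rw [← cancel_epi (p (i + 1)), ← hy, ← reassoc_of% (hd (i + 1) (by omega))]
    simp

lemma exists_desc_first (hn : 1 ≤ n) {X : SigmaSeq n S} (hX : X ∈ Θ) {W : C}
    (x : X.K.X 0 ⟶ W) (hx : X.δ ≫ S.map x = 0) :
    ∃ y : X.K.X 1 ⟶ W, X.K.d 0 1 ≫ y = x := by
  obtain ⟨Y, hY, p, t, hp, hd, hdn, hδ⟩ := hΘ.exists_unrotation hn hX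
  have h₀ := hp 0 (by omega)
  have h₁ : t.hom ≫ S.map (Y.K.d 0 1) = (-1 : ℤ) ^ n • (X.δ ≫ S.map (p 0)) := by
    rw [hδ, neg_one_pow_smul_smul]
  obtain ⟨y, hy⟩ := hΘ.exists_desc hn (i := 0) (by omega) hY (inv (p 0) ≫ x)
    (S.map_injective (by
      rw [← cancel_epi t.hom, S.map_comp, reassoc_of% h₁, Preadditive.zsmul_comp,
        Category.assoc, ← S.map_comp, IsIso.hom_inv_id_assoc, hx]
      simp))
  refine ⟨p 1 ≫ y, ?_⟩
  rw [reassoc_of% (hd 0 (by omega)), hy, IsIso.hom_inv_id_assoc]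

lemma isLeftEpi_iff (hn : 1 ≤ n) {X : SigmaSeq n S} (hX : X ∈ Θ) (P : ObjectProperty C) :
    IsLeftEpi P (X.K.d 0 1) ↔ ∀ H, P H → ∀ g : X.K.X 0 ⟶ H, X.δ ≫ S.map g = 0 := by
  refine ⟨fun h H hH g => ?_, fun h H hH g => hΘ.exists_desc_first hn hX g (h H hH g)⟩
  obtain ⟨y, hy⟩ := h H hH g
  rw [← show X.K.d 0 1 ≫ y = g from hy, S.map_comp, reassoc_of% (hΘ.δ_map_d hn hX), zero_comp]

/-- Rotate an angle whose first map is a desuspension of `(-1)ⁿ δ`; the sign cancels the one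
introduced by the rotation. -/
lemma exists_cpx (hn : 1 ≤ n) {A Z : C} (δ : Z ⟶ S.obj A) :
    ∃ X : Cpx n A Z, X.toSigmaSeq δ ∈ Θ := by
  let e : S.obj (S.objPreimage Z) ≅ Z := S.objObjPreimageIso Z
  obtain ⟨V, hV, e₀, e₁, hg⟩ :=
    hΘ.exists_mem (S.preimage ((-1 : ℤ) ^ n • (e.hom ≫ δ)) : S.objPreimage Z ⟶ A)
  obtain ⟨X, hX, p, t, hp, -, -, hδ⟩ := hΘ.exists_rotation hn hV
  have h₀ := hp 0 (by omega)
  let Y : Cpx n A Z :=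
    { toBCpx := X.toBCpx
      fst := asIso (p 0) ≪≫ e₁
      lst := t ≪≫ S.mapIso e₀ ≪≫ e }
  refine ⟨Y, ?_⟩
  suffices Y.toSigmaSeq δ = X by rwa [this]
  have h₁ : V.K.d 0 1 ≫ e₁.hom = e₀.hom ≫ S.preimage ((-1 : ℤ) ^ n • (e.hom ≫ δ)) := by
    rw [← hg, e₀.hom_inv_id_assoc]
  have h₂ : X.δ ≫ S.map Y.fst.hom = Y.lst.hom ≫ δ := by
    change X.δ ≫ S.map (p 0 ≫ e₁.hom) = (t.hom ≫ S.map e₀.hom ≫ e.hom) ≫ δ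
    rw [S.map_comp, reassoc_of% hδ, Preadditive.zsmul_comp, Category.assoc, ← S.map_comp, h₁,
      S.map_comp, S.map_preimage, Preadditive.comp_zsmul, Preadditive.comp_zsmul,
      neg_one_pow_smul_smul]
    simp
  have h₃ : Y.lst.hom ≫ δ ≫ S.map Y.fst.inv = X.δ := by
    rw [← Category.assoc, ← h₂, Category.assoc, ← S.map_comp, Y.fst.hom_inv_id, S.map_id]
    exact Category.comp_id _
  cases X
  simp only [Cpx.toSigmaSeq, h₃]
  rfl

/-- Two rotations turn the first map `d⁰` of an angle into the last differential `(-1)ⁿ S d⁰`, so it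
suffices to start an angle with a desuspension of `(-1)ⁿ g`. -/
lemma exists_mem_last (hn : 1 ≤ n) {B Z : C} (g : B ⟶ Z) :
    ∃ X ∈ Θ, ∃ (e : X.K.X n ≅ B) (e' : X.K.X (n + 1) ≅ Z),
      X.K.d n (n + 1) ≫ e'.hom = e.hom ≫ g := by
  let b : S.obj (S.objPreimage B) ≅ B := S.objObjPreimageIso B
  let z : S.obj (S.objPreimage Z) ≅ Z := S.objObjPreimageIso Z
  obtain ⟨V, hV, e₀, e₁, hg⟩ := hΘ.exists_mem
    (S.preimage ((-1 : ℤ) ^ n • (b.hom ≫ g ≫ z.inv)) : S.objPreimage B ⟶ S.objPreimage Z)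
  obtain ⟨X, hX, p, t, hp, -, -, hδ⟩ := hΘ.exists_rotation hn hV
  obtain ⟨Y, hY, p', t', hp', -, hdn', -⟩ := hΘ.exists_rotation hn hX
  have h₀ := hp 0 (by omega)
  have h₁ := hp' n le_rfl
  refine ⟨Y, hY, asIso (p' n) ≪≫ t ≪≫ S.mapIso e₀ ≪≫ b,
    t' ≪≫ S.mapIso (asIso (p 0)) ≪≫ S.mapIso e₁ ≪≫ z, ?_⟩
  have h₂ : V.K.d 0 1 ≫ e₁.hom =
      e₀.hom ≫ S.preimage ((-1 : ℤ) ^ n • (b.hom ≫ g ≫ z.inv)) := by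
    rw [← hg, e₀.hom_inv_id_assoc]
  have h₃ : S.map (V.K.d 0 1) ≫ S.map e₁.hom =
      (-1 : ℤ) ^ n • (S.map e₀.hom ≫ b.hom ≫ g ≫ z.inv) := by
    rw [← S.map_comp, h₂, S.map_comp, S.map_preimage, Preadditive.comp_zsmul]
  have h₄ : X.δ ≫ S.map (p 0) ≫ S.map e₁.hom = t.hom ≫ S.map e₀.hom ≫ b.hom ≫ g ≫ z.inv := by
    rw [reassoc_of% hδ, Preadditive.zsmul_comp, Category.assoc, h₃, Preadditive.comp_zsmul,
      neg_one_pow_smul_smul]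
  have h₅ := reassoc_of% hdn'
  have h₆ := reassoc_of% h₄
  simp [h₅, h₆]

end IsAngulation

end NExang

/-! ### Splitting idempotents of angles, without idempotent completeness. -/

namespace NExang

variable {C : Type u} [Category.{v} C] [Preadditive C] {n : ℕ} {S : C ⥤ C}

/-- The endomorphism `e` factors as a retraction followed by its section. -/
def SplitIdem {A : C} (e : A ⟶ A) : Prop :=
  ∃ (O : C) (s : O ⟶ A) (p : A ⟶ O), s ≫ p = 𝟙 O ∧ p ≫ s = e

lemma splitIdem_id (A : C) : SplitIdem (𝟙 A) := ⟨A, 𝟙 A, 𝟙 A, by simp, by simp⟩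

lemma splitIdem_zero [HasZeroObject C] (A : C) : SplitIdem (0 : A ⟶ A) :=
  ⟨0, 0, 0, (isZero_zero C).eq_of_src _ _, by simp⟩

lemma SplitIdem.conj {A B : C} {e : A ⟶ A} (h : SplitIdem e) (i : A ≅ B) :
    SplitIdem (i.inv ≫ e ≫ i.hom) := by
  obtain ⟨O, s, p, h₁, h₂⟩ := h
  exact ⟨O, s ≫ i.hom, i.inv ≫ p, by simp [h₁], by simp [← h₂]⟩

/-- `p` is a split epimorphism which has a kernel. -/
def SplitsWithKernel {A B : C} (p : A ⟶ B) : Prop :=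
  ∃ (N : C) (j : N ⟶ A) (q : A ⟶ N) (σ : B ⟶ A),
    j ≫ q = 𝟙 N ∧ σ ≫ p = 𝟙 B ∧ q ≫ j + p ≫ σ = 𝟙 A

lemma splitsWithKernel_of_isIso [HasZeroObject C] {A B : C} (p : A ⟶ B) [IsIso p] :
    SplitsWithKernel p :=
  ⟨0, 0, 0, inv p, (isZero_zero C).eq_of_src _ _, by simp, by simp⟩

/-- Having a kernel does not depend on the section: for every section `s`, the complement `𝟙 - p ≫
s` factors through the same kernel `N`. -/
lemma SplitsWithKernel.splitIdem {A B : C} {p : A ⟶ B} (h : SplitsWithKernel p) {s : B ⟶ A}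
    (hs : s ≫ p = 𝟙 B) : SplitIdem (𝟙 A - p ≫ s) := by
  obtain ⟨N, j, q, σ, h₁, h₂, h₃⟩ := h
  have hqj : q ≫ j = 𝟙 A - p ≫ σ := eq_sub_of_add_eq h₃
  have hjp : j ≫ p = 0 := by
    have h₄ : j ≫ p ≫ σ = 0 := by
      have : p ≫ σ = 𝟙 A - q ≫ j := by rw [hqj]; abel
      rw [this, Preadditive.comp_sub, reassoc_of% h₁]
      simp
    rw [← Category.comp_id (j ≫ p), ← h₂, Category.assoc, reassoc_of% h₄, zero_comp]
  refine ⟨N, j, (𝟙 A - p ≫ s) ≫ q, ?_, ?_⟩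
  · simp [Preadditive.comp_sub, Preadditive.sub_comp, reassoc_of% hjp, h₁]
  · rw [Category.assoc, hqj]
    simp [Preadditive.comp_sub, Preadditive.sub_comp, reassoc_of% hs]

/-- If `p` is already split on the summand `A₁`, the other summand only enlarges the kernel to `N ⊞
A₂`, where `A₂` is embedded after subtracting its image lifted along the section. -/
lemma SplitsWithKernel.of_summand [HasBinaryBiproducts C] {A A₁ A₂ B : C} {i₁ : A₁ ⟶ A}
    {p₁ : A ⟶ A₁} {i₂ : A₂ ⟶ A} {p₂ : A ⟶ A₂} (h₁ : i₁ ≫ p₁ = 𝟙 _) (h₂ : i₂ ≫ p₂ = 𝟙 _)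
    (h₁₂ : i₁ ≫ p₂ = 0) (h₂₁ : i₂ ≫ p₁ = 0) (h : p₁ ≫ i₁ + p₂ ≫ i₂ = 𝟙 A) {p : A ⟶ B}
    (hp : SplitsWithKernel (i₁ ≫ p)) : SplitsWithKernel p := by
  obtain ⟨N, j, q, σ, hjq, hσp, hqj⟩ := hp
  have hqj' : q ≫ j = 𝟙 A₁ - i₁ ≫ p ≫ σ := eq_sub_of_add_eq (by simpa using hqj)
  have hσq : σ ≫ q = 0 := by
    have h₄ : σ ≫ q ≫ j = 0 := by
      rw [hqj', Preadditive.comp_sub, reassoc_of% hσp]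
      simp
    rw [← Category.comp_id (σ ≫ q), ← hjq, Category.assoc, reassoc_of% h₄, zero_comp]
  refine ⟨N ⊞ A₂, biprod.desc (j ≫ i₁) (i₂ - i₂ ≫ p ≫ σ ≫ i₁), biprod.lift (p₁ ≫ q) p₂,
    σ ≫ i₁, ?_, by simpa using hσp, ?_⟩
  · ext <;> simp [Preadditive.sub_comp, reassoc_of% h₁, h₁₂, hjq, h₂,
      reassoc_of% h₂₁, hσq]
  · have h₄ : p = p₁ ≫ i₁ ≫ p + p₂ ≫ i₂ ≫ p := by
      rw [← Category.assoc, ← Category.assoc, ← Preadditive.add_comp, h, Category.id_comp]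
    rw [biprod.lift_desc, Category.assoc, reassoc_of% hqj', ← h, h₄]
    simp only [Preadditive.comp_sub, Preadditive.sub_comp, Preadditive.add_comp,
      Preadditive.comp_add, Category.assoc, Category.id_comp, reassoc_of% h₁, reassoc_of% h₂₁,
      reassoc_of% h₁₂, reassoc_of% h₂, zero_comp, add_zero, zero_add]
    abel

namespace SigmaSeq

lemma exists_splitting (W : SigmaSeq n S) (e : W.K ⟶ W.K) (he : IsHom e)
    (h : ∀ i, SplitIdem (e.f i)) :
    ∃ (Y : SigmaSeq n S) (s : Y.K ⟶ W.K) (p : W.K ⟶ Y.K), IsHom s ∧ IsHom p ∧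
      s ≫ p = 𝟙 _ ∧ p ≫ s = e := by
  choose O s p hsp hps using h
  have hse : ∀ i, s i ≫ e.f i = s i := fun i => by
    rw [← hps, reassoc_of% (hsp i)]
  have hep : ∀ i, e.f i ≫ p i = p i := fun i => by
    rw [← hps, Category.assoc, hsp, Category.comp_id]
  have hsd : ∀ i, s i ≫ W.K.d i (i + 1) ≫ e.f (i + 1) = s i ≫ W.K.d i (i + 1) := fun i => by
    rw [← e.comm, reassoc_of% (hse i)]
  let d : ∀ i, O i ⟶ O (i + 1) := fun i => s i ≫ W.K.d i (i + 1) ≫ p (i + 1)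
  have hd : ∀ i, d i ≫ d (i + 1) = 0 := fun i => by
    dsimp only [d]
    rw [Category.assoc, Category.assoc, reassoc_of% (hps (i + 1)), reassoc_of% (hsd i)]
    simp
  let Y : SigmaSeq n S :=
    { K := CochainComplex.of O d hd
      isZero := fun i hi => by
        rw [IsZero.iff_id_eq_zero]
        exact (hsp i).symm.trans (by rw [(W.isZero i hi).eq_of_src (p i) 0, comp_zero])
      δ := s (n + 1) ≫ W.δ ≫ S.map (p 0) }
  have hYd : ∀ i, Y.K.d i (i + 1) = s i ≫ W.K.d i (i + 1) ≫ p (i + 1) :=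
    fun i => CochainComplex.of_d _ _ _
  have heδ : W.δ ≫ S.map (e.f 0) = e.f (n + 1) ≫ W.δ := he
  refine ⟨Y, chainMap s fun i => ?_, chainMap p fun i => ?_, ?_, ?_, ?_, ?_⟩
  · rw [hYd, Category.assoc, Category.assoc, hps, hsd]
  · rw [hYd, reassoc_of% (hps i), reassoc_of% (e.comm i (i + 1)), hep]
  · change (s (n + 1) ≫ W.δ ≫ S.map (p 0)) ≫ S.map (s 0) = s (n + 1) ≫ W.δ
    rw [Category.assoc, Category.assoc, ← S.map_comp, hps, heδ, reassoc_of% (hse (n + 1))]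
  · change W.δ ≫ S.map (p 0) = p (n + 1) ≫ s (n + 1) ≫ W.δ ≫ S.map (p 0)
    rw [reassoc_of% (hps (n + 1)), ← reassoc_of% heδ, ← S.map_comp, hep]
  · ext i
    exact hsp i
  · ext i
    exact hps i

lemma exists_isSum [HasBinaryBiproducts C] (X Y : SigmaSeq n S) [S.Additive] :
    ∃ W : SigmaSeq n S, ∃ (i₁ : X.K ⟶ W.K) (p₁ : W.K ⟶ X.K) (i₂ : Y.K ⟶ W.K) (p₂ : W.K ⟶ Y.K),
    i₁ ≫ p₁ = 𝟙 _ ∧ i₂ ≫ p₂ = 𝟙 _ ∧ p₁ ≫ i₁ + p₂ ≫ i₂ = 𝟙 _ ∧ i₁ ≫ p₂ = 0 ∧ i₂ ≫ p₁ = 0 ∧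
    IsHom i₁ ∧ IsHom p₁ ∧ IsHom i₂ ∧ IsHom p₂ := by
  let i₁ : X.K ⟶ X.K ⊞ Y.K := biprod.inl
  let p₁ : X.K ⊞ Y.K ⟶ X.K := biprod.fst
  let i₂ : Y.K ⟶ X.K ⊞ Y.K := biprod.inr
  let p₂ : X.K ⊞ Y.K ⟶ Y.K := biprod.snd
  have h₁ : i₁ ≫ p₁ = 𝟙 _ := biprod.inl_fst
  have h₂ : i₂ ≫ p₂ = 𝟙 _ := biprod.inr_snd
  have h₁₂ : i₁ ≫ p₂ = 0 := biprod.inl_snd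
  have h₂₁ : i₂ ≫ p₁ = 0 := biprod.inr_fst
  have h : p₁ ≫ i₁ + p₂ ≫ i₂ = 𝟙 _ := biprod.total
  have c₁ : ∀ i, i₁.f i ≫ p₁.f i = 𝟙 _ := fun i => by
    rw [← HomologicalComplex.comp_f, h₁, HomologicalComplex.id_f]
  have c₂ : ∀ i, i₂.f i ≫ p₂.f i = 𝟙 _ := fun i => by
    rw [← HomologicalComplex.comp_f, h₂, HomologicalComplex.id_f]
  have c₁₂ : ∀ i, i₁.f i ≫ p₂.f i = 0 := fun i => by
    rw [← HomologicalComplex.comp_f, h₁₂, HomologicalComplex.zero_f]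
  have c₂₁ : ∀ i, i₂.f i ≫ p₁.f i = 0 := fun i => by
    rw [← HomologicalComplex.comp_f, h₂₁, HomologicalComplex.zero_f]
  have c : ∀ i, p₁.f i ≫ i₁.f i + p₂.f i ≫ i₂.f i = 𝟙 _ := fun i => by
    rw [← HomologicalComplex.comp_f, ← HomologicalComplex.comp_f,
      ← HomologicalComplex.add_f_apply, h, HomologicalComplex.id_f]
  have m₁ : S.map (i₁.f 0) ≫ S.map (p₁.f 0) = 𝟙 _ := by rw [← S.map_comp, c₁, S.map_id]
  have m₂ : S.map (i₂.f 0) ≫ S.map (p₂.f 0) = 𝟙 _ := by rw [← S.map_comp, c₂, S.map_id]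
  have m₁₂ : S.map (i₁.f 0) ≫ S.map (p₂.f 0) = 0 := by rw [← S.map_comp, c₁₂, S.map_zero]
  have m₂₁ : S.map (i₂.f 0) ≫ S.map (p₁.f 0) = 0 := by rw [← S.map_comp, c₂₁, S.map_zero]
  let W : SigmaSeq n S :=
    { K := X.K ⊞ Y.K
      isZero := fun i hi => by
        rw [IsZero.iff_id_eq_zero, ← c, (X.isZero i hi).eq_of_tgt (p₁.f i) 0,
          (Y.isZero i hi).eq_of_tgt (p₂.f i) 0]
        simp
      δ := p₁.f (n + 1) ≫ X.δ ≫ S.map (i₁.f 0) + p₂.f (n + 1) ≫ Y.δ ≫ S.map (i₂.f 0) }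
  have hW : W.δ = p₁.f (n + 1) ≫ X.δ ≫ S.map (i₁.f 0) + p₂.f (n + 1) ≫ Y.δ ≫ S.map (i₂.f 0) :=
    rfl
  refine ⟨W, i₁, p₁, i₂, p₂, h₁, h₂, h, h₁₂, h₂₁, ?_, ?_, ?_, ?_⟩
  · rw [IsHom, hW, Preadditive.comp_add, reassoc_of% (c₁ (n + 1)), reassoc_of% (c₁₂ (n + 1))]
    simp
  · rw [IsHom, hW, Preadditive.add_comp]
    simp [m₁, m₂₁]
  · rw [IsHom, hW, Preadditive.comp_add, reassoc_of% (c₂ (n + 1)), reassoc_of% (c₂₁ (n + 1))]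
    simp
  · rw [IsHom, hW, Preadditive.add_comp]
    simp [m₂, m₁₂]

end SigmaSeq

open SigmaSeq

namespace IsAngulation

variable [HasBinaryBiproducts C] [S.Additive] {Θ : Set (SigmaSeq n S)} (hΘ : IsAngulation Θ)
include hΘ

/-- The axiom on direct summands requires the complement as a sequence too, hence the condition on
`𝟙 - e`. -/
lemma exists_splitting {W : SigmaSeq n S} (hW : W ∈ Θ) (e : W.K ⟶ W.K) (he : IsHom e)
    (h : ∀ i, SplitIdem (e.f i)) (h' : ∀ i, SplitIdem (𝟙 _ - e.f i)) :
    ∃ Y ∈ Θ, ∃ (s : Y.K ⟶ W.K) (p : W.K ⟶ Y.K), IsHom s ∧ IsHom p ∧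
      s ≫ p = 𝟙 _ ∧ p ≫ s = e := by
  obtain ⟨Y, s, p, hs, hp, hsp, hps⟩ := W.exists_splitting e he h
  have he' : IsHom (X := W) (Y := W) (𝟙 W.K - e) := by
    have : W.δ ≫ S.map (e.f 0) = e.f (n + 1) ≫ W.δ := he
    simp [IsHom, Preadditive.comp_sub, Preadditive.sub_comp, S.map_sub, this]
  obtain ⟨Y', s', p', hs', hp', hsp', hps'⟩ := W.exists_splitting (𝟙 W.K - e) he' h'
  exact ⟨Y, hΘ.summand_mem Y Y' W ⟨s, p, s', p', hsp, hsp', by rw [hps, hps']; abel,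
    hs, hp, hs', hp'⟩ hW, s, p, hs, hp, hsp, hps⟩

variable [HasZeroObject C]

/-- A retract is a direct summand once the complementary idempotent splits as well. The kernels of
the components of `p` provide that splitting, and the resulting summand is isomorphic to `Y`. -/
lemma mem_of_retract {W Y : SigmaSeq n S} (hW : W ∈ Θ) (s : Y.K ⟶ W.K) (p : W.K ⟶ Y.K)
    (hs : IsHom s) (hp : IsHom p) (hsp : s ≫ p = 𝟙 _) (h : ∀ i, SplitsWithKernel (p.f i)) :
    Y ∈ Θ := by
  have hsp' : ∀ i, s.f i ≫ p.f i = 𝟙 _ := fun i => by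
    rw [← HomologicalComplex.comp_f, hsp, HomologicalComplex.id_f]
  obtain ⟨Y', hY', s', p', hs', hp', h₁, h₂⟩ := hΘ.exists_splitting hW (p ≫ s) (hp.comp hs)
    (fun i => ⟨_, s.f i, p.f i, hsp' i, rfl⟩) (fun i => (h i).splitIdem (hsp' i))
  refine hΘ.mem_of_iso hY' ⟨s' ≫ p, s ≫ p', ?_, ?_⟩ (hs'.comp hp)
  · rw [Category.assoc, ← Category.assoc p, ← h₂, Category.assoc, h₁, reassoc_of% h₁]
  · rw [Category.assoc, ← Category.assoc p', h₂, Category.assoc, hsp, reassoc_of% hsp]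

/-- Splitting off a summand which is concentrated in the degrees `0` and `n + 1`. -/
lemma exists_splitting_ends (hn : 1 ≤ n) {W : SigmaSeq n S} (hW : W ∈ Θ)
    (e₀ : W.K.X 0 ⟶ W.K.X 0) (e₁ : W.K.X (n + 1) ⟶ W.K.X (n + 1))
    (h₀ : SplitIdem e₀) (h₀' : SplitIdem (𝟙 _ - e₀)) (h₁ : SplitIdem e₁)
    (h₁' : SplitIdem (𝟙 _ - e₁)) (h0 : e₀ ≫ W.K.d 0 1 = W.K.d 0 1)
    (h1 : W.K.d n (n + 1) ≫ e₁ = W.K.d n (n + 1)) (hδ : W.δ ≫ S.map e₀ = e₁ ≫ W.δ) :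
    ∃ Y ∈ Θ, ∃ (s : Y.K ⟶ W.K) (p : W.K ⟶ Y.K), IsHom s ∧ IsHom p ∧
      s ≫ p = 𝟙 _ ∧ p.f 0 ≫ s.f 0 = e₀ ∧ p.f (n + 1) ≫ s.f (n + 1) = e₁ ∧
      ∀ i, 1 ≤ i → i ≤ n → IsIso (s.f i) := by
  let E : ∀ i, W.K.X i ⟶ W.K.X i :=
    Function.update (Function.update (fun i => 𝟙 _) 0 e₀) (n + 1) e₁
  have E0 : E 0 = e₀ := by simp [E, Function.update]
  have E1 : E (n + 1) = e₁ := by simp [E]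
  have E2 : ∀ i, i ≠ 0 → i ≠ n + 1 → E i = 𝟙 _ := fun i hi hi' => by simp [E, hi, hi']
  let e : W.K ⟶ W.K := chainMap E (fun i => by
    by_cases hi : i = 0
    · subst hi
      rw [E0, h0, E2 _ (by omega) (by omega), Category.comp_id]
    · by_cases hi' : i = n
      · subst hi'
        rw [E1, h1, E2 _ (by omega) (by omega), Category.id_comp]
      · by_cases hi'' : i = n + 1
        · exact (W.isZero _ (by omega)).eq_of_tgt _ _
        · rw [E2 i hi hi'', E2 (i + 1) (by omega) (by omega), Category.id_comp,
            Category.comp_id])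
  obtain ⟨Y, hY, s, p, hs, hp, hsp, hps⟩ := hΘ.exists_splitting hW e
    (by simp only [IsHom, e, chainMap_f, E0, E1, hδ])
    (fun i => by
      change SplitIdem (E i)
      by_cases hi : i = 0
      · subst hi
        rwa [E0]
      · by_cases hi' : i = n + 1
        · subst hi'
          rwa [E1]
        · rw [E2 i hi hi']
          exact splitIdem_id _)
    (fun i => by
      change SplitIdem (𝟙 _ - E i)
      by_cases hi : i = 0
      · subst hi
        rwa [E0]
      · by_cases hi' : i = n + 1
        · subst hi'
          rwa [E1]
        · rw [E2 i hi hi', sub_self]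
          exact splitIdem_zero _)
  have hps' : ∀ i, p.f i ≫ s.f i = E i := fun i => by
    rw [← HomologicalComplex.comp_f, hps]
    rfl
  refine ⟨Y, hY, s, p, hs, hp, hsp, by rw [hps', E0], by rw [hps', E1], fun i hi hi' =>
    ⟨p.f i, ?_, by rw [hps', E2 i (by omega) (by omega)]⟩⟩
  rw [← HomologicalComplex.comp_f, hsp, HomologicalComplex.id_f]

end IsAngulation

end NExang

/-! ### Homotopies and invariance of angles under homotopy equivalence. -/

namespace NExang

variable {C : Type u} [Category.{v} C] [Preadditive C] {n : ℕ} {S : C ⥤ C}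

/-- A homotopy to zero from its components. -/
def homotopyZero {K L : CochainComplex C ℕ} {φ : K ⟶ L} (k : ∀ i, K.X (i + 1) ⟶ L.X i)
    (h0 : φ.f 0 = K.d 0 1 ≫ k 0)
    (h : ∀ i, φ.f (i + 1) = K.d (i + 1) (i + 2) ≫ k (i + 1) + k i ≫ L.d i (i + 1)) :
    Homotopy φ 0 where
  hom i j := if h : j + 1 = i then eqToHom (by rw [h]) ≫ k j else 0
  zero i j hij := dif_neg hij
  comm := by
    rintro (_ | i)
    · rw [Homotopy.dNext_cochainComplex, Homotopy.prevD_zero_cochainComplex]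
      simp [h0]
    · rw [Homotopy.dNext_cochainComplex, Homotopy.prevD_succ_cochainComplex]
      simp [h]

namespace SigmaSeq

/-- A single component `h` of a homotopy contributes `d h` in degree `k` and `h d` in degree `k +
1`; this contribution factors through the disk on `Yᵏ`. The vanishing hypotheses make the two maps
compatible with the connecting maps when `k = 0` or `k = n`. -/
lemma exists_disk [HasZeroObject C] [S.Additive] {Y : SigmaSeq n S} (hY0 : Y.δ ≫ S.map (Y.K.d 0 1) = 0)
    (hY1 : Y.K.d n (n + 1) ≫ Y.δ = 0) (k : ℕ) (h : Y.K.X (k + 1) ⟶ Y.K.X k) (hk : k ≤ n) :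
    ∃ (D : SigmaSeq n S) (α : Y.K ⟶ D.K) (π : D.K ⟶ Y.K), D.IsDisk k ∧ IsHom α ∧ IsHom π ∧
      IsIso (π.f k) ∧ α.f k ≫ π.f k = Y.K.d k (k + 1) ≫ h ∧
      α.f (k + 1) ≫ π.f (k + 1) = h ≫ Y.K.d k (k + 1) := by
  have hrel : (ComplexShape.up ℕ).Rel k (k + 1) := rfl
  have hne : k ≠ k + 1 := by omega
  let K := HomologicalComplex.double (𝟙 (Y.K.X k)) hrel
  let e₀ : K.X k ≅ Y.K.X k := HomologicalComplex.doubleXIso₀ _ hrel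
  let e₁ : K.X (k + 1) ≅ Y.K.X k := HomologicalComplex.doubleXIso₁ _ hrel hne
  have hd : K.d k (k + 1) = e₀.hom ≫ e₁.inv := by
    rw [HomologicalComplex.double_d _ _ hne]
    simp [e₀, e₁]
  have hz : ∀ j, j ≠ k → j ≠ k + 1 → IsZero (K.X j) :=
    fun j hj hj' => HomologicalComplex.isZero_double_X _ _ j hj hj'
  let D : SigmaSeq n S :=
    { K := K
      isZero := fun i hi => hz i (by omega) (by omega)
      δ := 0 }
  let π : K ⟶ Y.K := HomologicalComplex.mkHomFromDouble hrel hne (𝟙 _) (Y.K.d k (k + 1))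
    (by simp) (by simp)
  have hπ₀ : π.f k = e₀.hom := by
    simp [π, e₀]
  have hπ₁ : π.f (k + 1) = e₁.hom ≫ Y.K.d k (k + 1) := by
    simp [π, e₁]
  let A : ∀ i, Y.K.X i ⟶ K.X i :=
    Function.update (Function.update 0 k (Y.K.d k (k + 1) ≫ h ≫ e₀.inv)) (k + 1) (h ≫ e₁.inv)
  have A₀ : A k = Y.K.d k (k + 1) ≫ h ≫ e₀.inv := by simp [A]
  have A₁ : A (k + 1) = h ≫ e₁.inv := by simp [A]
  have Az : ∀ i, i ≠ k → A i ≫ K.d i (i + 1) = 0 := fun i hi => by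
    rw [HomologicalComplex.double_d_eq_zero₀ _ _ _ _ hi, comp_zero]
  let α : Y.K ⟶ K := chainMap A (fun i => by
    by_cases hi : i = k
    · subst hi
      rw [A₀, A₁, hd]
      simp
    · rw [Az i hi]
      by_cases hi' : i + 1 = k
      · subst hi'
        rw [A₀]
        simp
      · exact (hz (i + 1) hi' (by omega)).eq_of_tgt _ _)
  have hα₀ : α.f k = Y.K.d k (k + 1) ≫ h ≫ e₀.inv := A₀
  have hα₁ : α.f (k + 1) = h ≫ e₁.inv := A₁
  refine ⟨D, α, π, ⟨?_, hz, rfl⟩, ?_, ?_, ?_, ?_, ?_⟩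
  · change IsIso (K.d k (k + 1))
    rw [hd]
    infer_instance
  · change Y.δ ≫ S.map (α.f 0) = α.f (n + 1) ≫ 0
    rw [comp_zero]
    by_cases hk0 : k = 0
    · subst hk0
      rw [hα₀, S.map_comp, reassoc_of% hY0, zero_comp]
    · rw [(hz 0 (by omega) (by omega)).eq_of_tgt (α.f 0) 0, S.map_zero, comp_zero]
  · change 0 ≫ S.map (π.f 0) = π.f (n + 1) ≫ Y.δ
    rw [zero_comp]
    by_cases hkn : k = n
    · subst hkn
      rw [hπ₁, Category.assoc, hY1, comp_zero]
    · rw [(hz (n + 1) (by omega) (by omega)).eq_of_src (π.f (n + 1)) 0, zero_comp]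
  · rw [hπ₀]
    infer_instance
  · rw [hα₀, hπ₀]
    simp
  · rw [hα₁, hπ₁]
    simp

end SigmaSeq

open SigmaSeq

namespace IsAngulation

variable [HasBinaryBiproducts C] [S.Additive] {Θ : Set (SigmaSeq n S)} (hΘ : IsAngulation Θ)
  [HasZeroObject C] [S.IsEquivalence]
include hΘ

/-- The homotopy writes `𝟙 Y` as `g ≫ f` plus terms factoring through disks, so `Y` is a retract of
`X` plus disks in degrees `0, …, n`. The retraction has a kernel in each degree: in degree `k ≤ n`
it is invertible on the disk placed there, and in degree `n + 1` it is invertible on `X`. -/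
lemma mem_of_homotopy (hn : 1 ≤ n) {X Y : SigmaSeq n S} (hX : X ∈ Θ) (f : X.K ⟶ Y.K)
    (g : Y.K ⟶ X.K) (hf : IsHom f) (hg : IsHom g) (_ : IsIso (f.f (n + 1)))
    (h0 : g.f 0 ≫ f.f 0 = 𝟙 _) (h1 : g.f (n + 1) ≫ f.f (n + 1) = 𝟙 _)
    (H : Homotopy (𝟙 Y.K) (g ≫ f)) : Y ∈ Θ := by
  have hf' : X.δ ≫ S.map (f.f 0) = f.f (n + 1) ≫ Y.δ := hf
  have hg' : Y.δ ≫ S.map (g.f 0) = g.f (n + 1) ≫ X.δ := hg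
  have hY0 : Y.δ ≫ S.map (Y.K.d 0 1) = 0 := by
    have h₁ : Y.K.d 0 1 = g.f 0 ≫ X.K.d 0 1 ≫ f.f 1 := by
      rw [← f.comm, reassoc_of% h0]
    rw [h₁, S.map_comp, S.map_comp, reassoc_of% hg', reassoc_of% (hΘ.δ_map_d hn hX)]
    simp
  have hY1 : Y.K.d n (n + 1) ≫ Y.δ = 0 := by
    have : Y.δ = g.f (n + 1) ≫ X.δ ≫ S.map (f.f 0) := by
      rw [hf', reassoc_of% h1]
    rw [this, ← g.comm_assoc, reassoc_of% (hΘ.d_δ hn hX)]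
    simp
  -- After `k` steps the disks in degrees `0, …, k - 1` have been added, so `s ≫ p` contains exactly
  -- the homotopy components `h : Yⁱ⁺¹ ⟶ Yⁱ` with `i < k`.
  have key : ∀ k, k ≤ n + 1 → ∃ W ∈ Θ, ∃ (s : Y.K ⟶ W.K) (p : W.K ⟶ Y.K), IsHom s ∧ IsHom p ∧
      (∀ i, i < k ∨ i = n + 1 → SplitsWithKernel (p.f i)) ∧
      ∀ i, s.f i ≫ p.f i = (if i < k then dNext i H.hom else 0) +
        (if i ≤ k then prevD i H.hom else 0) + g.f i ≫ f.f i := by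
    intro k
    induction k with
    | zero =>
      refine fun _ => ⟨X, hX, g, f, hg, hf, fun i hi => ?_, fun i => ?_⟩
      · obtain rfl : i = n + 1 := by omega
        exact splitsWithKernel_of_isIso _
      · rcases i with _ | i <;> simp
    | succ k ih =>
      intro hk
      obtain ⟨W, hW, s, p, hs, hp, hK, hsp⟩ := ih (by omega)
      obtain ⟨D, α, π, hD, hα, hπ, hiso, hk0, hk1⟩ :=
        exists_disk hY0 hY1 k (H.hom (k + 1) k) (by omega)
      have hDΘ := hΘ.mem_of_isDisk hn (by omega) hD
      obtain ⟨V, i₁, p₁, i₂, p₂, a₁, a₂, a, a₁₂, a₂₁, hi₁, hp₁, hi₂, hp₂⟩ := exists_isSum W D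
      have hV : V ∈ Θ := hΘ.sum_mem W D V ⟨i₁, p₁, i₂, p₂, a₁, a₂, a, hi₁, hp₁, hi₂, hp₂⟩ hW hDΘ
      have c₁ : ∀ i, i₁.f i ≫ p₁.f i = 𝟙 _ := fun i => by
        rw [← HomologicalComplex.comp_f, a₁, HomologicalComplex.id_f]
      have c₂ : ∀ i, i₂.f i ≫ p₂.f i = 𝟙 _ := fun i => by
        rw [← HomologicalComplex.comp_f, a₂, HomologicalComplex.id_f]
      have c₁₂ : ∀ i, i₁.f i ≫ p₂.f i = 0 := fun i => by
        rw [← HomologicalComplex.comp_f, a₁₂, HomologicalComplex.zero_f]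
      have c₂₁ : ∀ i, i₂.f i ≫ p₁.f i = 0 := fun i => by
        rw [← HomologicalComplex.comp_f, a₂₁, HomologicalComplex.zero_f]
      have c : ∀ i, p₁.f i ≫ i₁.f i + p₂.f i ≫ i₂.f i = 𝟙 _ := fun i => by
        rw [← HomologicalComplex.comp_f, ← HomologicalComplex.comp_f,
          ← HomologicalComplex.add_f_apply, a, HomologicalComplex.id_f]
      refine ⟨V, hV, s ≫ i₁ + α ≫ i₂, p₁ ≫ p + p₂ ≫ π, (hs.comp hi₁).add (hα.comp hi₂),
        (hp₁.comp hp).add (hp₂.comp hπ), fun i hi => ?_, fun i => ?_⟩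
      -- In the new degree `k` the disk is the summand on which the retraction is invertible; in the
      -- other degrees the kernel comes from the previous stage.
      · by_cases hik : i = k
        · subst hik
          refine SplitsWithKernel.of_summand (c₂ i) (c₁ i) (c₂₁ i) (c₁₂ i)
            ((add_comm _ _).trans (c i)) ?_
          have : i₂.f i ≫ (p₁ ≫ p + p₂ ≫ π).f i = π.f i := by
            simp [reassoc_of% (c₂ i), reassoc_of% (c₂₁ i)]
          rw [this]
          exact splitsWithKernel_of_isIso _
        · refine SplitsWithKernel.of_summand (c₁ i) (c₂ i) (c₁₂ i) (c₂₁ i) (c i) ?_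
          have : i₁.f i ≫ (p₁ ≫ p + p₂ ≫ π).f i = p.f i := by
            simp [reassoc_of% (c₁ i), reassoc_of% (c₁₂ i)]
          rw [this]
          exact hK i (by omega)
      · have h₂ : (s ≫ i₁ + α ≫ i₂).f i ≫ (p₁ ≫ p + p₂ ≫ π).f i =
            s.f i ≫ p.f i + α.f i ≫ π.f i := by
          simp [reassoc_of% (c₁ i), reassoc_of% (c₁₂ i), reassoc_of% (c₂ i),
            reassoc_of% (c₂₁ i)]
        rw [h₂, hsp]
        rcases lt_trichotomy i k with h | h | h
        · rw [if_pos h, if_pos h.le, if_pos (by omega), if_pos (by omega),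
            (hD.isZero i (by omega) (by omega)).eq_of_tgt (α.f i) 0]
          simp
        · subst h
          rw [if_neg (lt_irrefl _), if_pos le_rfl, if_pos (by omega), if_pos (by omega), hk0,
            Homotopy.dNext_cochainComplex]
          abel
        · by_cases h' : i = k + 1
          · subst h'
            rw [if_neg (by omega), if_neg (by omega), if_neg (by omega), if_pos (by omega), hk1,
              Homotopy.prevD_succ_cochainComplex]
            abel
          · rw [if_neg (by omega), if_neg (by omega), if_neg (by omega), if_neg (by omega),
              (hD.isZero i (by omega) (by omega)).eq_of_tgt (α.f i) 0]
            simp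
  obtain ⟨W, hW, s, p, hs, hp, hK, hsp⟩ := key (n + 1) le_rfl
  have hz : ∀ i, n + 1 < i → IsZero (Y.K.X i) := Y.isZero
  have hsp' : ∀ i, s.f i ≫ p.f i = 𝟙 _ := fun i => by
    by_cases hi : n + 1 < i
    · exact (hz i hi).eq_of_src _ _
    · have hc := H.comm i
      rw [HomologicalComplex.id_f] at hc
      -- The term missing in degree `n + 1` is zero anyway, as `Yⁿ⁺²` vanishes.
      have h₁ : (if i < n + 1 then dNext i H.hom else 0) = dNext i H.hom := by
        split_ifs with hi'
        · rfl
        · rw [Homotopy.dNext_cochainComplex, (hz (i + 1) (by omega)).eq_of_tgt (Y.K.d i (i + 1)) 0,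
            zero_comp]
      rw [hsp, hc, h₁, if_pos (by omega)]
      rfl
  refine hΘ.mem_of_retract hW s p hs hp (by ext i; exact hsp' i) (fun i => ?_)
  by_cases hi : i ≤ n + 1
  · exact hK i (by omega)
  · have h₁ := W.isZero i (by omega)
    have h₂ := hz i (by omega)
    have := h₁.isIso h₂ (p.f i)
    exact splitsWithKernel_of_isIso _

/-- Exactness of the contravariant Hom sequence builds a contraction of `φ` degree by degree,
starting from `φ⁰ = 0` and reaching degree `n`. Only degree `n + 1` can fail, and composing with `ψ`
removes it. -/
lemma exists_homotopyZero (hn : 1 ≤ n) {X : SigmaSeq n S} (hX : X ∈ Θ) (φ ψ : X.K ⟶ X.K)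
    (hφ : φ.f 0 = 0) (hψ : ψ.f (n + 1) = 0) : Nonempty (Homotopy (φ ≫ ψ) 0) := by
  have key : ∀ m, m ≤ n → ∃ k : ∀ i, X.K.X (i + 1) ⟶ X.K.X i, k 0 = 0 ∧
      ∀ i, i < m → φ.f (i + 1) = X.K.d (i + 1) (i + 2) ≫ k (i + 1) + k i ≫ X.K.d i (i + 1) := by
    intro m
    induction m with
    | zero => exact fun _ => ⟨0, rfl, by simp⟩
    | succ m ih =>
      intro hm
      obtain ⟨k, hk0, hk⟩ := ih (by omega)
      have h₁ : X.K.d m (m + 1) ≫ (φ.f (m + 1) - k m ≫ X.K.d m (m + 1)) = 0 := by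
        rw [Preadditive.comp_sub, ← φ.comm]
        rcases m with _ | m
        · simp [hφ, hk0]
        · rw [hk m (by omega)]
          simp
      obtain ⟨y, hy⟩ := hΘ.exists_desc hn (i := m) (by omega) hX _ h₁
      refine ⟨Function.update k (m + 1) y, by simp [Function.update, hk0], fun i hi => ?_⟩
      by_cases him : i = m
      · subst him
        simp [Function.update, hy]
      · have h₂ : i ≠ m + 1 := by omega
        simp [Function.update, him, h₂, hk i (by omega)]
  obtain ⟨k, hk0, hk⟩ := key n le_rfl
  refine ⟨homotopyZero (fun i => k i ≫ ψ.f i) (by simp [hφ, hk0]) (fun i => ?_)⟩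
  by_cases hi : i < n
  · rw [HomologicalComplex.comp_f, hk i hi]
    simp
  · by_cases hi' : i = n
    · subst hi'
      rw [HomologicalComplex.comp_f, Category.assoc, ψ.comm, hψ,
        (X.isZero (i + 2) (by omega)).eq_of_tgt (X.K.d (i + 1) (i + 2)) 0]
      simp
    · exact (X.isZero (i + 1) (by omega)).eq_of_src _ _

end IsAngulation

end NExang

/-! ### Morphisms of angles with prescribed end components. -/

namespace NExang

variable {C : Type u} [Category.{v} C] [Preadditive C] {n : ℕ} {S : C ⥤ C}

section

variable [HasBinaryBiproducts C]

/-- The equational form supplies the inclusions belonging to the projections `f` and `g`, and it is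
preserved by additive functors. -/
lemma isIso_biprod_lift_iff {A X Y : C} (f : A ⟶ X) (g : A ⟶ Y) :
    IsIso (biprod.lift f g) ↔ ∃ (i : X ⟶ A) (j : Y ⟶ A), i ≫ f = 𝟙 X ∧ i ≫ g = 0 ∧
      j ≫ f = 0 ∧ j ≫ g = 𝟙 Y ∧ f ≫ i + g ≫ j = 𝟙 A := by
  constructor
  · intro h
    have h₁ : inv (biprod.lift f g) ≫ f = biprod.fst := by simp
    have h₂ : inv (biprod.lift f g) ≫ g = biprod.snd := by simp
    refine ⟨biprod.inl ≫ inv (biprod.lift f g), biprod.inr ≫ inv (biprod.lift f g), ?_, ?_, ?_,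
      ?_, ?_⟩
    · rw [Category.assoc, h₁, biprod.inl_fst]
    · rw [Category.assoc, h₂, biprod.inl_snd]
    · rw [Category.assoc, h₁, biprod.inr_fst]
    · rw [Category.assoc, h₂, biprod.inr_snd]
    · rw [← Category.assoc, ← Category.assoc, ← Preadditive.add_comp, IsIso.comp_inv_eq,
        Category.id_comp]
      ext <;> simp
  · rintro ⟨i, j, h₁, h₂, h₃, h₄, h₅⟩
    refine ⟨biprod.desc i j, by rw [biprod.lift_desc, h₅], ?_⟩
    ext <;> simp [h₁, h₂, h₃, h₄]

lemma isIso_biprod_lift_comp {A A' X Y X' Y' : C} (s : A' ⟶ A) {f : A ⟶ X} {g : A ⟶ Y}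
    (a : X ⟶ X') (b : Y ⟶ Y') [IsIso s] [IsIso a] [IsIso b] (h : IsIso (biprod.lift f g)) :
    IsIso (biprod.lift (s ≫ f ≫ a) (s ≫ g ≫ b)) := by
  have : biprod.lift (s ≫ f ≫ a) (s ≫ g ≫ b) = s ≫ biprod.lift f g ≫ biprod.map a b := by
    ext <;> simp
  rw [this]
  have : IsIso (biprod.map a b) := (biprod.mapIso (asIso a) (asIso b)).isIso_hom
  infer_instance

lemma isIso_biprod_lift_map [S.Additive] {A X Y : C} {f : A ⟶ X} {g : A ⟶ Y}
    (h : IsIso (biprod.lift f g)) : IsIso (biprod.lift (S.map f) (S.map g)) := by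
  obtain ⟨i, j, h₁, h₂, h₃, h₄, h₅⟩ := (isIso_biprod_lift_iff _ _).1 h
  refine (isIso_biprod_lift_iff _ _).2 ⟨S.map i, S.map j, ?_, ?_, ?_, ?_, ?_⟩
  · rw [← S.map_comp, h₁, S.map_id]
  · rw [← S.map_comp, h₂, S.map_zero]
  · rw [← S.map_comp, h₃, S.map_zero]
  · rw [← S.map_comp, h₄, S.map_id]
  · rw [← S.map_comp, ← S.map_comp, ← S.map_add, h₅, S.map_id]

end

open SigmaSeq

namespace IsAngulation

variable [HasBinaryBiproducts C] [S.Additive] {Θ : Set (SigmaSeq n S)} (hΘ : IsAngulation Θ)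
  [HasZeroObject C] [S.IsEquivalence]
include hΘ

/-- Extension of a compatible pair `(a, c)` in the degrees `0` and `n + 1` to a morphism of
`(n+2)`-angles, the cone `W` of which (shifted by one) is an `(n+2)`-angle. -/
lemma exists_hom_ends (hn : 1 ≤ n) {X Y : SigmaSeq n S} (hX : X ∈ Θ) (hY : Y ∈ Θ)
    (a : X.K.X 0 ⟶ Y.K.X 0) (c : X.K.X (n + 1) ⟶ Y.K.X (n + 1))
    (hac : X.δ ≫ S.map a = c ≫ Y.δ) :
    ∃ f : X.K ⟶ Y.K, f.f 0 = a ∧ f.f (n + 1) = c ∧ ∃ W ∈ Θ,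
      ∃ (u : ∀ i, W.K.X i ⟶ X.K.X i) (v : ∀ i, W.K.X (i + 1) ⟶ Y.K.X i)
        (v' : S.obj (W.K.X 0) ⟶ Y.K.X (n + 1)),
        (∀ i, i ≤ n → IsIso (biprod.lift (u (i + 1)) (v i))) ∧
        IsIso (biprod.lift (S.map (u 0)) v') ∧
        (∀ i, i ≤ n → W.K.d i (i + 1) ≫ u (i + 1) = -(u i ≫ X.K.d i (i + 1))) ∧
        S.map (W.K.d 0 1 ≫ v 0) = S.map (u 0 ≫ a) + (-1 : ℤ) ^ n • (v' ≫ Y.δ) ∧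
        (∀ i, i < n → W.K.d (i + 1) (i + 2) ≫ v (i + 1) =
          u (i + 1) ≫ f.f (i + 1) + v i ≫ Y.K.d i (i + 1)) ∧
        W.δ ≫ S.map (u 0) = -((-1 : ℤ) ^ n • (u (n + 1) ≫ X.δ)) ∧
        W.δ ≫ v' = u (n + 1) ≫ c + v n ≫ Y.K.d n (n + 1) := by
  -- Rotating both angles backwards brings `c` and `a` into degrees `0` and `1`, where (F3) and (F4)
  -- apply.
  obtain ⟨X', hX', p, t, hp, hpd, hpn, hpδ⟩ := hΘ.exists_unrotation hn hX
  obtain ⟨Y', hY', q, r, hq, hqd, hqn, hqδ⟩ := hΘ.exists_unrotation hn hY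
  -- Inverses of the comparison maps as one family over all degrees; beyond degree `n` the value `0`
  -- is a default.
  have hp' : ∀ i, ∃ k : X'.K.X (i + 1) ⟶ X.K.X i, i ≤ n → p i ≫ k = 𝟙 _ ∧ k ≫ p i = 𝟙 _ :=
    fun i => by
      by_cases hi : i ≤ n
      · obtain ⟨k, hk⟩ := (hp i hi).out
        exact ⟨k, fun _ => hk⟩
      · exact ⟨0, fun h => absurd h hi⟩
  have hq' : ∀ i, ∃ k : Y'.K.X (i + 1) ⟶ Y.K.X i, i ≤ n → q i ≫ k = 𝟙 _ ∧ k ≫ q i = 𝟙 _ :=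
    fun i => by
      by_cases hi : i ≤ n
      · obtain ⟨k, hk⟩ := (hq i hi).out
        exact ⟨k, fun _ => hk⟩
      · exact ⟨0, fun h => absurd h hi⟩
  choose pi hpi using hp'
  choose qi hqi using hq'
  have hpid : ∀ i, i < n → pi i ≫ X.K.d i (i + 1) = X'.K.d (i + 1) (i + 2) ≫ pi (i + 1) :=
    fun i hi => by
      rw [← Category.comp_id (X.K.d i (i + 1)), ← (hpi (i + 1) (by omega)).1,
        reassoc_of% (hpd i hi), reassoc_of% (hpi i (by omega)).2]
  have hqid : ∀ i, i < n → qi i ≫ Y.K.d i (i + 1) = Y'.K.d (i + 1) (i + 2) ≫ qi (i + 1) :=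
    fun i hi => by
      rw [← Category.comp_id (Y.K.d i (i + 1)), ← (hqi (i + 1) (by omega)).1,
        reassoc_of% (hqd i hi), reassoc_of% (hqi i (by omega)).2]
  have hpin : pi n ≫ X.K.d n (n + 1) = X'.δ ≫ t.inv := by
    rw [← cancel_mono t.hom, Category.assoc, hpn, reassoc_of% (hpi n le_rfl).2]
    simp
  have hqin : qi n ≫ Y.K.d n (n + 1) = Y'.δ ≫ r.inv := by
    rw [← cancel_mono r.hom, Category.assoc, hqn, reassoc_of% (hqi n le_rfl).2]
    simp
  have hpSd : S.map (X'.K.d 0 1) = (-1 : ℤ) ^ n • (t.inv ≫ X.δ ≫ S.map (p 0)) := by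
    rw [hpδ, Preadditive.comp_zsmul, neg_one_pow_smul_smul, t.inv_hom_id_assoc]
  have hqSd : S.map (Y'.K.d 0 1) = (-1 : ℤ) ^ n • (r.inv ≫ Y.δ ≫ S.map (q 0)) := by
    rw [hqδ, Preadditive.comp_zsmul, neg_one_pow_smul_smul, r.inv_hom_id_assoc]
  have hp0 : S.map (p 0) ≫ S.map (pi 0) = 𝟙 _ := by
    rw [← S.map_comp, (hpi 0 (by omega)).1, S.map_id]
  have hq0 : S.map (q 0) ≫ S.map (qi 0) = 𝟙 _ := by
    rw [← S.map_comp, (hqi 0 (by omega)).1, S.map_id]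
  have hpSdi : S.map (X'.K.d 0 1) ≫ S.map (pi 0) = (-1 : ℤ) ^ n • (t.inv ≫ X.δ) := by
    rw [hpSd, Preadditive.zsmul_comp, Category.assoc, Category.assoc, hp0, Category.comp_id]
  have hqSdi : S.map (Y'.K.d 0 1) ≫ S.map (qi 0) = (-1 : ℤ) ^ n • (r.inv ≫ Y.δ) := by
    rw [hqSd, Preadditive.zsmul_comp, Category.assoc, Category.assoc, hq0, Category.comp_id]
  obtain ⟨g, hg, hg0, hg1, W, hW, uu, w, vv, hi, hin, hdu, hdw, hdv, hδu, hδv⟩ :=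
    hΘ.exists_hom X' hX' Y' hY' (S.preimage (t.inv ≫ c ≫ r.hom)) (pi 0 ≫ a ≫ q 0)
      (S.map_injective (by
        rw [S.map_comp, S.map_comp, S.map_comp, S.map_comp, S.map_preimage,
          reassoc_of% hpSdi, hqSd]
        simp [reassoc_of% hac]))
  have hgS : S.map (g.f 0) = t.inv ≫ c ≫ r.hom := by rw [hg0, S.map_preimage]
  have hg' : X'.δ ≫ S.map (g.f 0) = g.f (n + 1) ≫ Y'.δ := hg
  let F : ∀ i, X.K.X i ⟶ Y.K.X i :=
    Function.update (fun i => p i ≫ g.f (i + 1) ≫ qi i) (n + 1) c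
  have F1 : F (n + 1) = c := by simp [F]
  have F2 : ∀ i, i ≤ n → F i = p i ≫ g.f (i + 1) ≫ qi i := fun i hi => by
    have : i ≠ n + 1 := by omega
    simp [F, this]
  let f : X.K ⟶ Y.K := chainMap F (fun i => by
    rcases lt_trichotomy i n with h | h | h
    · rw [F2 i h.le, F2 (i + 1) (by omega), Category.assoc, Category.assoc, hqid i h,
        g.comm_assoc, reassoc_of% (hpd i h)]
    · subst h
      rw [F2 _ le_rfl, F1, Category.assoc, Category.assoc, hqin, ← reassoc_of% hg', hgS,
        ← reassoc_of% hpn]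
      simp
    · exact (Y.isZero _ (by omega)).eq_of_tgt _ _)
  let u : ∀ i, W.K.X i ⟶ X.K.X i :=
    Function.update (fun i => uu i ≫ pi i) (n + 1) (w ≫ t.inv)
  have u1 : u (n + 1) = w ≫ t.inv := by simp [u]
  have u2 : ∀ i, i ≤ n → u i = uu i ≫ pi i := fun i hi => by
    have : i ≠ n + 1 := by omega
    simp [u, this]
  have hpi_iso : ∀ i, i ≤ n → IsIso (pi i) := fun i hi => ⟨p i, (hpi i hi).2, (hpi i hi).1⟩
  have hqi_iso : ∀ i, i ≤ n → IsIso (qi i) := fun i hi => ⟨q i, (hqi i hi).2, (hqi i hi).1⟩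
  refine ⟨f, ?_, F1, W, hW, u, fun i => vv (i + 1) ≫ qi i, S.map (vv 0) ≫ r.inv,
    fun i hin' => ?_, ?_, fun i hin' => ?_, ?_, fun i hin' => ?_, ?_, ?_⟩
  · change F 0 = a
    rw [F2 0 (by omega), hg1, Category.assoc, Category.assoc, (hqi 0 (by omega)).1,
      reassoc_of% (hpi 0 (by omega)).1, Category.comp_id]
  · have := hqi_iso i hin'
    by_cases h : i = n
    · subst h
      rw [u1]
      simpa using isIso_biprod_lift_comp (𝟙 _) t.inv (qi i) hin
    · have := hpi_iso (i + 1) (by omega)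
      rw [u2 (i + 1) (by omega)]
      simpa using isIso_biprod_lift_comp (𝟙 _) (pi (i + 1)) (qi i)
        (hi (i + 1) (by omega))
  · have := hpi_iso 0 (by omega)
    rw [u2 0 (by omega), S.map_comp]
    simpa using isIso_biprod_lift_comp (𝟙 _) (S.map (pi 0)) r.inv
      (isIso_biprod_lift_map (hi 0 (by omega)))
  · by_cases h : i = n
    · subst h
      rw [u1, u2 _ le_rfl, reassoc_of% hdw, Category.assoc, hpin]
      simp
    · rw [u2 _ hin', u2 (i + 1) (by omega), reassoc_of% (hdu i (by omega)), Category.assoc,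
        hpid i (by omega)]
      simp
  · rw [reassoc_of% (hdv 0 (by omega)), u2 0 (by omega), Preadditive.add_comp, S.map_add]
    simp only [Category.assoc, S.map_comp, hg1, hq0, hqSdi, Category.comp_id]
    simp
  · change _ = u (i + 1) ≫ F (i + 1) + _
    rw [reassoc_of% (hdv (i + 1) (by omega)), u2 (i + 1) (by omega), F2 (i + 1) (by omega),
      Category.assoc, Category.assoc, hqid i hin', reassoc_of% (hpi (i + 1) (by omega)).2]
    simp
  · rw [u2 0 (by omega), u1, S.map_comp, reassoc_of% hδu]
    simp [hpSdi]
  · rw [u1, reassoc_of% hδv, Preadditive.add_comp, hgS]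
    simp [hqin]

end IsAngulation

end NExang

/-! ### Good lifts: splitting a contractible piece off the cone. -/

namespace NExang

variable {C : Type u} [Category.{v} C] [Preadditive C] {n : ℕ} {S : C ⥤ C}

open SigmaSeq

namespace IsAngulation

variable [HasBinaryBiproducts C] [S.Additive] {Θ : Set (SigmaSeq n S)} (hΘ : IsAngulation Θ)
  [HasZeroObject C] [S.IsEquivalence]
include hΘ

/-- The cone is `X⁰ ⊞ S⁻¹Yⁿ⁺¹ ⟶ X¹ ⊞ Y⁰ ⟶ ⋯ ⟶ Xⁿ⁺¹ ⊞ Yⁿ ⟶ S X⁰ ⊞ Yⁿ⁺¹`. Its connecting map sends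
`Xⁿ⁺¹` to `Yⁿ⁺¹` by the isomorphism `c`; removing these two summands, which sit in the end degrees,
leaves the mapping cocone. -/
lemma exists_good_colift (hn : 1 ≤ n) {X Y : SigmaSeq n S} (hX : X ∈ Θ) (hY : Y ∈ Θ)
    (a : X.K.X 0 ⟶ Y.K.X 0) (c : X.K.X (n + 1) ⟶ Y.K.X (n + 1)) (_ : IsIso c)
    (hac : X.δ ≫ S.map a = c ≫ Y.δ) :
    ∃ f : X.K ⟶ Y.K, f.f 0 = a ∧ f.f (n + 1) = c ∧ ∃ N ∈ Θ,
      ∃ (u : ∀ i, N.K.X i ⟶ X.K.X i) (v : ∀ i, N.K.X (i + 1) ⟶ Y.K.X i),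
        IsMappingCocone n f N.K u v ∧
        N.δ ≫ S.map (u 0) = v n ≫ Y.K.d n (n + 1) ≫ inv c ≫ X.δ := by
  obtain ⟨f, hf0, hf1, W, hW, u, v, v', hi, hi0, hdu, hdv0, hdv, hδu, hδv⟩ :=
    hΘ.exists_hom_ends hn hX hY a c hac
  obtain ⟨I, J, hIu, hIv, hJu, hJv, hIJ⟩ := (isIso_biprod_lift_iff _ _).1 hi0
  obtain ⟨k, l, hku, hkv, hlu, hlv, hkl⟩ := (isIso_biprod_lift_iff _ _).1 (hi n le_rfl)
  have hδdX : X.δ ≫ S.map (X.K.d 0 1) = 0 := hΘ.δ_map_d hn hX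
  have hdδX' : inv c ≫ X.δ ≫ S.map a = Y.δ := by rw [hac, IsIso.inv_hom_id_assoc]
  let τ : X.K.X 0 ⟶ W.K.X 0 := S.preimage I
  have hτ : S.map τ = I := S.map_preimage I
  let θ : W.K.X 0 ⟶ X.K.X 0 := S.preimage (v' ≫ inv c ≫ X.δ)
  have hθ : S.map θ = v' ≫ inv c ≫ X.δ := S.map_preimage _
  have hτu : τ ≫ u 0 = 𝟙 _ := S.map_injective (by rw [S.map_comp, hτ, hIu, S.map_id])
  have hτθ : τ ≫ θ = 0 := S.map_injective (by
    rw [S.map_comp, hτ, hθ, reassoc_of% hIv, zero_comp, S.map_zero])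
  -- The plain inclusion `l` of `Yⁿ` is corrected so that `σ ≫ W.δ ≫ v' = 0`: the remaining part
  -- must not hit the summand `Yⁿ⁺¹`.
  let σ : Y.K.X n ⟶ W.K.X (n + 1) := l - Y.K.d n (n + 1) ≫ inv c ≫ k
  have hσv : σ ≫ v n = 𝟙 _ := by simp [σ, Preadditive.sub_comp, hkv, hlv]
  have hσu : σ ≫ u (n + 1) = -(Y.K.d n (n + 1) ≫ inv c) := by
    simp [σ, Preadditive.sub_comp, hku, hlu]
  -- The images of `e₀` and `e₁` are copies of `X⁰` and `Yⁿ`. The complements are copies of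
  -- `S⁻¹Yⁿ⁺¹` and `Xⁿ⁺¹`, and `e₀` is corrected by `θ` so that its complement is killed by the
  -- first differential.
  let e₀ : W.K.X 0 ⟶ W.K.X 0 := (u 0 + (-1 : ℤ) ^ n • θ) ≫ τ
  let e₁ : W.K.X (n + 1) ⟶ W.K.X (n + 1) := v n ≫ σ
  have hSe₀ : S.map e₀ =
      (S.map (u 0) + (-1 : ℤ) ^ n • (v' ≫ inv c ≫ X.δ)) ≫ I := by
    simp only [e₀, S.map_comp, S.map_add, S.map_zsmul, hτ, hθ]
  have hSe₀' : S.map (𝟙 _ - e₀) = v' ≫ (J - (-1 : ℤ) ^ n • (inv c ≫ X.δ ≫ I)) := by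
    rw [S.map_sub, S.map_id, hSe₀, ← hIJ]
    simp [Preadditive.add_comp, Preadditive.comp_sub]
  let b : S.obj (S.objPreimage (Y.K.X (n + 1))) ≅ Y.K.X (n + 1) := S.objObjPreimageIso _
  have h₀ : SplitIdem e₀ := ⟨_, τ, u 0 + (-1 : ℤ) ^ n • θ, by simp [hτu, hτθ], rfl⟩
  have h₀' : SplitIdem (𝟙 _ - e₀) :=
    ⟨S.objPreimage (Y.K.X (n + 1)),
      S.preimage (b.hom ≫ (J - (-1 : ℤ) ^ n • (inv c ≫ X.δ ≫ I))), S.preimage (v' ≫ b.inv),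
      S.map_injective (by
        simp only [S.map_comp, S.map_preimage, Category.assoc]
        rw [← Category.assoc (J - _), Preadditive.sub_comp, hJv]
        simp [hIv]),
      S.map_injective (by
        rw [S.map_comp, S.map_preimage, S.map_preimage, hSe₀']
        simp)⟩
  have h₁ : SplitIdem e₁ := ⟨_, σ, v n, hσv, rfl⟩
  have h₁' : SplitIdem (𝟙 _ - e₁) := by
    refine ⟨_, k, u (n + 1) + v n ≫ Y.K.d n (n + 1) ≫ inv c, by simp [hku, reassoc_of% hkv], ?_⟩
    rw [← hkl]
    simp only [e₁, σ, Preadditive.comp_sub, Preadditive.add_comp, Category.assoc]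
    abel
  have hmono : ∀ {A : C} (x y : A ⟶ W.K.X 1), x ≫ u 1 = y ≫ u 1 → x ≫ v 0 = y ≫ v 0 → x = y := by
    intro A x y hu hv
    have := hi 0 (by omega)
    rw [← cancel_mono (biprod.lift (u (0 + 1)) (v 0))]
    ext
    · simpa using hu
    · simpa using hv
  have hd₀ : e₀ ≫ W.K.d 0 1 = W.K.d 0 1 := by
    refine hmono _ _ ?_ (S.map_injective ?_)
    · rw [Category.assoc, hdu 0 (by omega), Preadditive.comp_neg]
      have hθd : θ ≫ X.K.d 0 1 = 0 := S.map_injective (by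
        rw [S.map_comp, hθ, Category.assoc, Category.assoc, hδdX]
        simp)
      simp [e₀, reassoc_of% hτu, hθd, Preadditive.add_comp]
    · rw [Category.assoc, S.map_comp, hdv0, hSe₀]
      simp only [S.map_comp, Preadditive.add_comp, Preadditive.comp_add, Category.assoc,
        Preadditive.comp_zsmul, Preadditive.zsmul_comp, reassoc_of% hIu, reassoc_of% hIv,
        hdδX', zero_comp, comp_zero, smul_zero, add_zero]
  have hd₁ : W.K.d n (n + 1) ≫ e₁ = W.K.d n (n + 1) := by
    have h₂ : W.K.d n (n + 1) ≫ (u (n + 1) + v n ≫ Y.K.d n (n + 1) ≫ inv c) = 0 := by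
      have h₃ : W.K.d n (n + 1) ≫ W.δ ≫ v' = 0 := by
        rw [reassoc_of% (hΘ.d_δ hn hW), zero_comp]
      rw [hδv] at h₃
      rw [← cancel_mono c, zero_comp, ← h₃]
      simp
    have h₃ : e₁ = 𝟙 _ - (u (n + 1) + v n ≫ Y.K.d n (n + 1) ≫ inv c) ≫ k := by
      rw [← hkl]
      simp [e₁, σ, Preadditive.comp_sub, Preadditive.add_comp]
    rw [h₃, Preadditive.comp_sub, reassoc_of% h₂]
    simp
  have hδ : W.δ ≫ S.map e₀ = e₁ ≫ W.δ := by
    have h₂ : σ ≫ W.δ = (-1 : ℤ) ^ n • (Y.K.d n (n + 1) ≫ inv c ≫ X.δ ≫ I) := by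
      rw [← Category.comp_id W.δ, ← hIJ, Preadditive.comp_add, Preadditive.comp_add,
        reassoc_of% hδu, reassoc_of% hδv]
      simp only [Preadditive.add_comp, Preadditive.comp_add, Preadditive.neg_comp,
        Preadditive.comp_neg, Preadditive.zsmul_comp, Preadditive.comp_zsmul, Category.assoc,
        reassoc_of% hσu, reassoc_of% hσv, IsIso.inv_hom_id_assoc]
      simp
    rw [hSe₀, ← Category.assoc, Preadditive.comp_add, Preadditive.comp_zsmul, hδu,
      reassoc_of% hδv]
    simp only [e₁, Category.assoc, h₂, Preadditive.add_comp, Preadditive.neg_comp,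
      Preadditive.zsmul_comp, Preadditive.comp_zsmul, IsIso.hom_inv_id_assoc]
    simp
  obtain ⟨N, hN, s, p, hs, hp, hsp, hps0, hps1, hiso⟩ :=
    hΘ.exists_splitting_ends hn hW e₀ e₁ h₀ h₀' h₁ h₁' hd₀ hd₁ hδ
  have hs' : N.δ ≫ S.map (s.f 0) = s.f (n + 1) ≫ W.δ := hs
  have hsp' : ∀ i, s.f i ≫ p.f i = 𝟙 _ := fun i => by
    rw [← HomologicalComplex.comp_f, hsp, HomologicalComplex.id_f]
  have hse0 : s.f 0 ≫ e₀ = s.f 0 := by rw [← hps0, reassoc_of% (hsp' 0)]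
  have hse1 : s.f (n + 1) ≫ e₁ = s.f (n + 1) := by rw [← hps1, reassoc_of% (hsp' (n + 1))]
  have hsv' : S.map (s.f 0) ≫ v' = 0 := by
    rw [← hse0, S.map_comp, hSe₀, Category.assoc, Category.assoc, hIv]
    simp
  have hsθ : s.f 0 ≫ θ = 0 := S.map_injective (by
    rw [S.map_comp, hθ, reassoc_of% hsv', zero_comp, S.map_zero])
  have hsu : s.f 0 ≫ u 0 ≫ τ = s.f 0 := by
    conv_rhs => rw [← hse0]
    simp [e₀, Preadditive.add_comp, reassoc_of% hsθ]
  have hsu1 : s.f (n + 1) ≫ u (n + 1) = -(s.f (n + 1) ≫ v n ≫ Y.K.d n (n + 1) ≫ inv c) := by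
    conv_lhs => rw [← hse1]
    simp [e₁, hσu]
  have hsign : ∀ i : ℕ, (-1 : ℤ) ^ (i + 1) = -(-1 : ℤ) ^ i := fun i => by rw [pow_succ]; ring
  have hunit : ∀ (i : ℕ) (A : C), IsIso ((-1 : ℤ) ^ i • 𝟙 A) := fun i A =>
    ⟨(-1 : ℤ) ^ i • 𝟙 A, by
      simp only [Preadditive.comp_zsmul, Category.comp_id,
        neg_one_pow_smul_smul, and_self]⟩
  -- The signs `(-1)ⁱ` on the projections change the cone differential `[-d 0; f d]` into the cocone
  -- differential `[d 0; f -d]`.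
  refine ⟨f, hf0, hf1, N, hN, fun i => (-1 : ℤ) ^ i • (s.f i ≫ u i),
    fun i => (-1 : ℤ) ^ i • (s.f (i + 1) ≫ v i), ⟨?_, fun i hin => ?_, ?_, fun i hin => ?_, ?_,
    fun i hin => ?_⟩, ?_⟩
  · rw [pow_zero, one_smul]
    refine ⟨τ ≫ p.f 0, ?_, ?_⟩
    · rw [Category.assoc, reassoc_of% hsu, hsp']
    · rw [Category.assoc, reassoc_of% hps0]
      simp [e₀, Preadditive.add_comp, Preadditive.comp_add, hτu, hτθ]
  · have := hiso (i + 1) (by omega) (by omega)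
    have := hunit (i + 1) (X.K.X (i + 1))
    have := hunit i (Y.K.X i)
    simpa using isIso_biprod_lift_comp (s.f (i + 1)) ((-1 : ℤ) ^ (i + 1) • 𝟙 (X.K.X (i + 1)))
      ((-1 : ℤ) ^ i • 𝟙 (Y.K.X i)) (hi i hin.le)
  · refine ⟨(-1 : ℤ) ^ n • (σ ≫ p.f (n + 1)), ?_, ?_⟩
    · simp only [Preadditive.zsmul_comp, Preadditive.comp_zsmul, neg_one_pow_smul_smul,
        Category.assoc]
      rw [← Category.assoc (v n), reassoc_of% hse1, hsp']
    · simp only [Preadditive.zsmul_comp, Preadditive.comp_zsmul, neg_one_pow_smul_smul,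
        Category.assoc]
      rw [reassoc_of% hps1]
      simp [e₁, hσv]
  · rw [Preadditive.comp_zsmul, ← s.comm_assoc, hdu i (by omega), hsign]
    simp
  · simp only [pow_zero, one_smul]
    refine S.map_injective ?_
    rw [← s.comm_assoc, S.map_comp, hdv0, hf0]
    simp [reassoc_of% hsv']
  · rw [Preadditive.comp_zsmul, ← s.comm_assoc, hdv i hin, hsign]
    simp [sub_eq_add_neg]
  · beta_reduce
    rw [pow_zero, one_smul, S.map_comp, reassoc_of% hs', hδu, Preadditive.zsmul_comp,
      Preadditive.comp_neg, Preadditive.comp_zsmul, reassoc_of% hsu1]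
    simp

/-- This time `a` identifies the summand `X⁰` of `W⁰` with the summand `Y⁰` of `W¹`. One rotation of
the cone puts this contractible piece into the end degrees, where it is split off; the mapping cone
remains. -/
lemma exists_good_lift (hn : 1 ≤ n) {X Y : SigmaSeq n S} (hX : X ∈ Θ) (hY : Y ∈ Θ)
    (a : X.K.X 0 ⟶ Y.K.X 0) (c : X.K.X (n + 1) ⟶ Y.K.X (n + 1)) (_ : IsIso a)
    (hac : X.δ ≫ S.map a = c ≫ Y.δ) :
    ∃ f : X.K ⟶ Y.K, f.f 0 = a ∧ f.f (n + 1) = c ∧ ∃ M ∈ Θ,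
      ∃ (u : ∀ i, M.K.X i ⟶ X.K.X (i + 1)) (v : ∀ i, M.K.X i ⟶ Y.K.X i),
        IsMappingCone n f M.K u v ∧
        M.δ ≫ S.map (u 0) = v (n + 1) ≫ Y.δ ≫ S.map (inv a ≫ X.K.d 0 1) := by
  obtain ⟨f, hf0, hf1, W, hW, u, v, v', hi, hi0, hdu, hdv0, hdv, hδu, hδv⟩ :=
    hΘ.exists_hom_ends hn hX hY a c hac
  obtain ⟨V, hV, g, t, hg, hgd, hgn, hgδ⟩ := hΘ.exists_rotation hn hW
  obtain ⟨I, J, hIu, hIv, hJu, hJv, hIJ⟩ := (isIso_biprod_lift_iff _ _).1 hi0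
  obtain ⟨k, l, hku, hkv, hlu, hlv, hkl⟩ := (isIso_biprod_lift_iff (u 1) (v 0)).1 (hi 0 (by omega))
  have hdδY : Y.K.d n (n + 1) ≫ Y.δ = 0 := hΘ.d_δ hn hY
  have hadf : inv a ≫ X.K.d 0 1 ≫ f.f 1 = Y.K.d 0 1 := by
    rw [← f.comm, hf0, IsIso.inv_hom_id_assoc]
  have hcδ : c ≫ Y.δ ≫ S.map (inv a) = X.δ := by
    rw [← reassoc_of% hac, ← S.map_comp, IsIso.hom_inv_id, S.map_id, Category.comp_id]
  -- Eliminating `Y⁰` against `X⁰` through `a⁻¹` produces `μ` and `ν`. They correct the projection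
  -- onto `X¹` and the inclusion of `Yⁿ⁺¹`, so that `l - μ ≫ k` is killed by the next differential
  -- and `W.δ` factors through the image of `e₁`.
  let μ : Y.K.X 0 ⟶ X.K.X 1 := inv a ≫ X.K.d 0 1
  let κ : W.K.X 1 ⟶ X.K.X 1 := u 1 + v 0 ≫ μ
  let ν : Y.K.X (n + 1) ⟶ S.obj (X.K.X 0) := Y.δ ≫ S.map (inv a)
  let l' : Y.K.X (n + 1) ⟶ S.obj (W.K.X 0) := J - (-1 : ℤ) ^ n • (ν ≫ I)
  let e₀ : W.K.X 1 ⟶ W.K.X 1 := κ ≫ k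
  let e₁ : S.obj (W.K.X 0) ⟶ S.obj (W.K.X 0) := v' ≫ l'
  have hkκ : k ≫ κ = 𝟙 _ := by simp [κ, Preadditive.comp_add, hku, reassoc_of% hkv]
  have hl'v : l' ≫ v' = 𝟙 _ := by simp [l', Preadditive.sub_comp, hJv, hIv]
  have hl'u : l' ≫ S.map (u 0) = -((-1 : ℤ) ^ n • ν) := by
    simp [l', Preadditive.sub_comp, hJu, hIu]
  have he₀ : 𝟙 _ - e₀ = v 0 ≫ (l - μ ≫ k) := by
    rw [← hkl]
    simp only [e₀, κ, Preadditive.comp_sub, Preadditive.add_comp, Category.assoc]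
    abel
  have he₁ : 𝟙 _ - e₁ = (S.map (u 0) + (-1 : ℤ) ^ n • (v' ≫ ν)) ≫ I := by
    rw [← hIJ]
    simp only [e₁, l', Preadditive.comp_sub, Preadditive.add_comp, Category.assoc,
      Preadditive.comp_zsmul, Preadditive.zsmul_comp]
    abel
  have := hg 0 (by omega)
  have h1iso := hg 1 hn
  let G : V.K.X 0 ≅ W.K.X 1 := asIso (g 0)
  have hG : G.hom = g 0 := rfl
  have hmono : ∀ {A : C} (x y : A ⟶ W.K.X 2), x ≫ u 2 = y ≫ u 2 → x ≫ v 1 = y ≫ v 1 → x = y := by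
    intro A x y hu hv
    have := hi 1 hn
    rw [← cancel_mono (biprod.lift (u (1 + 1)) (v 1))]
    ext
    · simpa using hu
    · simpa using hv
  have hd₀ : e₀ ≫ W.K.d 1 2 = W.K.d 1 2 := by
    have h : (l - μ ≫ k) ≫ W.K.d 1 2 = 0 := by
      have hdu1 : W.K.d 1 2 ≫ u 2 = -(u 1 ≫ X.K.d 1 2) := hdu 1 hn
      have hdv1 : W.K.d 1 2 ≫ v 1 = u 1 ≫ f.f 1 + v 0 ≫ Y.K.d 0 1 := hdv 0 (by omega)
      refine hmono _ _ ?_ ?_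
      · rw [Category.assoc, hdu1, zero_comp]
        simp [μ, Preadditive.sub_comp, reassoc_of% hlu, reassoc_of% hku]
      · rw [Category.assoc, hdv1, zero_comp]
        simp [μ, Preadditive.sub_comp, reassoc_of% hlu, reassoc_of% hku,
          reassoc_of% hlv, reassoc_of% hkv, hadf]
    rw [← sub_eq_zero, ← neg_eq_zero, neg_sub]
    nth_rw 1 [← Category.id_comp (W.K.d 1 2)]
    rw [← Preadditive.sub_comp, he₀, Category.assoc, h, comp_zero]
  have hd₁ : W.δ ≫ e₁ = W.δ := by
    have h : W.δ ≫ (S.map (u 0) + (-1 : ℤ) ^ n • (v' ≫ ν)) = 0 := by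
      rw [Preadditive.comp_add, Preadditive.comp_zsmul, hδu, reassoc_of% hδv]
      simp [ν, reassoc_of% hdδY, hcδ, Preadditive.add_comp, -Functor.map_inv]
    rw [← sub_eq_zero, ← neg_eq_zero, neg_sub]
    nth_rw 1 [← Category.comp_id W.δ]
    rw [← Preadditive.comp_sub, he₁, reassoc_of% h, zero_comp]
  have hmid : S.map (W.K.d 0 1) ≫ S.map e₀ = e₁ ≫ S.map (W.K.d 0 1) := by
    have h₁ : S.map (W.K.d 0 1) ≫ S.map (v 0) = S.map (u 0) ≫ S.map a +
        (-1 : ℤ) ^ n • (v' ≫ Y.δ) := by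
      rw [← S.map_comp, hdv0, S.map_comp]
    have h₂ : S.map (W.K.d 0 1) ≫ S.map (u 1) = -(S.map (u 0) ≫ S.map (X.K.d 0 1)) := by
      rw [← S.map_comp, hdu 0 (by omega), S.map_neg, S.map_comp]
    have h₃ : l' ≫ S.map (W.K.d 0 1) =
        (-1 : ℤ) ^ n • (ν ≫ S.map (X.K.d 0 1) ≫ S.map k) := by
      have h₄ : S.map (u 1) ≫ S.map k + S.map (v 0) ≫ S.map l = 𝟙 _ := by
        rw [← S.map_comp, ← S.map_comp, ← S.map_add, hkl, S.map_id]
      rw [← Category.comp_id (S.map (W.K.d 0 1)), ← h₄, Preadditive.comp_add, Preadditive.comp_add,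
        reassoc_of% h₂, reassoc_of% h₁]
      simp only [Preadditive.add_comp, Preadditive.comp_add, Preadditive.neg_comp,
        Preadditive.comp_neg, Preadditive.zsmul_comp, Preadditive.comp_zsmul, Category.assoc,
        reassoc_of% hl'u, reassoc_of% hl'v]
      simp [ν]
    rw [Category.assoc, h₃]
    simp only [e₀, κ, μ, S.map_comp, S.map_add, Preadditive.add_comp, Preadditive.comp_add,
      reassoc_of% h₁, reassoc_of% h₂, Category.assoc]
    simp [ν]
  obtain ⟨M, hM, s, p, hs, hp, hsp, hps0, hps1, hiso⟩ :=
    hΘ.exists_splitting_ends hn hV (G.hom ≫ e₀ ≫ G.inv) (t.hom ≫ e₁ ≫ t.inv)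
      (SplitIdem.conj ⟨_, k, κ, hkκ, rfl⟩ G.symm)
      (by
        have : 𝟙 _ - G.hom ≫ e₀ ≫ G.inv = G.hom ≫ (𝟙 _ - e₀) ≫ G.inv := by
          simp [Preadditive.comp_sub, Preadditive.sub_comp]
        rw [this]
        refine SplitIdem.conj ⟨_, l - μ ≫ k, v 0, ?_, he₀.symm⟩ G.symm
        simp [Preadditive.sub_comp, hlv, hkv])
      (SplitIdem.conj ⟨_, l', v', hl'v, rfl⟩ t.symm)
      (by
        have : 𝟙 _ - t.hom ≫ e₁ ≫ t.inv = t.hom ≫ (𝟙 _ - e₁) ≫ t.inv := by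
          simp [Preadditive.comp_sub, Preadditive.sub_comp]
        rw [this]
        refine SplitIdem.conj ⟨_, I, S.map (u 0) + (-1 : ℤ) ^ n • (v' ≫ ν), ?_, he₁.symm⟩ t.symm
        simp [Preadditive.comp_add, hIu, reassoc_of% hIv])
      (by
        rw [← cancel_mono (g 1), Category.assoc, Category.assoc, Category.assoc,
          hgd 0 (by omega), ← hG, G.inv_hom_id_assoc, hd₀])
      (by
        rw [← cancel_mono t.hom, Category.assoc, Category.assoc, Category.assoc, t.inv_hom_id,
          reassoc_of% hgn, Category.comp_id, hd₁, hgn])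
      (by
        have hgδ' : V.δ ≫ S.map G.hom = (-1 : ℤ) ^ n • (t.hom ≫ S.map (W.K.d 0 1)) := hgδ
        rw [← cancel_mono (S.map G.hom)]
        simp [hgδ', reassoc_of% hgδ', hmid])
  have hs' : M.δ ≫ S.map (s.f 0) = s.f (n + 1) ≫ V.δ := hs
  have hsp' : ∀ i, s.f i ≫ p.f i = 𝟙 _ := fun i => by
    rw [← HomologicalComplex.comp_f, hsp, HomologicalComplex.id_f]
  have hse0 : s.f 0 ≫ g 0 ≫ e₀ = s.f 0 ≫ g 0 := by
    have : s.f 0 ≫ G.hom ≫ e₀ ≫ G.inv = s.f 0 := by rw [← hps0, reassoc_of% (hsp' 0)]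
    rw [← cancel_mono G.inv, Category.assoc, Category.assoc, ← hG, this, Category.assoc,
      G.hom_inv_id, Category.comp_id]
  have hse1 : s.f (n + 1) ≫ t.hom ≫ e₁ = s.f (n + 1) ≫ t.hom := by
    have : s.f (n + 1) ≫ t.hom ≫ e₁ ≫ t.inv = s.f (n + 1) := by
      rw [← hps1, reassoc_of% (hsp' (n + 1))]
    rw [← cancel_mono t.inv, Category.assoc, Category.assoc, this, Category.assoc,
      t.hom_inv_id, Category.comp_id]
  have hsv : s.f 0 ≫ g 0 ≫ v 0 = 0 := by
    rw [← reassoc_of% hse0]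
    simp [e₀, hkv]
  have hsu : s.f 0 ≫ g 0 ≫ u 1 ≫ k = s.f 0 ≫ g 0 := by
    conv_rhs => rw [← hse0]
    simp [e₀, κ, Preadditive.add_comp, reassoc_of% hsv]
  let vM : ∀ i, M.K.X i ⟶ Y.K.X i :=
    Function.update (fun i => s.f i ≫ g i ≫ v i) (n + 1) (s.f (n + 1) ≫ t.hom ≫ v')
  have vM1 : vM (n + 1) = s.f (n + 1) ≫ t.hom ≫ v' := by simp [vM]
  have vM2 : ∀ i, i ≤ n → vM i = s.f i ≫ g i ≫ v i := fun i hi => by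
    have : i ≠ n + 1 := by omega
    simp [vM, this]
  refine ⟨f, hf0, hf1, M, hM, fun i => s.f i ≫ g i ≫ u (i + 1), vM,
    ⟨?_, ?_, fun i hi₁ hin => ?_, ?_, fun i hin => ?_, fun i hin => ?_⟩, ?_⟩
  · refine ⟨k ≫ G.inv ≫ p.f 0, ?_, ?_⟩
    · rw [Category.assoc, Category.assoc, reassoc_of% hsu, ← hG, G.hom_inv_id_assoc, hsp']
    · rw [Category.assoc, Category.assoc, reassoc_of% hps0, ← hG]
      simp [e₀, κ, Preadditive.add_comp, Preadditive.comp_add, hku,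
        reassoc_of% hkv]
  · rw [vM2 0 (by omega), hsv]
  · rw [vM2 i hin]
    have := hiso i hi₁ hin
    have := hg i hin
    simpa using isIso_biprod_lift_comp (s.f i ≫ g i) (𝟙 _) (𝟙 _) (hi i hin)
  · rw [vM1]
    refine ⟨l' ≫ t.inv ≫ p.f (n + 1), ?_, ?_⟩
    · have := reassoc_of% hse1
      simp only [e₁, Category.assoc] at this
      rw [Category.assoc, Category.assoc, this, t.hom_inv_id_assoc, hsp']
    · rw [Category.assoc, Category.assoc, reassoc_of% hps1]
      simp [e₁, hl'v]
  · rw [← s.comm_assoc, reassoc_of% (hgd i hin), hdu (i + 1) (by omega)]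
    simp
  · by_cases h : i = n
    · subst h
      rw [vM1, vM2 _ le_rfl, ← s.comm_assoc, reassoc_of% hgn, hδv, hf1]
      simp
    · rw [vM2 i hin, vM2 (i + 1) (by omega), ← s.comm_assoc, reassoc_of% (hgd i (by omega)),
        hdv i (by omega)]
      simp
  · have hdu0 : W.K.d 0 1 ≫ u 1 = -(u 0 ≫ X.K.d 0 1) := hdu 0 (by omega)
    have hst : s.f (n + 1) ≫ t.hom ≫ S.map (u 0) =
        -((-1 : ℤ) ^ n • (s.f (n + 1) ≫ t.hom ≫ v' ≫ ν)) := by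
      rw [← reassoc_of% hse1]
      simp [e₁, hl'u]
    rw [vM1]
    simp only [S.map_comp]
    rw [reassoc_of% hs', reassoc_of% hgδ, Preadditive.zsmul_comp, Category.assoc, ← S.map_comp,
      hdu0, S.map_neg, S.map_comp, Preadditive.comp_neg, smul_neg, Preadditive.comp_neg,
      Preadditive.comp_zsmul, reassoc_of% hst, Preadditive.neg_comp,
      smul_neg, neg_neg, Preadditive.zsmul_comp, neg_one_pow_smul_smul]
    simp [ν]

end IsAngulation

end NExang

/-! ### The subfunctor of killed extensions, its inflations and deflations; uniqueness of
realizations. -/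

namespace NExang

variable {C : Type u} [Category.{v} C] [Preadditive C] {n : ℕ} {S : C ⥤ C}

lemma SubExt.incl_injective {E : Cᵒᵖ ⥤ C ⥤ AddCommGrpCat.{v}} (F : SubExt E) {Z A : C} :
    Function.Injective (F.incl : Ext F.functor Z A → Ext E Z A) := Subtype.val_injective

lemma SubExt.incl_mem {E : Cᵒᵖ ⥤ C ⥤ AddCommGrpCat.{v}} (F : SubExt E) {Z A : C}
    (δ : Ext F.functor Z A) : F.incl δ ∈ F.carrier Z A := Subtype.property δ

/-- The extensions `δ` with `δ ≫ S g = 0` for all maps `g` into objects of `P`. -/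
def killedExt (S : C ⥤ C) [S.Additive] (P : ObjectProperty C) : SubExt (shiftExt S) where
  carrier Z A :=
    { carrier := {δ : Z ⟶ S.obj A | ∀ H, P H → ∀ g : A ⟶ H, δ ≫ S.map g = 0}
      add_mem' := fun {δ δ'} h h' H hH g =>
        (Preadditive.add_comp _ _ _ (δ : Z ⟶ S.obj A) δ' (S.map g)).trans
          (by rw [h H hH g, h' H hH g, add_zero])
      zero_mem' := fun H hH g => zero_comp
      neg_mem' := fun {δ} h H hH g =>
        (Preadditive.neg_comp (δ : Z ⟶ S.obj A) (S.map g)).trans (by rw [h H hH g, neg_zero]) }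
  push_mem := fun {Z A A'} a (δ : Z ⟶ S.obj A)
      (h : ∀ H, P H → ∀ g : A ⟶ H, δ ≫ S.map g = 0) H hH g => by
    have : (δ ≫ S.map a) ≫ S.map g = 0 := by
      rw [Category.assoc, ← S.map_comp, h H hH (a ≫ g)]
    exact this
  pull_mem := fun {Z Z' A} c (δ : Z ⟶ S.obj A)
      (h : ∀ H, P H → ∀ g : A ⟶ H, δ ≫ S.map g = 0) H hH g => by
    have : (c ≫ δ) ≫ S.map g = 0 := by
      rw [Category.assoc, h H hH g, comp_zero]
    exact this

lemma mem_killedExt [S.Additive] {P : ObjectProperty C} {Z A : C} (δ : Z ⟶ S.obj A) :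
    δ ∈ (killedExt S P).carrier Z A ↔ ∀ H, P H → ∀ g : A ⟶ H, δ ≫ S.map g = 0 := Iff.rfl

/-- A sequence as a complex with prescribed end terms. -/
def SigmaSeq.toCpxOfIso (X : SigmaSeq n S) {A Z : C} (e₀ : X.K.X 0 ≅ A) (e₁ : X.K.X (n + 1) ≅ Z) :
    Cpx n A Z where
  toBCpx := X.toBCpx
  fst := e₀
  lst := e₁

lemma SigmaSeq.toSigmaSeq_toCpxOfIso (X : SigmaSeq n S) {A Z : C} (e₀ : X.K.X 0 ≅ A)
    (e₁ : X.K.X (n + 1) ≅ Z) (δ : Z ⟶ S.obj A) (h : X.δ ≫ S.map e₀.hom = e₁.hom ≫ δ) :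
    (X.toCpxOfIso e₀ e₁).toSigmaSeq δ = X := by
  have h' : e₁.hom ≫ δ ≫ S.map e₀.inv = X.δ := by
    rw [← Category.assoc, ← h, Category.assoc, ← S.map_comp, e₀.hom_inv_id, S.map_id,
      Category.comp_id]
  cases X
  simp only [toCpxOfIso, Cpx.toSigmaSeq, h']

lemma Cpx.isHom_iff {A Z A' Z' : C} {X : Cpx n A Z} {Y : Cpx n A' Z'} {δ : Z ⟶ S.obj A}
    {ρ : Z' ⟶ S.obj A'} {f : X.K ⟶ Y.K} {a : A ⟶ A'} {c : Z ⟶ Z'} (hf : IsLift f a c) :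
    SigmaSeq.IsHom (X := X.toSigmaSeq δ) (Y := Y.toSigmaSeq ρ) f ↔ δ ≫ S.map a = c ≫ ρ := by
  have h₀ : f.f 0 = X.fst.hom ≫ a ≫ Y.fst.inv := by
    rw [← Category.assoc, ← hf.1, Category.assoc, Y.fst.hom_inv_id, Category.comp_id]
  have h₁ : f.f (n + 1) = X.lst.hom ≫ c ≫ Y.lst.inv := by
    rw [← Category.assoc, ← hf.2, Category.assoc, Y.lst.hom_inv_id, Category.comp_id]
  change (X.lst.hom ≫ δ ≫ S.map X.fst.inv) ≫ S.map (f.f 0) =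
    f.f (n + 1) ≫ Y.lst.hom ≫ ρ ≫ S.map Y.fst.inv ↔ _
  rw [h₀, h₁]
  have h₂ : (X.lst.hom ≫ δ ≫ S.map X.fst.inv) ≫ S.map (X.fst.hom ≫ a ≫ Y.fst.inv) =
      X.lst.hom ≫ (δ ≫ S.map a) ≫ S.map Y.fst.inv := by
    simp only [Category.assoc, ← S.map_comp, X.fst.inv_hom_id_assoc]
  have h₃ : (X.lst.hom ≫ c ≫ Y.lst.inv) ≫ Y.lst.hom ≫ ρ ≫ S.map Y.fst.inv =
      X.lst.hom ≫ (c ≫ ρ) ≫ S.map Y.fst.inv := by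
    simp
  rw [h₂, h₃, cancel_epi, cancel_mono]

lemma Cpx.isLift_of_f_eq {A Z A' Z' : C} {X : Cpx n A Z} {Y : Cpx n A' Z'} {f : X.K ⟶ Y.K}
    {a : A ⟶ A'} {c : Z ⟶ Z'} (h₀ : f.f 0 = X.fst.hom ≫ a ≫ Y.fst.inv)
    (h₁ : f.f (n + 1) = X.lst.hom ≫ c ≫ Y.lst.inv) : IsLift f a c :=
  ⟨by rw [h₀]; simp, by rw [h₁]; simp⟩

lemma Cpx.toSigmaSeq_compat {A Z A' Z' : C} (X : Cpx n A Z) (Y : Cpx n A' Z') {δ : Z ⟶ S.obj A}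
    {ρ : Z' ⟶ S.obj A'} {a : A ⟶ A'} {c : Z ⟶ Z'} (h : δ ≫ S.map a = c ≫ ρ) :
    (X.toSigmaSeq δ).δ ≫ S.map (X.fst.hom ≫ a ≫ Y.fst.inv) =
      (X.lst.hom ≫ c ≫ Y.lst.inv) ≫ (Y.toSigmaSeq ρ).δ := by
  change (X.lst.hom ≫ δ ≫ S.map X.fst.inv) ≫ S.map (X.fst.hom ≫ a ≫ Y.fst.inv) =
    (X.lst.hom ≫ c ≫ Y.lst.inv) ≫ Y.lst.hom ≫ ρ ≫ S.map Y.fst.inv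
  simp only [Category.assoc, ← S.map_comp, X.fst.inv_hom_id_assoc, Y.lst.inv_hom_id_assoc]
  simp only [S.map_comp, ← reassoc_of% h]

namespace IsAngulation

variable [HasBinaryBiproducts C] [S.Additive] {Θ : Set (SigmaSeq n S)} (hΘ : IsAngulation Θ)
  [HasZeroObject C] [S.IsEquivalence]
include hΘ

lemma isLeftEpi_toSigmaSeq_iff (hn : 1 ≤ n) (P : ObjectProperty C) {A Z : C} {X : Cpx n A Z}
    {δ : Z ⟶ S.obj A} (hX : X.toSigmaSeq δ ∈ Θ) :
    IsLeftEpi P (X.K.d 0 1) ↔ δ ∈ (killedExt S P).carrier Z A := by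
  have key : (∀ H, P H → ∀ g : X.K.X 0 ⟶ H, (X.lst.hom ≫ δ ≫ S.map X.fst.inv) ≫ S.map g = 0) ↔
      ∀ H, P H → ∀ g : A ⟶ H, δ ≫ S.map g = 0 := by
    refine forall₂_congr fun H hH => ⟨fun h g => ?_, fun h g => ?_⟩
    · have h' := h (X.fst.hom ≫ g)
      rw [Category.assoc, Category.assoc, ← S.map_comp, X.fst.inv_hom_id_assoc] at h'
      rw [← cancel_epi X.lst.hom, h', comp_zero]
    · rw [Category.assoc, Category.assoc, ← S.map_comp, h, comp_zero]
  exact (hΘ.isLeftEpi_iff hn hX P).trans key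

lemma induced_leftEpiAngles_iff (hn : 1 ≤ n) (P : ObjectProperty C) {A Z : C} {X : Cpx n A Z}
    {δ : Z ⟶ S.obj A} :
    induced (leftEpiAngles Θ P) (A := A) (Z := Z) δ X ↔
      X.toSigmaSeq δ ∈ Θ ∧ δ ∈ (killedExt S P).carrier Z A := by
  refine ⟨fun h => ⟨h.1, (hΘ.isLeftEpi_toSigmaSeq_iff hn P h.1).1 h.2⟩,
    fun h => ⟨h.1, (hΘ.isLeftEpi_toSigmaSeq_iff hn P h.1).2 h.2⟩⟩

lemma exists_desc_last (hn : 1 ≤ n) {X : SigmaSeq n S} (hX : X ∈ Θ) {W : C}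
    (y : X.K.X (n + 1) ⟶ W) (hy : X.K.d n (n + 1) ≫ y = 0) :
    ∃ z : S.obj (X.K.X 0) ⟶ W, X.δ ≫ z = y := by
  obtain ⟨m, rfl⟩ : ∃ m, n = m + 1 := ⟨n - 1, by omega⟩
  obtain ⟨Y, hY, p, t, hp, hd, hdn, -⟩ := hΘ.exists_rotation hn hX
  have := hp (m + 1) le_rfl
  obtain ⟨z, hz⟩ := hΘ.exists_desc hn (i := m) (by omega) hY (p (m + 1) ≫ y) (by
    rw [reassoc_of% (hd m (by omega)), hy, comp_zero])
  refine ⟨t.inv ≫ z, ?_⟩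
  rw [← cancel_epi (p (m + 1)), ← hz, ← reassoc_of% hdn]
  simp

/-- By exactness `y` factors as `δ` followed by a map `S A ⟶ S H`. That map is `S g` for some `g`
since `S` is full, and `δ` kills `S g`. -/
lemma eq_zero_of_π_comp (hn : 1 ≤ n) {P : ObjectProperty C} {A Z : C} {X : Cpx n A Z}
    {δ : Z ⟶ S.obj A} (hX : X.toSigmaSeq δ ∈ Θ) (hδ : δ ∈ (killedExt S P).carrier Z A) {H : C}
    (hH : P H) (y : Z ⟶ S.obj H) (hy : X.π ≫ y = 0) : y = 0 := by
  obtain ⟨z, hz⟩ : ∃ z : S.obj (X.K.X 0) ⟶ S.obj H,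
      (X.lst.hom ≫ δ ≫ S.map X.fst.inv) ≫ z = X.lst.hom ≫ y :=
    hΘ.exists_desc_last hn hX (X.lst.hom ≫ y) ((Category.assoc _ _ _).symm.trans hy)
  rw [Category.assoc, cancel_epi] at hz
  rw [← hz, Category.assoc, ← S.map_preimage (S.map X.fst.inv ≫ z)]
  exact hδ H hH _

/-- Complete `g` to an angle with last map `g` and connecting map `δ`. For `k : A ⟶ H` the composite
`δ ≫ S k` vanishes after `g`, hence vanishes by hypothesis. -/
lemma exists_killed_last (hn : 1 ≤ n) {P : ObjectProperty C} {B Z : C} (g : B ⟶ Z)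
    (hg : ∀ H, P H → ∀ y : Z ⟶ S.obj H, g ≫ y = 0 → y = 0) :
    ∃ (A : C) (δ : Z ⟶ S.obj A) (X : Cpx n A Z) (e : X.K.X n ≅ B),
      X.toSigmaSeq δ ∈ Θ ∧ δ ∈ (killedExt S P).carrier Z A ∧ e.inv ≫ X.π = g := by
  obtain ⟨X, hX, e, e', h⟩ := hΘ.exists_mem_last hn g
  refine ⟨X.K.X 0, e'.inv ≫ X.δ, X.toCpxOfIso (Iso.refl _) e', e, ?_, ?_, ?_⟩
  · rwa [X.toSigmaSeq_toCpxOfIso _ _ _ (by simp)]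
  · intro H hH k
    refine hg H hH _ ?_
    rw [← cancel_epi e.hom, ← reassoc_of% h, Category.assoc, e'.hom_inv_id_assoc,
      reassoc_of% (hΘ.d_δ hn hX)]
    simp
  · change e.inv ≫ X.K.d n (n + 1) ≫ e'.hom = g
    rw [h, e.inv_hom_id_assoc]

lemma isDeflation_restrict_iff (hn : 1 ≤ n) (P : ObjectProperty C) {B Z : C} (g : B ⟶ Z) :
    IsDeflation ((killedExt S P).restrict (induced Θ)) g ↔
      ∀ H, P H → ∀ y : Z ⟶ S.obj H, g ≫ y = 0 → y = 0 := by
  constructor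
  · rintro ⟨A, δ, X, e, hX, rfl⟩ H hH y hy
    refine hΘ.eq_zero_of_π_comp hn hX ((killedExt S P).incl_mem δ) hH y ?_
    rw [← cancel_epi e.inv, comp_zero, ← hy, Category.assoc]
  · intro hg
    obtain ⟨A, δ, X, e, hX, hδ, h⟩ := hΘ.exists_killed_last hn g hg
    exact ⟨A, (⟨δ, hδ⟩ : (killedExt S P).carrier Z A), X, e, hX, h⟩

lemma isDeflation_leftEpiAngles_iff (hn : 1 ≤ n) (P : ObjectProperty C) {B Z : C} (g : B ⟶ Z) :
    IsDeflation (induced (leftEpiAngles Θ P)) g ↔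
      ∀ H, P H → ∀ y : Z ⟶ S.obj H, g ≫ y = 0 → y = 0 := by
  constructor
  · rintro ⟨A, δ, X, e, hX, rfl⟩ H hH y hy
    obtain ⟨h₁, h₂⟩ := (hΘ.induced_leftEpiAngles_iff hn P).1 hX
    refine hΘ.eq_zero_of_π_comp hn h₁ h₂ hH y ?_
    rw [← cancel_epi e.inv, comp_zero, ← hy, Category.assoc]
  · intro hg
    obtain ⟨A, δ, X, e, hX, hδ, h⟩ := hΘ.exists_killed_last hn g hg
    exact ⟨A, δ, X, e, (hΘ.induced_leftEpiAngles_iff hn P).2 ⟨hX, hδ⟩, h⟩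

/-- Every map starts an angle by (F1), so the only condition left is that its connecting map be
killed, which is the left `P`-epimorphism property. -/
lemma isInflation_restrict_iff (hn : 1 ≤ n) (P : ObjectProperty C) {A B : C} (f : A ⟶ B) :
    IsInflation ((killedExt S P).restrict (induced Θ)) f ↔ IsLeftEpi P f := by
  constructor
  · rintro ⟨Z, δ, X, e, hX, rfl⟩ H hH g
    obtain ⟨y, hy⟩ := (hΘ.isLeftEpi_toSigmaSeq_iff hn P hX).2 ((killedExt S P).incl_mem δ) H hH
      (X.fst.hom ≫ g)
    refine ⟨e.inv ≫ y, ?_⟩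
    have hy' : X.K.d 0 1 ≫ y = X.fst.hom ≫ g := hy
    simp [Cpx.ι, hy']
  · intro hf
    obtain ⟨X, hX, e₀, e₁, h⟩ := hΘ.exists_mem f
    have hX' : (X.toCpxOfIso e₀ (Iso.refl _)).toSigmaSeq (X.δ ≫ S.map e₀.hom) ∈ Θ := by
      rwa [X.toSigmaSeq_toCpxOfIso _ _ _ (by simp)]
    have hδ : X.δ ≫ S.map e₀.hom ∈ (killedExt S P).carrier (X.K.X (n + 1)) A := by
      refine (hΘ.isLeftEpi_toSigmaSeq_iff hn P hX').1 fun H hH (g : X.K.X 0 ⟶ H) => ?_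
      obtain ⟨y, hy⟩ := hf H hH (e₀.inv ≫ g)
      refine ⟨e₁.hom ≫ y, ?_⟩
      have hy' : f ≫ y = e₀.inv ≫ g := hy
      have h' : X.K.d 0 1 ≫ e₁.hom = e₀.hom ≫ f := by rw [← h, e₀.hom_inv_id_assoc]
      change X.K.d 0 1 ≫ e₁.hom ≫ y = g
      rw [reassoc_of% h', hy', e₀.hom_inv_id_assoc]
    exact ⟨_, (⟨_, hδ⟩ : (killedExt S P).carrier _ A), X.toCpxOfIso e₀ (Iso.refl _), e₁, hX',
      (Category.assoc _ _ _).trans h⟩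

lemma exists_isLift (hn : 1 ≤ n) {A Z A' Z' : C} {δ : Z ⟶ S.obj A} {ρ : Z' ⟶ S.obj A'}
    {X : Cpx n A Z} {Y : Cpx n A' Z'} (hX : X.toSigmaSeq δ ∈ Θ) (hY : Y.toSigmaSeq ρ ∈ Θ)
    {a : A ⟶ A'} {c : Z ⟶ Z'} (h : δ ≫ S.map a = c ≫ ρ) : ∃ f : X.K ⟶ Y.K, Cpx.IsLift f a c := by
  obtain ⟨f, h₀, h₁, -⟩ := hΘ.exists_hom_ends hn hX hY _ _ (X.toSigmaSeq_compat Y h)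
  exact ⟨f, Cpx.isLift_of_f_eq h₀ h₁⟩

lemma mem_of_hEquiv (hn : 1 ≤ n) {A Z : C} {δ : Z ⟶ S.obj A} {X Y : Cpx n A Z}
    (hX : X.toSigmaSeq δ ∈ Θ) (h : X.HEquiv Y) : Y.toSigmaSeq δ ∈ Θ := by
  obtain ⟨f, g, hf, hg, -, ⟨H⟩⟩ := h
  have hf' := (Cpx.isHom_iff (δ := δ) (ρ := δ) hf).2 (by simp)
  have hg' := (Cpx.isHom_iff (δ := δ) (ρ := δ) hg).2 (by simp)
  have hf1 : f.f (n + 1) = X.lst.hom ≫ Y.lst.inv := by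
    rw [← Category.comp_id X.lst.hom, ← hf.2, Category.assoc, Y.lst.hom_inv_id, Category.comp_id]
  have hg1 : g.f (n + 1) = Y.lst.hom ≫ X.lst.inv := by
    rw [← Category.comp_id Y.lst.hom, ← hg.2, Category.assoc, X.lst.hom_inv_id, Category.comp_id]
  have hf0 : f.f 0 = X.fst.hom ≫ Y.fst.inv := by
    rw [← Category.comp_id X.fst.hom, ← hf.1, Category.assoc, Y.fst.hom_inv_id, Category.comp_id]
  have hg0 : g.f 0 = Y.fst.hom ≫ X.fst.inv := by
    rw [← Category.comp_id Y.fst.hom, ← hg.1, Category.assoc, X.fst.hom_inv_id, Category.comp_id]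
  have hiso : IsIso (f.f (n + 1)) := by
    rw [hf1]
    infer_instance
  have h0 : g.f 0 ≫ f.f 0 = 𝟙 _ := by
    rw [hf0, hg0]
    simp
  have h1 : g.f (n + 1) ≫ f.f (n + 1) = 𝟙 _ := by
    rw [hf1, hg1]
    simp
  exact mem_of_homotopy hΘ hn hX (Y := Y.toSigmaSeq δ) f g hf' hg' hiso h0 h1 H.symm

/-- Lifts `f`, `g` of the identities need not be homotopy inverse. However `f ≫ g - 𝟙` vanishes at
both ends, so its square is null-homotopic; replacing `g` by `2g - g ≫ f ≫ g` makes the error equal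
to minus this square, on either side. -/
lemma hEquiv_of_mem (hn : 1 ≤ n) {A Z : C} {δ : Z ⟶ S.obj A} {X Y : Cpx n A Z}
    (hX : X.toSigmaSeq δ ∈ Θ) (hY : Y.toSigmaSeq δ ∈ Θ) : X.HEquiv Y := by
  obtain ⟨f, hf⟩ := hΘ.exists_isLift hn hX hY (a := 𝟙 A) (c := 𝟙 Z) (by simp)
  obtain ⟨g, hg⟩ := hΘ.exists_isLift hn hY hX (a := 𝟙 A) (c := 𝟙 Z) (by simp)
  have hf0 : f.f 0 ≫ Y.fst.hom = X.fst.hom := by simpa using hf.1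
  have hf1 : f.f (n + 1) ≫ Y.lst.hom = X.lst.hom := by simpa using hf.2
  have hg0 : g.f 0 ≫ X.fst.hom = Y.fst.hom := by simpa using hg.1
  have hg1 : g.f (n + 1) ≫ X.lst.hom = Y.lst.hom := by simpa using hg.2
  have hfg0 : f.f 0 ≫ g.f 0 = 𝟙 _ := by
    rw [← cancel_mono X.fst.hom, Category.assoc, hg0, hf0, Category.id_comp]
  have hfg1 : f.f (n + 1) ≫ g.f (n + 1) = 𝟙 _ := by
    rw [← cancel_mono X.lst.hom, Category.assoc, hg1, hf1, Category.id_comp]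
  have hgf0 : g.f 0 ≫ f.f 0 = 𝟙 _ := by
    rw [← cancel_mono Y.fst.hom, Category.assoc, hf0, hg0, Category.id_comp]
  have hgf1 : g.f (n + 1) ≫ f.f (n + 1) = 𝟙 _ := by
    rw [← cancel_mono Y.lst.hom, Category.assoc, hf1, hg1, Category.id_comp]
  have h₁ : (f ≫ g - 𝟙 X.K).f 0 = 0 := by simp [hfg0]
  have h₂ : (𝟙 X.K - f ≫ g).f (n + 1) = 0 := by simp [hfg1]
  have h₃ : (g ≫ f - 𝟙 Y.K).f 0 = 0 := by simp [hgf0]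
  have h₄ : (𝟙 Y.K - g ≫ f).f (n + 1) = 0 := by simp [hgf1]
  obtain ⟨H⟩ := hΘ.exists_homotopyZero hn hX (f ≫ g - 𝟙 X.K) (𝟙 X.K - f ≫ g) h₁ h₂
  obtain ⟨H'⟩ := hΘ.exists_homotopyZero hn hY (g ≫ f - 𝟙 Y.K) (𝟙 Y.K - g ≫ f) h₃ h₄
  have e₁ : f ≫ (g + g - g ≫ f ≫ g) - 𝟙 X.K = (f ≫ g - 𝟙 X.K) ≫ (𝟙 X.K - f ≫ g) := by
    simp only [Preadditive.sub_comp, Preadditive.comp_sub, Preadditive.comp_add,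
      Category.assoc, Category.comp_id, Category.id_comp]
    abel
  have e₂ : (g + g - g ≫ f ≫ g) ≫ f - 𝟙 Y.K = (g ≫ f - 𝟙 Y.K) ≫ (𝟙 Y.K - g ≫ f) := by
    simp only [Preadditive.sub_comp, Preadditive.comp_sub, Preadditive.add_comp,
      Category.assoc, Category.comp_id, Category.id_comp]
    abel
  refine ⟨f, g + g - g ≫ f ≫ g, hf, ⟨?_, ?_⟩,
    ⟨Homotopy.equivSubZero.symm ((Homotopy.ofEq e₁).trans H)⟩,
    ⟨Homotopy.equivSubZero.symm ((Homotopy.ofEq e₂).trans H')⟩⟩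
  · simp [Preadditive.sub_comp, Preadditive.add_comp, hf0, hg0]
  · simp [Preadditive.sub_comp, Preadditive.add_comp, hf1, hg1]

end IsAngulation

end NExang

/-! ### Split realizations and exactness of the exangles. -/

namespace NExang

variable {C : Type u} [Category.{v} C] [Preadditive C] {n : ℕ} {S : C ⥤ C}

open SigmaSeq

namespace IsAngulation

variable [HasBinaryBiproducts C] [S.Additive] {Θ : Set (SigmaSeq n S)} (hΘ : IsAngulation Θ)
  [HasZeroObject C] [S.IsEquivalence]
include hΘ

lemma mem_of_isIso_first (hn : 1 ≤ n) {A Z : C} (X : Cpx n A Z) (h : IsIso (X.K.d 0 1))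
    (hz : ∀ i, 2 ≤ i → IsZero (X.K.X i)) : X.toSigmaSeq (0 : Z ⟶ S.obj A) ∈ Θ :=
  hΘ.mem_of_isDisk hn (i := 0) (by omega)
    ⟨h, fun j _ _ => hz j (by omega), (congrArg (X.lst.hom ≫ ·) zero_comp).trans comp_zero⟩

lemma mem_of_isIso_last (hn : 1 ≤ n) {A Z : C} (X : Cpx n A Z) (h : IsIso (X.K.d n (n + 1)))
    (hz : ∀ i, i < n → IsZero (X.K.X i)) : X.toSigmaSeq (0 : Z ⟶ S.obj A) ∈ Θ :=
  hΘ.mem_of_isDisk hn (i := n) le_rfl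
    ⟨h, fun j hj hj' => by
      by_cases hjn : j < n
      · exact hz j hjn
      · exact X.isZero j (by omega), (congrArg (X.lst.hom ≫ ·) zero_comp).trans comp_zero⟩

lemma isExangle_restrict (hn : 1 ≤ n) {F : SubExt (shiftExt S)} {A Z : C}
    (δ : Ext F.functor Z A) (X : Cpx n A Z) (hX : X.toSigmaSeq (F.incl δ) ∈ Θ) :
    IsExangle F.functor δ X := by
  -- A copy of the extension typed as a morphism of `C`, so that it can be composed and rewritten.
  obtain ⟨δ', hδ'⟩ : ∃ δ' : Z ⟶ S.obj A, δ' = F.incl δ := ⟨_, rfl⟩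
  rw [← hδ'] at hX
  have hzero₁ : ∀ (W : C) (x : W ⟶ Z), pull F.functor x δ = 0 ↔ x ≫ δ' = 0 := fun W x => by
    rw [← F.incl_injective.eq_iff, hδ']
    exact Iff.rfl
  have hzero₂ : ∀ (W : C) (x : A ⟶ W), push F.functor x δ = 0 ↔ δ' ≫ S.map x = 0 := fun W x => by
    rw [← F.incl_injective.eq_iff, hδ']
    exact Iff.rfl
  have hdδ : X.K.d n (n + 1) ≫ X.lst.hom ≫ δ' ≫ S.map X.fst.inv = 0 := hΘ.d_δ hn hX
  have hδd : (X.lst.hom ≫ δ' ≫ S.map X.fst.inv) ≫ S.map (X.K.d 0 1) = 0 := hΘ.δ_map_d hn hX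
  refine ⟨fun W i hi x hx => hΘ.exists_lift hn hi hX x hx, fun W x => ?_,
    fun W i hi x hx => hΘ.exists_desc hn hi hX x hx, fun W x => ?_⟩
  · rw [hzero₁]
    constructor
    · intro hx
      have hx' : (x ≫ X.lst.inv) ≫ X.lst.hom ≫ δ' ≫ S.map X.fst.inv = 0 := by
        rw [Category.assoc, X.lst.inv_hom_id_assoc, reassoc_of% hx, zero_comp]
      obtain ⟨y, hy⟩ : ∃ y : W ⟶ X.K.X n, y ≫ X.K.d n (n + 1) = x ≫ X.lst.inv :=
        hΘ.exists_lift_last hn hX (x ≫ X.lst.inv) hx'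
      refine ⟨y, ?_⟩
      simp [Cpx.π, reassoc_of% hy]
    · rintro ⟨y, rfl⟩
      rw [← cancel_mono (S.map X.fst.inv), zero_comp]
      simp [Cpx.π, hdδ]
  · rw [hzero₂]
    constructor
    · intro hx
      have hx' : (X.lst.hom ≫ δ' ≫ S.map X.fst.inv) ≫ S.map (X.fst.hom ≫ x) = 0 := by
        rw [Category.assoc, Category.assoc, ← S.map_comp, X.fst.inv_hom_id_assoc, hx, comp_zero]
      obtain ⟨y, hy⟩ : ∃ y : X.K.X 1 ⟶ W, X.K.d 0 1 ≫ y = X.fst.hom ≫ x :=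
        hΘ.exists_desc_first hn hX (X.fst.hom ≫ x) hx'
      refine ⟨y, ?_⟩
      simp [Cpx.ι, hy]
    · rintro ⟨y, rfl⟩
      have hδd' : δ' ≫ S.map X.fst.inv ≫ S.map (X.K.d 0 1) = 0 := by
        rw [← cancel_epi X.lst.hom, comp_zero, ← hδd]
        simp
      simp [Cpx.ι, reassoc_of% hδd']

end IsAngulation

end NExang

/-! ### The `n`-exangulated structure, properness of `ξ`, and the comparison results. -/

namespace NExang

variable {C : Type u} [Category.{v} C] [Preadditive C] {n : ℕ} {S : C ⥤ C}

open SigmaSeq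

namespace IsAngulation

variable [HasBinaryBiproducts C] [S.Additive] {Θ : Set (SigmaSeq n S)} (hΘ : IsAngulation Θ)
  [HasZeroObject C] [S.IsEquivalence]
include hΘ

/-- Only the composition axioms involve `P`. The good lifts of `Θ` serve unchanged, because the
extensions realized by their cones are pushes and pulls of members of the subfunctor. -/
lemma isNExangulated_restrict (hn : 1 ≤ n) (P : ObjectProperty C) :
    IsNExangulated n (killedExt S P).functor ((killedExt S P).restrict (induced Θ)) where
  push_add := fun {Z A A'} a b δ => (killedExt S P).incl_injective (by
    obtain ⟨δ', hδ'⟩ : ∃ δ' : Z ⟶ S.obj A, δ' = (killedExt S P).incl δ := ⟨_, rfl⟩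
    have : δ' ≫ S.map (a + b) = δ' ≫ S.map a + δ' ≫ S.map b := by
      rw [S.map_add, Preadditive.comp_add]
    rw [hδ'] at this
    exact this)
  pull_add := fun {Z Z' A} c d δ => (killedExt S P).incl_injective
    (Preadditive.add_comp _ _ _ c d ((killedExt S P).incl δ : Z ⟶ S.obj A))
  htpyClass := fun {A Z} δ => by
    obtain ⟨X, hX⟩ := hΘ.exists_cpx hn ((killedExt S P).incl δ : Z ⟶ S.obj A)
    exact ⟨X, fun Y => ⟨fun hY => hΘ.hEquiv_of_mem hn hX hY, fun h => hΘ.mem_of_hEquiv hn hX h⟩⟩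
  lift := fun δ ρ X Y hX hY a c h => hΘ.exists_isLift hn hX hY
    (congrArg (killedExt S P).incl h)
  exangle := fun δ X hX => hΘ.isExangle_restrict hn δ X hX
  zero_right := fun X h hz => hΘ.mem_of_isIso_first hn X h hz
  zero_left := fun X h hz => hΘ.mem_of_isIso_last hn X h hz
  inflation_comp := fun f g hf hg => by
    rw [hΘ.isInflation_restrict_iff hn] at hf hg ⊢
    intro H hH x
    obtain ⟨y, hy⟩ := hf H hH x
    obtain ⟨z, hz⟩ := hg H hH y
    have hy' : f ≫ y = x := hy
    have hz' : g ≫ z = y := hz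
    refine ⟨z, ?_⟩
    change (f ≫ g) ≫ z = x
    rw [Category.assoc, hz', hy']
  deflation_comp := fun f g hf hg => by
    rw [hΘ.isDeflation_restrict_iff hn] at hf hg ⊢
    intro H hH y hy
    exact hg H hH y (hf H hH _ (by rw [← Category.assoc, hy]))
  good_lift := fun {A Z D} ρ c X Y hX hY => by
    obtain ⟨ρ', hρ'⟩ : ∃ ρ' : D ⟶ S.obj A, ρ' = (killedExt S P).incl ρ := ⟨_, rfl⟩
    have hX' : X.toSigmaSeq (c ≫ ρ') ∈ Θ := by
      rw [hρ']
      exact hX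
    have hY' : Y.toSigmaSeq ρ' ∈ Θ := by
      rw [hρ']
      exact hY
    have hiso : IsIso (X.fst.hom ≫ 𝟙 A ≫ Y.fst.inv) := by
      rw [Category.id_comp]
      infer_instance
    obtain ⟨f, h₀, h₁, M, hM, u, v, hMC, hδ⟩ : ∃ f : X.K ⟶ Y.K,
        f.f 0 = X.fst.hom ≫ 𝟙 A ≫ Y.fst.inv ∧ f.f (n + 1) = X.lst.hom ≫ c ≫ Y.lst.inv ∧ ∃ M ∈ Θ,
        ∃ (u : ∀ i, M.K.X i ⟶ X.K.X (i + 1)) (v : ∀ i, M.K.X i ⟶ Y.K.X i),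
          IsMappingCone n f M.K u v ∧
          M.δ ≫ S.map (u 0) = v (n + 1) ≫ (Y.lst.hom ≫ ρ' ≫ S.map Y.fst.inv) ≫
            S.map (inv (X.fst.hom ≫ 𝟙 A ≫ Y.fst.inv) ≫ X.K.d 0 1) :=
      hΘ.exists_good_lift hn hX' hY' _ _ hiso
        (X.toSigmaSeq_compat Y (a := 𝟙 A) (c := c) (by simp))
    refine ⟨f, Cpx.isLift_of_f_eq h₀ h₁,
      M.toCpxOfIso (@asIso _ _ _ _ (u 0) hMC.iso_zero)
        (@asIso _ _ _ _ (v (n + 1)) hMC.iso_last ≪≫ Y.lst),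
      u, v, hMC, rfl, rfl, ?_⟩
    have hinv : inv (X.fst.hom ≫ 𝟙 A ≫ Y.fst.inv) = Y.fst.hom ≫ X.fst.inv :=
      IsIso.inv_eq_of_hom_inv_id (by simp)
    have hρM : ρ' ≫ S.map X.ι = (killedExt S P).incl (push (killedExt S P).functor X.ι ρ) := by
      rw [hρ']
      rfl
    change (M.toCpxOfIso _ _).toSigmaSeq (S := S)
      ((killedExt S P).incl (push (killedExt S P).functor X.ι ρ)) ∈ Θ
    rw [← hρM, M.toSigmaSeq_toCpxOfIso]
    · exact hM
    · change M.δ ≫ S.map (u 0) = (v (n + 1) ≫ Y.lst.hom) ≫ ρ' ≫ S.map X.ι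
      rw [hδ, hinv]
      simp [Cpx.ι]
  good_colift := fun {A A' Z} ρ a X Y hX hY => by
    obtain ⟨ρ', hρ'⟩ : ∃ ρ' : Z ⟶ S.obj A, ρ' = (killedExt S P).incl ρ := ⟨_, rfl⟩
    have hX' : X.toSigmaSeq ρ' ∈ Θ := by
      rw [hρ']
      exact hX
    have hY' : Y.toSigmaSeq (ρ' ≫ S.map a) ∈ Θ := by
      rw [hρ']
      exact hY
    have hiso : IsIso (X.lst.hom ≫ 𝟙 Z ≫ Y.lst.inv) := by
      rw [Category.id_comp]
      infer_instance
    obtain ⟨f, h₀, h₁, N, hN, u, v, hNC, hδ⟩ : ∃ f : X.K ⟶ Y.K,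
        f.f 0 = X.fst.hom ≫ a ≫ Y.fst.inv ∧ f.f (n + 1) = X.lst.hom ≫ 𝟙 Z ≫ Y.lst.inv ∧ ∃ N ∈ Θ,
        ∃ (u : ∀ i, N.K.X i ⟶ X.K.X i) (v : ∀ i, N.K.X (i + 1) ⟶ Y.K.X i),
          IsMappingCocone n f N.K u v ∧
          N.δ ≫ S.map (u 0) = v n ≫ Y.K.d n (n + 1) ≫
            inv (X.lst.hom ≫ 𝟙 Z ≫ Y.lst.inv) ≫ X.lst.hom ≫ ρ' ≫ S.map X.fst.inv :=
      hΘ.exists_good_colift hn hX' hY' _ _ hiso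
        (X.toSigmaSeq_compat Y (a := a) (c := 𝟙 Z) (by simp))
    refine ⟨f, Cpx.isLift_of_f_eq h₀ h₁,
      N.toCpxOfIso (@asIso _ _ _ _ (u 0) hNC.iso_zero ≪≫ X.fst)
        (@asIso _ _ _ _ (v n) hNC.iso_last),
      u, v, hNC, rfl, rfl, ?_⟩
    have hinv : inv (X.lst.hom ≫ 𝟙 Z ≫ Y.lst.inv) = Y.lst.hom ≫ X.lst.inv :=
      IsIso.inv_eq_of_hom_inv_id (by simp)
    have hρN : Y.π ≫ ρ' = (killedExt S P).incl (pull (killedExt S P).functor Y.π ρ) := by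
      rw [hρ']
      rfl
    change (N.toCpxOfIso _ _).toSigmaSeq (S := S)
      ((killedExt S P).incl (pull (killedExt S P).functor Y.π ρ)) ∈ Θ
    rw [← hρN, N.toSigmaSeq_toCpxOfIso]
    · exact hN
    · change N.δ ≫ S.map (u 0 ≫ X.fst.hom) = v n ≫ (Y.K.d n (n + 1) ≫ Y.lst.hom) ≫ ρ'
      rw [hinv] at hδ
      rw [S.map_comp, reassoc_of% hδ]
      simp [← S.map_comp]

lemma isProperClass (hn : 1 ≤ n) (P : ObjectProperty C) :
    IsProperClass (shiftExt S) (induced Θ) (induced (leftEpiAngles Θ P)) where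
  distinguished := fun δ X h => h.1
  split := fun {A Z} X h => (hΘ.induced_leftEpiAngles_iff hn P).2
    ⟨h, ((killedExt S P).carrier Z A).zero_mem⟩
  weakIso := fun {A Z A' Z'} (δ : Z ⟶ S.obj A) X (ρ : Z' ⟶ S.obj A') Y f a c hX hY _
      (h : δ ≫ S.map a = c ≫ ρ) ha hc => by
    refine (hΘ.induced_leftEpiAngles_iff hn P).trans (Iff.trans ?_
      (hΘ.induced_leftEpiAngles_iff hn P).symm)
    have hX' : X.toSigmaSeq δ ∈ Θ := hX
    have hY' : Y.toSigmaSeq ρ ∈ Θ := hY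
    simp only [hX', hY', true_and, mem_killedExt]
    refine forall₂_congr fun H hH => ⟨fun hδ g => ?_, fun hρ g => ?_⟩
    · rw [← cancel_epi c, ← reassoc_of% h, ← S.map_comp, hδ, comp_zero]
    · rw [← IsIso.hom_inv_id_assoc a g, S.map_comp, reassoc_of% h, hρ, comp_zero]
  coprod := fun {A Z A' Z' A'' Z''} (δ : Z ⟶ S.obj A) X (ρ : Z' ⟶ S.obj A') Y
      (ω : Z'' ⟶ S.obj A'') W hX hY hW => by
    obtain ⟨i₁, p₁, i₂, p₂, h₁, h₂, h, ⟨a₁, c₁, ha₁, hc₁⟩, ⟨a₂, c₂, ha₂, hc₂⟩, ⟨a₃, c₃, ha₃, hc₃⟩,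
      ⟨a₄, c₄, ha₄, hc₄⟩⟩ := hW
    refine ⟨hΘ.sum_mem (X.toSigmaSeq δ) (Y.toSigmaSeq ρ) (W.toSigmaSeq ω)
      ⟨i₁, p₁, i₂, p₂, h₁, h₂, h, (Cpx.isHom_iff ha₁).2 hc₁, (Cpx.isHom_iff ha₂).2 hc₂,
        (Cpx.isHom_iff ha₃).2 hc₃, (Cpx.isHom_iff ha₄).2 hc₄⟩ hX.1 hY.1,
      fun H hH (g : W.K.X 0 ⟶ H) => ?_⟩
    obtain ⟨y, hy⟩ : ∃ y : X.K.X 1 ⟶ H, X.K.d 0 1 ≫ y = i₁.f 0 ≫ g := hX.2 H hH (i₁.f 0 ≫ g)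
    obtain ⟨z, hz⟩ : ∃ z : Y.K.X 1 ⟶ H, Y.K.d 0 1 ≫ z = i₂.f 0 ≫ g := hY.2 H hH (i₂.f 0 ≫ g)
    have h' : p₁.f 0 ≫ i₁.f 0 + p₂.f 0 ≫ i₂.f 0 = 𝟙 _ := by
      rw [← HomologicalComplex.comp_f, ← HomologicalComplex.comp_f,
        ← HomologicalComplex.add_f_apply, h, HomologicalComplex.id_f]
    refine ⟨p₁.f 1 ≫ y + p₂.f 1 ≫ z, ?_⟩
    have : W.K.d 0 1 ≫ (p₁.f 1 ≫ y + p₂.f 1 ≫ z) = g := by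
      rw [Preadditive.comp_add, ← p₁.comm_assoc, ← p₂.comm_assoc, hy, hz, ← Category.assoc,
        ← Category.assoc, ← Preadditive.add_comp, h', Category.id_comp]
    exact this
  baseChange := fun {A Z Z'} δ X c Y hX hY => (hΘ.induced_leftEpiAngles_iff hn P).2
    ⟨hY, (killedExt S P).pull_mem c δ ((hΘ.induced_leftEpiAngles_iff hn P).1 hX).2⟩
  cobaseChange := fun {A A' Z} δ X a Y hX hY => (hΘ.induced_leftEpiAngles_iff hn P).2
    ⟨hY, (killedExt S P).push_mem a δ ((hΘ.induced_leftEpiAngles_iff hn P).1 hX).2⟩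
  -- If `d ≫ y = 0` then `a ≫ b ≫ y = 0`, and injectivity for `a` and then for `b` gives `y = 0`.
  saturated := fun a b c d h _ ha hb => by
    rw [hΘ.isDeflation_leftEpiAngles_iff hn] at ha hb ⊢
    intro H hH y hy
    refine hb H hH y (ha H hH _ ?_)
    rw [← Category.assoc, h, Category.assoc, hy, comp_zero]

lemma carrier_killedExt (hn : 1 ≤ n) (P : ObjectProperty C) (Z A : C) :
    ((killedExt S P).carrier Z A : Set (Ext (shiftExt S) Z A)) =
      extOf (induced (leftEpiAngles Θ P)) Z A := by
  ext δ
  constructor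
  · intro hδ
    obtain ⟨X, hX⟩ := hΘ.exists_cpx hn (δ : Z ⟶ S.obj A)
    exact ⟨X, (hΘ.induced_leftEpiAngles_iff hn P).2 ⟨hX, hδ⟩⟩
  · rintro ⟨X, hX⟩
    exact ((hΘ.induced_leftEpiAngles_iff hn P).1 hX).2

/-- The `n`-kernel condition makes `d⁰` a monomorphism, whereas `δ ≫ S d⁰ = 0`; desuspending gives
`δ = 0`. Conversely, a zero connecting map is killed by everything. -/
lemma leftEpiAngles_eq_of_isNExactExt (hn : 1 ≤ n) (P : ObjectProperty C)
    (h : IsNExactExt (killedExt S P).functor ((killedExt S P).restrict (induced Θ))) :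
    leftEpiAngles Θ P = {X | X ∈ Θ ∧ X.δ = 0} := by
  obtain ⟨𝒳, h𝒳, hmem⟩ := h
  ext X
  constructor
  · rintro ⟨hX, hepi⟩
    refine ⟨hX, ?_⟩
    have hX' : X.toBCpx.toCpx.toSigmaSeq X.δ = X :=
      X.toSigmaSeq_toCpxOfIso (Iso.refl _) (Iso.refl _) X.δ (by simp)
    have hδ : X.δ ∈ (killedExt S P).carrier _ _ := (hΘ.isLeftEpi_iff hn hX P).1 hepi
    have hX𝒳 : X.toBCpx ∈ 𝒳 := (hmem X.toBCpx).1
      ⟨(⟨X.δ, hδ⟩ : (killedExt S P).carrier _ _), by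
        change X.toBCpx.toCpx.toSigmaSeq X.δ ∈ Θ
        rwa [hX']⟩
    have hker := ((h𝒳.nExact _ hX𝒳).1 (S.objPreimage (X.K.X (n + 1)))).1
      (S.preimage ((S.objObjPreimageIso _).hom ≫ X.δ)) (S.map_injective (by
        rw [S.map_comp, S.map_preimage, Category.assoc, hΘ.δ_map_d hn hX, comp_zero, S.map_zero]))
    have h₁ := congrArg S.map hker
    rw [S.map_preimage, S.map_zero] at h₁
    rw [← cancel_epi (S.objObjPreimageIso (X.K.X (n + 1))).hom, h₁, comp_zero]
  · rintro ⟨hX, h0⟩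
    exact ⟨hX, (hΘ.isLeftEpi_iff hn hX P).2 fun H _ g => by rw [h0, zero_comp]⟩

/-- An angle of `Φ` starting with `H ⟶ 0` is carried by the inverse of `η` to a member of the
restricted realization. Its first map is therefore a left `P`-epimorphism, so the identity of `H`
factors through a zero object. -/
lemma isZero_of_isAngulatedExt (hn : 1 ≤ n) (P : ObjectProperty C)
    (h : IsAngulatedExt (killedExt S P).functor ((killedExt S P).restrict (induced Θ))) {H : C}
    (hH : P H) : IsZero H := by
  obtain ⟨T, Φ, η, -, -, hΦ, hη⟩ := h
  obtain ⟨X, hX, e₀, e₁, -⟩ := hΦ.exists_mem (0 : H ⟶ 0)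
  let Y : Cpx n H (X.K.X (n + 1)) := X.toCpxOfIso e₀ (Iso.refl _)
  have hY : Y.toSigmaSeq (X.δ ≫ T.map e₀.hom) = X :=
    X.toSigmaSeq_toCpxOfIso _ _ _ (by simp)
  let δ : Ext (killedExt S P).functor (X.K.X (n + 1)) H :=
    (η.inv.app (op (X.K.X (n + 1)))).app H (X.δ ≫ T.map e₀.hom)
  have hδ : (η.hom.app (op (X.K.X (n + 1)))).app H δ = X.δ ≫ T.map e₀.hom := by
    have := congrArg (fun k => (k.app (op (X.K.X (n + 1)))).app H) η.inv_hom_id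
    exact DFunLike.congr_fun (congrArg AddCommGrpCat.Hom.hom this) (X.δ ≫ T.map e₀.hom)
  have hs := (hη H (X.K.X (n + 1)) δ Y).2 (by
    rw [hδ]
    change Y.toSigmaSeq (X.δ ≫ T.map e₀.hom) ∈ Φ
    rwa [hY])
  obtain ⟨y, hy⟩ : ∃ y : X.K.X 1 ⟶ H, X.K.d 0 1 ≫ y = e₀.hom :=
    (hΘ.isLeftEpi_toSigmaSeq_iff hn P hs).2 ((killedExt S P).incl_mem δ) H hH e₀.hom
  have hX1 : IsZero (X.K.X 1) := (isZero_zero C).of_iso e₁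
  rw [IsZero.iff_id_eq_zero, ← e₀.inv_hom_id, ← hy, hX1.eq_of_src y 0, comp_zero, comp_zero]

lemma eq_leftEpiAngles_of_isAngulatedExt (hn : 1 ≤ n) (P : ObjectProperty C)
    (h : IsAngulatedExt (killedExt S P).functor ((killedExt S P).restrict (induced Θ))) :
    Θ = leftEpiAngles Θ P := by
  refine Set.Subset.antisymm (fun X hX => ⟨hX, fun H hH g => ⟨0, ?_⟩⟩) fun X hX => hX.1
  exact (hΘ.isZero_of_isAngulatedExt hn P h hH).eq_of_tgt _ _

/-- The approximating angle of an object `B` outside `P` would have zero connecting map. Its first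
map would then split, making `B` a retract of `H¹`, which lies in `P` because `n ≥ 1`. -/
lemma not_isNExactExt (hn : 1 ≤ n) (P : ObjectProperty C) (hP : StronglyCovariantlyFinite Θ P)
    (hret : P.IsStableUnderRetracts) (hB : ∃ B : C, ¬ P B) :
    ¬ IsNExactExt (killedExt S P).functor ((killedExt S P).restrict (induced Θ)) := by
  intro h
  obtain ⟨B, hB⟩ := hB
  obtain ⟨X, hX, ⟨e⟩, hXP, hepi⟩ := hP B
  have hX' : X ∈ leftEpiAngles Θ P := ⟨hX, hepi⟩
  rw [hΘ.leftEpiAngles_eq_of_isNExactExt hn P h] at hX'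
  obtain ⟨y, hy⟩ := hΘ.exists_desc_first hn hX (𝟙 _) (by rw [hX'.2, zero_comp])
  exact hB (P.prop_of_retract
    { i := e.inv ≫ X.K.d 0 1
      r := y ≫ e.hom
      retract := by simp [reassoc_of% hy] } (hXP 1 le_rfl hn))

end IsAngulation

end NExang

theorem proposition4p8 {C : Type u} [Category.{v} C] [Preadditive C] [HasZeroObject C]
    [HasBinaryBiproducts C] (n : ℕ) (hn : 1 ≤ n) (S : C ⥤ C) [S.IsEquivalence] [S.Additive]
    (Θ : Set (NExang.SigmaSeq n S)) (hΘ : NExang.IsAngulation Θ) (P : ObjectProperty C) :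
    NExang.IsProperClass (NExang.shiftExt S) (NExang.induced Θ)
      (NExang.induced (NExang.leftEpiAngles Θ P)) ∧
    ∃ F : NExang.SubExt (NExang.shiftExt S),
      (∀ Z A : C, (F.carrier Z A : Set (NExang.Ext (NExang.shiftExt S) Z A)) =
        NExang.extOf (NExang.induced (NExang.leftEpiAngles Θ P)) Z A) ∧
      NExang.IsNExangulated n F.functor (F.restrict (NExang.induced Θ)) ∧
      (NExang.IsNExactExt F.functor (F.restrict (NExang.induced Θ)) →
        NExang.leftEpiAngles Θ P = {X | X ∈ Θ ∧ X.δ = 0}) ∧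
      (NExang.IsAngulatedExt F.functor (F.restrict (NExang.induced Θ)) →
        Θ = NExang.leftEpiAngles Θ P) ∧
      (NExang.StronglyCovariantlyFinite Θ P → P.IsStableUnderRetracts →
        (∃ H : C, P H ∧ ¬ IsZero H) → (∃ B : C, ¬ P B) →
        ¬ NExang.IsNExactExt F.functor (F.restrict (NExang.induced Θ)) ∧
        ¬ NExang.IsAngulatedExt F.functor (F.restrict (NExang.induced Θ))) := by
  refine ⟨hΘ.isProperClass hn P, NExang.killedExt S P, hΘ.carrier_killedExt hn P,
    hΘ.isNExangulated_restrict hn P, hΘ.leftEpiAngles_eq_of_isNExactExt hn P,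
    hΘ.eq_leftEpiAngles_of_isAngulatedExt hn P, fun hP hret hH hB =>
      ⟨hΘ.not_isNExactExt hn P hP hret hB, fun h => ?_⟩⟩
  obtain ⟨H, hH, hH'⟩ := hH
  exact hH' (hΘ.isZero_of_isAngulatedExt hn P h hH)
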